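/- Conventions. A finite lattice is geometric if for every element $F$ all maximal chains of $[\hat 0,F]$ have the same cardinality (the common length being the rank $\mathrm{rk}\,F$), every element is a join of atoms, and $\mathrm{rk}(F\wedge G)+\mathrm{rk}(F\vee G)\le \mathrm{rk}\,F+\mathrm{rk}\,G$ for all $F,G$; $F$ is modular if equality holds for all $G$. An embedding of geometric lattices is an injective, join-preserving map sending atoms to atoms. A modular extension of a geometric lattice $L$ is an embedding $\imath\colon L\to E$ of geometric lattices with $\imath(L)=[\hat 0,F_\imath]$, where $F_\imath=\imath(\hat 1)$ is modular in $E$. A modular diagram of $L$ is a triple $(E,\imath,J)$ with $(E,\imath)$ a modular extension and $J$ a finite word in the atoms of $E$; its degree is $|J|-2\left(\mathrm{rk}\bigvee J-\mathrm{rk}\left((\bigvee J)\wedge F_\imath\right)\right)$. For a geometric lattice $L$ with more than one element, $MD(L)$ is the graded $\mathbb Q$-vector space spanned by the modular diagrams of $L$ modulo the relations: (1) $(E,\imath,J)\sim-(E,\imath,J')$ if $J'$ is obtained from $J$ by a transposition of letters; (2) $(E,\imath,J)\sim(E',\varphi\circ\imath,\varphi(J))$ for every embedding $\varphi\colon E\to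 E'$ with $\mathrm{rk}\,E=\mathrm{rk}\,E'$; (3) $(E,\imath,J)\sim 0$ if $F_\imath\vee\bigvee J<\hat 1$; (4) $(E,\imath,J)\sim0$ if $E$ is a product $E_1\times E_2$ of non-trivial geometric lattices with $F_\imath\in E_1\times\{\hat 0\}$; (5) $(E,\imath,J)\sim0$ if there is a modular $F\ge F_\imath$ in $E$ such that exactly two letters of $J$ are not below $F$. The product on $MD(L)$ is $$(E_1,\imath_1,J_1)\bullet(E_2,\imath_2,J_2)=(E_1\cup_LE_2,\ (\imath_1,\imath_2),\ J_1J_2),$$ where $E_1\cup_LE_2=\{(x_1,x_2)\in E_1\times E_2 : \imath_1^{-1}(x_1\wedge F_{\imath_1})=\imath_2^{-1}(x_2\wedge F_{\imath_2})\}$, an atom $H$ of $E_1$ is identified with $(H,\imath_2\imath_1^{-1}(H\wedge F_{\imath_1}))$, and symmetrically for atoms of $E_2$. The unit is $(L,\mathrm{id},\emptyset)$. The differential is given, for a word $J=H_1\cdots H_n$ without repetition, by $$d(E,\imath,J)=\sum_i(-1)^{i+1}\left([H_i,\hat 1],\ H_i\vee\imath,\ H_i\vee(J\setminus H_i)\right),$$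 the sum being over those $i$ such that $H_i\not\le F_\imath$ and there is no $F\ge F_\imath$ in $E$ such that $H_i$ is the only letter of $J$ not below $F$. (Diagrams whose word has a repetition vanish in $MD(L)$ by (1).) **Proposition.** Let $L_1$ and $L_2$ be geometric lattices, each with more than one element. The formulas above define cdga structures on $MD(L_1)$, $MD(L_2)$ and $MD(L_1\times L_2)$, and there is an isomorphism of cdgas $$MD(L_1)\otimes MD(L_2)\;\cong\; MD(L_1\times L_2),\qquad (E_1,\imath_1,J_1)\otimes(E_2,\imath_2,J_2)\mapsto(E_1\times E_2,\ \imath_1\times\imath_2,\ J_1\sqcup J_2),$$ where $J_1\sqcup J_2$ is the word of the atoms $(H,\hat0)$, $H\in J_1$, followed by the atoms $(\hat 0,H)$, $H\in J_2$. Moreover, every modular extension of $L_1\times L_2$ is isomorphic, as an extension of $L_1\times L_2$, to a product $\imath_1\times\imath_2\colon L_1\times L_2\to E_1\times E_2$ of modular extensions of $L_1$ and $L_2$. -/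

import Mathlib

universe u v w

namespace ModularDiagrams

/-! ### Geometric lattices -/

/-- The rank of an element of a finite poset: the length of a longest chain ending at it. -/
noncomputable def rk {E : Type*} [Preorder E] (x : E) : ℕ := (Order.height x).toNat

/-- Finite geometric lattices: well-ranked, atomic and semimodular. -/
class IsGeometricLattice (E : Type*) [Lattice E] [BoundedOrder E] : Prop where
  finite : Finite E
  /-- All maximal chains from `⊥` to `F` have the same number of elements. -/
  wellRanked : ∀ (F : E) (c c' : Set (Set.Iic F)),
    IsMaxChain (· ≤ ·) c → IsMaxChain (· ≤ ·) c' → c.ncard = c'.ncard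
  atomistic : IsAtomistic E
  semimodular : ∀ x y : E, rk (x ⊓ y) + rk (x ⊔ y) ≤ rk x + rk y

section Rank

theorem exists_atom_le_not_le {E : Type*} [Lattice E] [BoundedOrder E] [IsAtomistic E]
    {a b : E} (h : ¬ b ≤ a) : ∃ p, IsAtom p ∧ p ≤ b ∧ ¬ p ≤ a := by
  obtain ⟨s, hs, hat⟩ := isLUB_atoms b
  by_contra! hc
  exact h (hs.2 fun p hp => hc p (hat p hp) (hs.1 hp))

theorem ncard_isMaxChain {E : Type*} [Lattice E] [BoundedOrder E] [Finite E] (r : E → ℕ)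
    (h0 : r ⊥ = 0) (hs : StrictMono r) (hc : ∀ a b, a ⋖ b → r b = r a + 1) (F : E)
    (c : Set (Set.Iic F)) (hm : IsMaxChain (· ≤ ·) c) : c.ncard = r F + 1 := by
  have mem_of : ∀ z : Set.Iic F, (∀ w ∈ c, w ≤ z ∨ z ≤ w) → z ∈ c := by
    intro z hz
    have := hm.2 (t := insert z c) (hm.1.insert fun w hw _ => (hz w hw).symm)
      (Set.subset_insert _ _)
    rw [this]; exact Set.mem_insert _ _
  have key : ∀ n, n ≤ r F → ∃ x ∈ c, r x.1 = n := by
    intro n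
    induction n with
    | zero =>
      intro _
      exact ⟨⟨⊥, bot_le⟩, mem_of _ fun w _ => Or.inr (show (⊥ : E) ≤ w.1 from bot_le), h0⟩
    | succ n ih =>
      intro hn
      obtain ⟨x, hx, hxn⟩ := ih (by omega)
      have hF : (⟨F, le_rfl⟩ : Set.Iic F) ∈ c := mem_of _ fun w _ => Or.inl w.2
      have hxF : x < ⟨F, le_rfl⟩ := by
        refine lt_of_le_of_ne x.2 fun h => ?_
        rw [h] at hxn; simp at hxn; omega
      obtain ⟨y, hy⟩ := (Set.toFinite {y | y ∈ c ∧ x < y}).exists_minimal ⟨_, hF, hxF⟩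
      refine ⟨y, hy.1.1, ?_⟩
      rw [hc x.1 y.1 ?_, hxn]
      refine ⟨hy.1.2, fun z hxz hzy => ?_⟩
      have hzF : z ≤ F := hzy.le.trans y.2
      have hz : (⟨z, hzF⟩ : Set.Iic F) ∈ c := by
        refine mem_of _ fun w hw => ?_
        rcases hm.1.total hw hx with h | h
        · exact Or.inl (le_trans h hxz.le)
        · rcases h.eq_or_lt with h | h
          · exact Or.inl (h ▸ hxz.le)
          · refine Or.inr ?_
            have hyw : y ≤ w := by
              rcases hm.1.total hw hy.1.1 with h' | h'
              · exact hy.2 ⟨hw, h⟩ h'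
              · exact h'
            exact le_trans hzy.le hyw
      exact absurd (hy.2 ⟨hz, hxz⟩ hzy.le) (not_le_of_gt hzy)
  have himg : (fun x : Set.Iic F => r x.1) '' c = ↑(Finset.range (r F + 1)) := by
    ext n
    simp only [Set.mem_image, Finset.coe_range, Set.mem_Iio]
    constructor
    · rintro ⟨x, _, rfl⟩
      exact Nat.lt_succ_of_le (hs.monotone x.2)
    · intro hn
      obtain ⟨x, hx, h⟩ := key n (by omega)
      exact ⟨x, hx, h⟩
  have hinj : Set.InjOn (fun x : Set.Iic F => r x.1) c := by
    intro x hx y hy hxy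
    rcases hm.1.total hx hy with h | h
    · rcases h.eq_or_lt with h | h
      · exact h
      · exact absurd hxy (hs (show x.1 < y.1 from h)).ne
    · rcases h.eq_or_lt with h | h
      · exact h.symm
      · exact absurd hxy (hs (show y.1 < x.1 from h)).ne'
  rw [← hinj.ncard_image, himg, Set.ncard_coe_finset, Finset.card_range]

/-- A finite atomistic lattice with a strictly monotone submodular function that vanishes at `⊥`
and is at most one on atoms is geometric, and this function is the rank. -/
theorem of_rank {E : Type*} [Lattice E] [BoundedOrder E] [Finite E] [IsAtomistic E] (r : E → ℕ)
    (h0 : r ⊥ = 0) (hs : StrictMono r) (ha : ∀ a, IsAtom a → r a ≤ 1)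
    (hm : ∀ x y, r (x ⊓ y) + r (x ⊔ y) ≤ r x + r y) :
    (∀ x : E, rk x = r x) ∧ IsGeometricLattice E := by
  have hcov : ∀ a b, a ⋖ b → r b = r a + 1 := by
    intro a b hab
    obtain ⟨p, hp, hpb, hpa⟩ := exists_atom_le_not_le (not_le_of_gt hab.lt)
    have h1 : a < a ⊔ p := lt_of_le_of_ne le_sup_left fun h => hpa (h ▸ le_sup_right)
    have h2 : a ⊔ p = b := by
      by_contra h
      exact hab.2 h1 (lt_of_le_of_ne (sup_le hab.le hpb) h)
    have h3 := hm a p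
    have h4 := ha p hp
    have h5 := hs hab.lt
    rw [h2] at h3
    omega
  have hht : ∀ x : E, Order.height x = r x := by
    intro x
    apply le_antisymm
    · simpa using Order.height_le_height_apply_of_strictMono r hs x
    · induction hn : r x using Nat.strong_induction_on generalizing x with
      | _ n ih =>
        rcases eq_or_ne x ⊥ with rfl | hx
        · rw [h0] at hn; simp [← hn]
        · obtain ⟨y, -, hy⟩ := exists_le_covBy_of_lt (bot_lt_iff_ne_bot.2 hx)
          have h1 := hcov y x hy
          have h2 := ih (r y) (by omega) y rfl
          rw [← hn, h1]
          push_cast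
          exact (add_le_add_left h2 1).trans (Order.height_add_one_le hy.lt)
  have hrk : ∀ x : E, rk x = r x := fun x => by simp [rk, hht]
  refine ⟨hrk, inferInstance, fun F c c' hc hc' => ?_, inferInstance, fun x y => ?_⟩
  · rw [ncard_isMaxChain r h0 hs hcov F c hc, ncard_isMaxChain r h0 hs hcov F c' hc']
  · simpa only [hrk] using hm x y

theorem rk_strictMono {E : Type*} [Lattice E] [BoundedOrder E] [hE : IsGeometricLattice E] :
    StrictMono (rk : E → ℕ) := by
  have := hE.finite
  intro x y h
  have hfin : ∀ z : E, Order.height z < ⊤ := fun z => by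
    refine lt_of_le_of_lt (Order.height_le (n := (Nat.card E : ℕ∞)) fun p _ => ?_)
      (ENat.natCast_lt_top _)
    have h1 := Nat.card_le_card_of_injective _ p.strictMono.injective
    rw [Nat.card_eq_fintype_card, Fintype.card_fin] at h1
    exact_mod_cast (Nat.le_succ _).trans h1
  have h1 := Order.height_strictMono h (hfin x)
  unfold rk
  lift Order.height x to ℕ using (hfin x).ne with m
  lift Order.height y to ℕ using (hfin y).ne with n
  simpa using h1

theorem rk_mono {E : Type*} [Lattice E] [BoundedOrder E] [IsGeometricLattice E] {x y : E}
    (h : x ≤ y) : rk x ≤ rk y :=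
  rk_strictMono.monotone h

theorem eq_of_le_of_rk_le {E : Type*} [Lattice E] [BoundedOrder E] [IsGeometricLattice E] {x y : E}
    (h : x ≤ y) (hr : rk y ≤ rk x) : x = y := by
  by_contra hne
  have := rk_strictMono (lt_of_le_of_ne h hne)
  omega

theorem rk_bot {E : Type*} [Lattice E] [BoundedOrder E] : rk (⊥ : E) = 0 := by
  simp [rk]

theorem rk_atom {E : Type*} [Lattice E] [BoundedOrder E] {a : E} (ha : IsAtom a) : rk a = 1 := by
  have h : Order.height a = ((1 : ℕ) : ℕ∞) := by
    apply le_antisymm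
    · rw [Order.height_le_coe_iff]
      intro y hy
      rw [ha.2 y hy]; simp
    · have := Order.height_pos_of_bot_lt ha.bot_lt
      simpa using Order.one_le_iff_pos.2 this
  simp [rk, h]

theorem isAtom_of_rk {E : Type*} [Lattice E] [BoundedOrder E] [IsGeometricLattice E] {a : E}
    (h : rk a = 1) : IsAtom a := by
  refine ⟨fun h0 => ?_, fun b hb => ?_⟩
  · rw [h0, rk_bot] at h; omega
  · have h1 := rk_strictMono hb
    exact (eq_of_le_of_rk_le bot_le (by omega)).symm

theorem rk_sup_atom {E : Type*} [Lattice E] [BoundedOrder E] [hE : IsGeometricLattice E] {x a : E}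
    (ha : IsAtom a) (h : ¬ a ≤ x) : rk (x ⊔ a) = rk x + 1 := by
  have h1 := hE.semimodular x a
  have h2 := rk_atom ha
  have h3 : x < x ⊔ a := lt_of_le_of_ne le_sup_left fun e => h (e ▸ le_sup_right)
  have h4 := rk_strictMono h3
  omega

end Rank

/-! ### Modular elements, embeddings, modular extensions -/

/-- Modular elements of a geometric lattice. -/
def IsModular {E : Type*} [Lattice E] (F : E) : Prop :=
  ∀ x : E, rk (F ⊓ x) + rk (F ⊔ x) = rk F + rk x

/-- Embeddings of geometric lattices: injective maps that preserve binary joins (hence the order)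
and send atoms to atoms. -/
structure IsEmbedding {E E' : Type*} [Lattice E] [BoundedOrder E] [Lattice E'] [BoundedOrder E']
    (φ : E → E') : Prop where
  injective : Function.Injective φ
  map_sup : ∀ x y, φ (x ⊔ y) = φ x ⊔ φ y
  map_atom : ∀ a, IsAtom a → IsAtom (φ a)

theorem IsModular.inf_sup {E : Type*} [Lattice E] [BoundedOrder E] [hE : IsGeometricLattice E]
    {F : E} (hF : IsModular F) {a : E} (ha : a ≤ F) (x : E) : F ⊓ (a ⊔ x) = a ⊔ (F ⊓ x) := by
  symm
  refine eq_of_le_of_rk_le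
    (sup_le (le_inf ha le_sup_left) (inf_le_inf_left _ le_sup_right)) ?_
  have h1 := hF (a ⊔ x)
  have h2 := hF x
  have e1 : F ⊔ (a ⊔ x) = F ⊔ x := by rw [← sup_assoc, sup_eq_left.2 ha]
  have h3 := hE.semimodular (a ⊔ (F ⊓ x)) x
  have e2 : a ⊔ (F ⊓ x) ⊔ x = a ⊔ x := by
    rw [sup_assoc, sup_eq_right.2 (inf_le_right : F ⊓ x ≤ x)]
  have h4 : rk (F ⊓ x) ≤ rk ((a ⊔ (F ⊓ x)) ⊓ x) := rk_mono (le_inf le_sup_right inf_le_right)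
  rw [e1] at h1
  rw [e2] at h3
  omega

/-- A modular extension of `L`: a geometric lattice `E` with an embedding `ι : L → E` whose image
is the interval `[⊥, ι ⊤]`, the flat `ι ⊤` being modular in `E`. -/
structure ModularExtension (L : Type u) [Lattice L] [BoundedOrder L] : Type (u + 1) where
  E : Type u
  [lattice : Lattice E]
  [boundedOrder : BoundedOrder E]
  [geometric : IsGeometricLattice E]
  ι : L → E
  isEmbedding : IsEmbedding ι
  range_ι : Set.range ι = Set.Iic (ι ⊤)
  isModular : IsModular (ι ⊤)

namespace ModularExtension

attribute [instance] ModularExtension.lattice ModularExtension.boundedOrder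
  ModularExtension.geometric

variable {L : Type u} [Lattice L] [BoundedOrder L]

/-- The flat `F_ι = ι ⊤` of a modular extension. -/
def flat (X : ModularExtension L) : X.E := X.ι ⊤

theorem ι_le_ι_iff (X : ModularExtension L) {a b : L} : X.ι a ≤ X.ι b ↔ a ≤ b := by
  rw [← sup_eq_right, ← X.isEmbedding.map_sup, X.isEmbedding.injective.eq_iff, sup_eq_right]

theorem ι_le_flat (X : ModularExtension L) (a : L) : X.ι a ≤ X.flat :=
  X.ι_le_ι_iff.2 le_top

theorem exists_ι_eq (X : ModularExtension L) {x : X.E} (h : x ≤ X.flat) : ∃ a, X.ι a = x := by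
  have : x ∈ Set.range X.ι := by rw [X.range_ι]; exact h
  exact this

theorem ι_bot (X : ModularExtension L) : X.ι ⊥ = ⊥ := by
  obtain ⟨a, ha⟩ := X.exists_ι_eq (bot_le : (⊥ : X.E) ≤ X.flat)
  exact le_bot_iff.1 (ha ▸ X.ι_le_ι_iff.2 bot_le)

theorem rk_ι [hL : IsGeometricLattice L] (X : ModularExtension L) (a : L) :
    rk (X.ι a) = rk a := by
  have := hL.finite
  have := hL.atomistic
  refine ((of_rank (fun a : L => rk (X.ι a)) ?_ ?_ ?_ ?_).1 a).symm
  · simp [X.ι_bot, rk_bot]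
  · intro a b h
    exact rk_strictMono (lt_of_le_of_ne (X.ι_le_ι_iff.2 h.le)
      fun e => h.ne (X.isEmbedding.injective e))
  · intro a ha
    exact (rk_atom (X.isEmbedding.map_atom a ha)).le
  · intro a b
    have h1 := X.geometric.semimodular (X.ι a) (X.ι b)
    have h2 : rk (X.ι (a ⊓ b)) ≤ rk (X.ι a ⊓ X.ι b) :=
      rk_mono (le_inf (X.ι_le_ι_iff.2 inf_le_left) (X.ι_le_ι_iff.2 inf_le_right))
    simp only [X.isEmbedding.map_sup]
    omega

/-- The element `ι⁻¹(x ∧ F_ι)` of `L`. -/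
noncomputable def trace (X : ModularExtension L) (x : X.E) : L :=
  (X.exists_ι_eq (inf_le_right : x ⊓ X.flat ≤ X.flat)).choose

theorem ι_trace (X : ModularExtension L) (x : X.E) : X.ι (X.trace x) = x ⊓ X.flat :=
  (X.exists_ι_eq (inf_le_right : x ⊓ X.flat ≤ X.flat)).choose_spec

theorem le_trace_iff (X : ModularExtension L) {x : X.E} {a : L} : a ≤ X.trace x ↔ X.ι a ≤ x := by
  rw [← X.ι_le_ι_iff, ι_trace, le_inf_iff, and_iff_left (X.ι_le_flat a)]

theorem trace_ι (X : ModularExtension L) (a : L) : X.trace (X.ι a) = a :=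
  le_antisymm (by rw [← X.ι_le_ι_iff, ι_trace]; exact inf_le_left) (X.le_trace_iff.2 le_rfl)

theorem trace_mono (X : ModularExtension L) {x y : X.E} (h : x ≤ y) : X.trace x ≤ X.trace y :=
  X.le_trace_iff.2 ((X.ι_trace x).le.trans (inf_le_left.trans h))

theorem trace_inf (X : ModularExtension L) (x y : X.E) :
    X.trace (x ⊓ y) = X.trace x ⊓ X.trace y :=
  le_antisymm (le_inf (X.trace_mono inf_le_left) (X.trace_mono inf_le_right))
    (X.le_trace_iff.2 (le_inf (X.le_trace_iff.1 inf_le_left) (X.le_trace_iff.1 inf_le_right)))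

theorem trace_sup_ι (X : ModularExtension L) (x : X.E) (a : L) :
    X.trace (x ⊔ X.ι a) = X.trace x ⊔ a := by
  apply X.isEmbedding.injective
  rw [ι_trace, X.isEmbedding.map_sup, ι_trace, inf_comm, sup_comm x,
    IsModular.inf_sup (F := X.flat) X.isModular (X.ι_le_flat a), sup_comm, inf_comm]

end ModularExtension

/-! ### Intervals, products and pushouts -/

/-- Upper intervals of geometric lattices are geometric. -/
theorem Ici_geometric {E : Type*} [Lattice E] [BoundedOrder E] [hE : IsGeometricLattice E] (F : E) :
    (∀ x : Set.Ici F, rk x + rk F = rk x.1) ∧ IsGeometricLattice (Set.Ici F) := by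
  have := hE.finite
  have := hE.atomistic
  have hat : ∀ p : E, IsAtom p → ¬ p ≤ F → IsAtom (⟨F ⊔ p, le_sup_left⟩ : Set.Ici F) := by
    intro p hp hpF
    have h1 := rk_sup_atom hp hpF
    refine ⟨fun h => ?_, fun b hb => ?_⟩
    · have : F ⊔ p = F := congrArg Subtype.val h
      exact hpF (this ▸ le_sup_right)
    · have h2 := rk_strictMono (show b.1 < F ⊔ p from hb)
      exact Subtype.ext (eq_of_le_of_rk_le (show F ≤ b.1 from b.2) (by omega)).symm
  have hatom : IsAtomistic (Set.Ici F) := by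
    refine ⟨fun b => ⟨{a | IsAtom a ∧ a ≤ b}, ⟨fun a ha => ha.2, fun c hc => ?_⟩,
      fun a ha => ha.1⟩⟩
    by_contra hbc
    obtain ⟨p, hp, hpb, hpc⟩ := exists_atom_le_not_le (show ¬ b.1 ≤ c.1 from hbc)
    have hpF : ¬ p ≤ F := fun h => hpc (h.trans c.2)
    have h1 : (⟨F ⊔ p, le_sup_left⟩ : Set.Ici F) ≤ c :=
      hc ⟨hat p hp hpF, show F ⊔ p ≤ b.1 from sup_le b.2 hpb⟩
    exact hpc (le_sup_right.trans (show F ⊔ p ≤ c.1 from h1))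
  have hle : ∀ x : Set.Ici F, rk F ≤ rk x.1 := fun x => rk_mono x.2
  have := of_rank (fun x : Set.Ici F => rk x.1 - rk F) ?_ ?_ ?_ ?_
  · refine ⟨fun x => ?_, this.2⟩
    have h1 := this.1 x
    have h2 := hle x
    omega
  · show rk F - rk F = 0
    omega
  · intro x y h
    have h1 := rk_strictMono (show x.1 < y.1 from h)
    have h2 : rk F ≤ rk x.1 := hle x
    show rk x.1 - rk F < rk y.1 - rk F
    omega
  · intro a ha
    have h0 : ¬ a.1 ≤ F := fun h => ha.1 (Subtype.ext (le_antisymm h a.2))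
    obtain ⟨p, hp, hpa, hpF⟩ := exists_atom_le_not_le h0
    have h1 : (⟨F ⊔ p, le_sup_left⟩ : Set.Ici F) = a :=
      (ha.le_iff_eq (hat p hp hpF).1).1 (show F ⊔ p ≤ a.1 from sup_le a.2 hpa)
    have h2 := rk_sup_atom hp hpF
    rw [← h1]
    show rk (F ⊔ p) - rk F ≤ 1
    omega
  · intro x y
    have h1 := hE.semimodular x.1 y.1
    have h2 := hle x
    have h3 := hle y
    have h4 : rk F ≤ rk (x.1 ⊓ y.1) := rk_mono (le_inf x.2 y.2)
    have h5 : rk F ≤ rk (x.1 ⊔ y.1) := hle (x ⊔ y)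
    show rk (x.1 ⊓ y.1) - rk F + (rk (x.1 ⊔ y.1) - rk F) ≤ rk x.1 - rk F + (rk y.1 - rk F)
    omega

instance {E : Type*} [Lattice E] [BoundedOrder E] [IsGeometricLattice E] (F : E) :
    IsGeometricLattice (Set.Ici F) := (Ici_geometric F).2

/-- Products of geometric lattices are geometric. -/
theorem prod_geometric {E E' : Type*} [Lattice E] [BoundedOrder E] [hE : IsGeometricLattice E]
    [Lattice E'] [BoundedOrder E'] [hE' : IsGeometricLattice E'] :
    (∀ x : E × E', rk x = rk x.1 + rk x.2) ∧ IsGeometricLattice (E × E') := by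
  have := hE.finite
  have := hE'.finite
  have := hE.atomistic
  have := hE'.atomistic
  have hatom : IsAtomistic (E × E') := by
    refine ⟨fun b => ⟨{a | IsAtom a ∧ a ≤ b}, ⟨fun a ha => ha.2, fun c hc => ?_⟩,
      fun a ha => ha.1⟩⟩
    constructor
    · by_contra hbc
      obtain ⟨p, hp, hpb, hpc⟩ := exists_atom_le_not_le hbc
      have : IsAtom ((p, ⊥) : E × E') := by
        refine ⟨fun h => hp.1 (congrArg Prod.fst h), fun d hd => ?_⟩
        have h2 : d.2 = ⊥ := le_bot_iff.1 hd.le.2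
        have h1 : d.1 < p := lt_of_le_of_ne hd.le.1 fun h => hd.ne (Prod.ext h h2)
        exact Prod.ext (hp.2 _ h1) h2
      exact hpc (hc ⟨this, ⟨hpb, bot_le⟩⟩).1
    · by_contra hbc
      obtain ⟨p, hp, hpb, hpc⟩ := exists_atom_le_not_le hbc
      have : IsAtom ((⊥, p) : E × E') := by
        refine ⟨fun h => hp.1 (congrArg Prod.snd h), fun d hd => ?_⟩
        have h2 : d.1 = ⊥ := le_bot_iff.1 hd.le.1
        have h1 : d.2 < p := lt_of_le_of_ne hd.le.2 fun h => hd.ne (Prod.ext h2 h)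
        exact Prod.ext h2 (hp.2 _ h1)
      exact hpc (hc ⟨this, ⟨bot_le, hpb⟩⟩).2
  refine of_rank (fun x : E × E' => rk x.1 + rk x.2) ?_ ?_ ?_ ?_
  · simp [rk_bot]
  · intro x y h
    rcases Prod.lt_iff.1 h with ⟨h1, h2⟩ | ⟨h1, h2⟩
    · exact add_lt_add_of_lt_of_le (rk_strictMono h1) (rk_mono h2)
    · exact add_lt_add_of_le_of_lt (rk_mono h1) (rk_strictMono h2)
  · intro a ha
    rcases eq_or_ne a.1 ⊥ with h | h
    · have : IsAtom a.2 := by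
        refine ⟨fun h' => ha.1 (Prod.ext h h'), fun b hb => ?_⟩
        exact congrArg Prod.snd (ha.2 (a.1, b) (Prod.lt_iff.2 (Or.inr ⟨le_rfl, hb⟩)))
      simp [h, rk_bot, rk_atom this]
    · have h3 : ((a.1, ⊥) : E × E') ≤ a := ⟨le_rfl, (bot_le : ⊥ ≤ a.2)⟩
      have h2 : (a.1, ⊥) = a := by
        have h4 : ((a.1, ⊥) : E × E') ≠ ⊥ := fun h' => h (congrArg Prod.fst h')
        exact (ha.le_iff_eq h4).1 h3
      have : IsAtom a.1 := by
        refine ⟨h, fun b hb => ?_⟩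
        exact congrArg Prod.fst (ha.2 (b, a.2) (Prod.lt_iff.2 (Or.inl ⟨hb, le_rfl⟩)))
      rw [← h2]
      simp [rk_bot, rk_atom this]
  · intro x y
    have h1 := hE.semimodular x.1 y.1
    have h2 := hE'.semimodular x.2 y.2
    show rk (x.1 ⊓ y.1) + rk (x.2 ⊓ y.2) + (rk (x.1 ⊔ y.1) + rk (x.2 ⊔ y.2)) ≤ _
    omega

instance {E E' : Type*} [Lattice E] [BoundedOrder E] [IsGeometricLattice E]
    [Lattice E'] [BoundedOrder E'] [IsGeometricLattice E'] : IsGeometricLattice (E × E') :=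
  prod_geometric.2

theorem isAtom_prod_left {E E' : Type*} [Lattice E] [BoundedOrder E] [IsGeometricLattice E]
    [Lattice E'] [BoundedOrder E'] [IsGeometricLattice E'] {p : E} (hp : IsAtom p) :
    IsAtom ((p, ⊥) : E × E') :=
  isAtom_of_rk (by rw [prod_geometric.1]; simp [rk_bot, rk_atom hp])

theorem isAtom_prod_right {E E' : Type*} [Lattice E] [BoundedOrder E] [IsGeometricLattice E]
    [Lattice E'] [BoundedOrder E'] [IsGeometricLattice E'] {p : E'} (hp : IsAtom p) :
    IsAtom ((⊥, p) : E × E') :=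
  isAtom_of_rk (by rw [prod_geometric.1]; simp [rk_bot, rk_atom hp])

namespace ModularExtension

/-- The product `ι₁ × ι₂ : L₁ × L₂ → E₁ × E₂` of two modular extensions. -/
def prod {L₁ L₂ : Type u} [Lattice L₁] [BoundedOrder L₁] [Lattice L₂] [BoundedOrder L₂]
    [IsGeometricLattice L₁] [IsGeometricLattice L₂]
    (X₁ : ModularExtension L₁) (X₂ : ModularExtension L₂) : ModularExtension (L₁ × L₂) where
  E := X₁.E × X₂.E
  ι l := (X₁.ι l.1, X₂.ι l.2)
  isEmbedding :=
    { injective := fun a b h => Prod.ext (X₁.isEmbedding.injective (congrArg Prod.fst h))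
        (X₂.isEmbedding.injective (congrArg Prod.snd h))
      map_sup := fun a b => Prod.ext (X₁.isEmbedding.map_sup _ _) (X₂.isEmbedding.map_sup _ _)
      map_atom := fun a ha => by
        have h := rk_atom ha
        rw [prod_geometric.1] at h
        exact isAtom_of_rk (by rw [prod_geometric.1]; simpa [rk_ι] using h) }
  range_ι := by
    ext x
    constructor
    · rintro ⟨l, rfl⟩
      exact ⟨X₁.ι_le_flat _, X₂.ι_le_flat _⟩
    · rintro ⟨h1, h2⟩
      obtain ⟨a, ha⟩ := X₁.exists_ι_eq h1
      obtain ⟨b, hb⟩ := X₂.exists_ι_eq h2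
      exact ⟨(a, b), Prod.ext ha hb⟩
  isModular := by
    intro x
    have h1 := X₁.isModular x.1
    have h2 := X₂.isModular x.2
    simp only [prod_geometric.1, Prod.fst_inf, Prod.snd_inf, Prod.fst_sup, Prod.snd_sup,
      Prod.fst_top, Prod.snd_top]
    omega

/-- For an atom `H` of `E` that is not below `F_ι`, the interval `[H, ⊤]` with the embedding
`l ↦ H ∨ ι l`. -/
def contract {L : Type u} [Lattice L] [BoundedOrder L] [IsGeometricLattice L]
    (X : ModularExtension L) (H : X.E) (hH : IsAtom H) (hHF : ¬ H ≤ X.flat) :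
    ModularExtension L where
  E := Set.Ici H
  ι l := ⟨H ⊔ X.ι l, le_sup_left⟩
  isEmbedding :=
    { injective := fun a b h => by
        have h1 : H ⊔ X.ι a = H ⊔ X.ι b := congrArg Subtype.val h
        have h2 : X.trace H = ⊥ := by
          apply X.isEmbedding.injective
          rw [ι_trace, ι_bot]
          rcases hH.le_iff.1 (inf_le_left : H ⊓ X.flat ≤ H) with h | h
          · exact h
          · exact absurd (inf_eq_left.1 h) hHF
        have h3 := congrArg X.trace h1
        rwa [trace_sup_ι, trace_sup_ι, h2, bot_sup_eq, bot_sup_eq] at h3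
      map_sup := fun a b => Subtype.ext (by
        show H ⊔ X.ι (a ⊔ b) = H ⊔ X.ι a ⊔ (H ⊔ X.ι b)
        rw [X.isEmbedding.map_sup, sup_sup_distrib_left])
      map_atom := fun a ha => isAtom_of_rk (by
        have h1 := (Ici_geometric H).1 ⟨H ⊔ X.ι a, le_sup_left⟩
        have h2 : ¬ H ≤ X.ι a := fun h => hHF (h.trans (X.ι_le_flat a))
        have h3 := rk_sup_atom hH h2
        have h4 := rk_atom (X.isEmbedding.map_atom a ha)
        have h5 := rk_atom hH
        rw [sup_comm] at h3
        simp only at h1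
        omega) }
  range_ι := by
    ext x
    constructor
    · rintro ⟨l, rfl⟩
      exact sup_le_sup_left (X.ι_le_flat l) H
    · intro hx
      have hx' : x.1 ≤ H ⊔ X.flat := hx
      obtain ⟨l, hl⟩ := X.exists_ι_eq (inf_le_left : X.flat ⊓ x.1 ≤ X.flat)
      refine ⟨l, Subtype.ext ?_⟩
      show H ⊔ X.ι l = x.1
      have h0 : H ≤ x.1 := x.2
      have h1 := X.isModular.inf_sup (a := X.flat ⊓ x.1) inf_le_left H
      have e : X.flat ⊔ x.1 = X.flat ⊔ H :=
        le_antisymm (sup_le le_sup_left (hx'.trans (by rw [sup_comm])))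
          (sup_le_sup_left h0 _)
      have h2 := X.isModular x.1
      have h3 := rk_sup_atom hH hHF
      have h4 : ¬ H ≤ X.flat ⊓ x.1 := fun h => hHF (h.trans inf_le_left)
      have h5 := rk_sup_atom hH h4
      change rk (X.flat ⊓ x.1) + rk (X.flat ⊔ x.1) = rk X.flat + rk x.1 at h2
      rw [e] at h2
      rw [hl, sup_comm]
      exact eq_of_le_of_rk_le (sup_le inf_le_right h0) (by omega)
  isModular := by
    intro x
    have r := (Ici_geometric H).1
    set F : Set.Ici H := ⟨H ⊔ X.ι ⊤, le_sup_left⟩ with hF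
    have h1 := r (F ⊓ x)
    have h2 := r (F ⊔ x)
    have h3 := r F
    have h4 := r x
    have h0 : H ≤ x.1 := x.2
    have e1 : (F ⊔ x).1 = X.ι ⊤ ⊔ x.1 := by
      show H ⊔ X.ι ⊤ ⊔ x.1 = _
      rw [sup_comm H, sup_assoc, sup_eq_right.2 h0]
    have h5 := X.isModular x.1
    have h6 : rk (X.ι ⊤ ⊓ x.1) + 1 ≤ rk (F ⊓ x).1 := by
      have h7 : ¬ H ≤ X.ι ⊤ ⊓ x.1 := fun h => hHF (h.trans inf_le_left)
      rw [← rk_sup_atom hH h7]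
      exact rk_mono (sup_le (inf_le_inf_right _ le_sup_right) (le_inf le_sup_left h0))
    have h8 : rk F.1 = rk (X.ι ⊤) + 1 := by
      have := rk_sup_atom hH hHF
      rw [sup_comm] at this
      exact this
    have h9 := IsGeometricLattice.semimodular F.1 x.1
    have e2 : (F ⊓ x).1 = F.1 ⊓ x.1 := rfl
    have e3 : (F ⊔ x).1 = F.1 ⊔ x.1 := rfl
    rw [← e2, ← e3] at h9
    rw [e1] at h2 h9
    omega

section Pushout

variable {L : Type u} [Lattice L] [BoundedOrder L]

theorem rk_sup_flat (X : ModularExtension L) (x : X.E) :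
    rk (x ⊔ X.flat) + rk (X.ι (X.trace x)) = rk x + rk X.flat := by
  have h := X.isModular x
  change rk (X.flat ⊓ x) + rk (X.flat ⊔ x) = rk X.flat + rk x at h
  rw [ι_trace, sup_comm, inf_comm]
  omega

/-- The carrier of the pushout `E₁ ∪_L E₂` of two modular extensions: the subposet of `E₁ × E₂` of
the pairs `(x₁, x₂)` with `ι₁⁻¹(x₁ ∧ F_{ι₁}) = ι₂⁻¹(x₂ ∧ F_{ι₂})`. -/
abbrev Pushout (X₁ X₂ : ModularExtension L) : Type u :=
  {p : X₁.E × X₂.E // X₁.trace p.1 = X₂.trace p.2}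

/-- Joins in the pushout: the componentwise join has to be completed by the traces of its two
components. -/
noncomputable def Pushout.sup {X₁ X₂ : ModularExtension L} (p q : Pushout X₁ X₂) : Pushout X₁ X₂ :=
  ⟨(p.1.1 ⊔ q.1.1 ⊔ X₁.ι (X₁.trace (p.1.1 ⊔ q.1.1) ⊔ X₂.trace (p.1.2 ⊔ q.1.2)),
    p.1.2 ⊔ q.1.2 ⊔ X₂.ι (X₁.trace (p.1.1 ⊔ q.1.1) ⊔ X₂.trace (p.1.2 ⊔ q.1.2))), by
    rw [trace_sup_ι, trace_sup_ι, ← sup_assoc, sup_idem, sup_left_comm, sup_idem]⟩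

noncomputable instance (X₁ X₂ : ModularExtension L) : Lattice (Pushout X₁ X₂) where
  sup := Pushout.sup
  le_sup_left p q := ⟨le_sup_left.trans le_sup_left, le_sup_left.trans le_sup_left⟩
  le_sup_right p q := ⟨le_sup_right.trans le_sup_left, le_sup_right.trans le_sup_left⟩
  sup_le p q s hp hq := by
    have h1 : p.1.1 ⊔ q.1.1 ≤ s.1.1 := sup_le hp.1 hq.1
    have h2 : p.1.2 ⊔ q.1.2 ≤ s.1.2 := sup_le hp.2 hq.2
    refine ⟨sup_le h1 (X₁.le_trace_iff.1 (sup_le (X₁.trace_mono h1) ?_)),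
      sup_le h2 (X₂.le_trace_iff.1 (sup_le ?_ (X₂.trace_mono h2)))⟩
    · rw [s.2]; exact X₂.trace_mono h2
    · rw [← s.2]; exact X₁.trace_mono h1
  inf p q := ⟨p.1 ⊓ q.1, by
    simp only [Prod.fst_inf, Prod.snd_inf, trace_inf, p.2, q.2]⟩
  inf_le_left p q := (inf_le_left : p.1 ⊓ q.1 ≤ p.1)
  inf_le_right p q := (inf_le_right : p.1 ⊓ q.1 ≤ q.1)
  le_inf p q s hq hs := (le_inf hq hs : p.1 ≤ q.1 ⊓ s.1)

theorem trace_top (X : ModularExtension L) : X.trace ⊤ = ⊤ :=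
  top_le_iff.1 (X.le_trace_iff.2 le_top)

theorem trace_bot (X : ModularExtension L) : X.trace ⊥ = ⊥ := by
  rw [← ι_bot, trace_ι]

noncomputable instance (X₁ X₂ : ModularExtension L) : BoundedOrder (Pushout X₁ X₂) where
  top := ⟨⊤, by simp only [Prod.fst_top, Prod.snd_top, trace_top]⟩
  le_top p := (le_top : p.1 ≤ ⊤)
  bot := ⟨⊥, by simp only [Prod.fst_bot, Prod.snd_bot, trace_bot]⟩
  bot_le p := (bot_le : ⊥ ≤ p.1)

/-- The embedding `E₁ → E₁ ∪_L E₂`. -/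
noncomputable def inl (X₁ X₂ : ModularExtension L) (x : X₁.E) : Pushout X₁ X₂ :=
  ⟨(x, X₂.ι (X₁.trace x)), (X₂.trace_ι _).symm⟩

/-- The embedding `E₂ → E₁ ∪_L E₂`. -/
noncomputable def inr (X₁ X₂ : ModularExtension L) (x : X₂.E) : Pushout X₁ X₂ :=
  ⟨(X₁.ι (X₂.trace x), x), X₁.trace_ι _⟩

theorem inl_le_iff {X₁ X₂ : ModularExtension L} {x : X₁.E} {p : Pushout X₁ X₂} :
    X₁.inl X₂ x ≤ p ↔ x ≤ p.1.1 := by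
  refine ⟨fun h => h.1, fun h => ⟨h, X₂.le_trace_iff.1 ?_⟩⟩
  rw [← p.2]
  exact X₁.trace_mono h

theorem inr_le_iff {X₁ X₂ : ModularExtension L} {x : X₂.E} {p : Pushout X₁ X₂} :
    X₁.inr X₂ x ≤ p ↔ x ≤ p.1.2 := by
  refine ⟨fun h => h.2, fun h => ⟨X₁.le_trace_iff.1 ?_, h⟩⟩
  rw [p.2]
  exact X₂.trace_mono h

theorem trace_atom (X : ModularExtension L) {a : X.E} (ha : IsAtom a) (h : ¬ a ≤ X.flat) :
    X.trace a = ⊥ := by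
  apply X.isEmbedding.injective
  rw [ι_trace, ι_bot]
  rcases ha.le_iff.1 (inf_le_left : a ⊓ X.flat ≤ a) with h' | h'
  · exact h'
  · exact absurd (inf_eq_left.1 h') h

theorem isAtom_inl (X₁ X₂ : ModularExtension L) {a : X₁.E} (ha : IsAtom a) :
    IsAtom (X₁.inl X₂ a) := by
  refine ⟨fun h => ha.1 (congrArg (fun p => p.1.1) h), fun b hb => ?_⟩
  have h1 : b.1.1 ≤ a := hb.le.1
  rcases ha.le_iff.1 h1 with h | h
  · have h2 : b.1.2 ≤ X₂.ι (X₁.trace a) := hb.le.2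
    have h3 : X₂.trace b.1.2 = ⊥ := by rw [← b.2, h, trace_bot]
    have h4 : b.1.2 = ⊥ := by
      have := X₂.ι_trace b.1.2
      rw [h3, ι_bot, inf_eq_left.2 (h2.trans (X₂.ι_le_flat _))] at this
      exact this.symm
    exact Subtype.ext (Prod.ext h h4)
  · exact absurd (inl_le_iff.2 h.ge) (not_le_of_gt hb)

theorem isAtom_inr (X₁ X₂ : ModularExtension L) {a : X₂.E} (ha : IsAtom a) :
    IsAtom (X₁.inr X₂ a) := by
  refine ⟨fun h => ha.1 (congrArg (fun p => p.1.2) h), fun b hb => ?_⟩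
  have h1 : b.1.2 ≤ a := hb.le.2
  rcases ha.le_iff.1 h1 with h | h
  · have h2 : b.1.1 ≤ X₁.ι (X₂.trace a) := hb.le.1
    have h3 : X₁.trace b.1.1 = ⊥ := by rw [b.2, h, trace_bot]
    have h4 : b.1.1 = ⊥ := by
      have := X₁.ι_trace b.1.1
      rw [h3, ι_bot, inf_eq_left.2 (h2.trans (X₁.ι_le_flat _))] at this
      exact this.symm
    exact Subtype.ext (Prod.ext h4 h)
  · exact absurd (inr_le_iff.2 h.ge) (not_le_of_gt hb)

variable [hL : IsGeometricLattice L]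

theorem trace_sup_submodular (X : ModularExtension L) (x y : X.E) :
    (rk (x ⊔ y ⊔ X.flat) + rk (x ⊓ y ⊔ X.flat)) + rk (X.trace (x ⊔ y))
      ≤ (rk (x ⊔ X.flat) + rk (y ⊔ X.flat)) + rk (X.trace x ⊔ X.trace y) := by
  set T := X.trace x ⊔ X.trace y with hT
  have h1 := X.geometric.semimodular (x ⊔ X.ι T) (y ⊔ X.ι T)
  have e1 : x ⊔ X.ι T ⊔ (y ⊔ X.ι T) = x ⊔ y := by
    rw [← sup_sup_distrib_right, sup_eq_left]
    rw [← le_trace_iff]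
    exact sup_le (X.trace_mono le_sup_left) (X.trace_mono le_sup_right)
  have f1 := X.rk_sup_flat (x ⊔ y)
  have f2 := X.rk_sup_flat (x ⊔ X.ι T)
  have f3 := X.rk_sup_flat (y ⊔ X.ι T)
  have f4 := X.rk_sup_flat ((x ⊔ X.ι T) ⊓ (y ⊔ X.ι T))
  have t2 : X.trace (x ⊔ X.ι T) = T := by rw [trace_sup_ι, hT, ← sup_assoc, sup_idem]
  have t3 : X.trace (y ⊔ X.ι T) = T := by
    rw [trace_sup_ι, hT, sup_left_comm, sup_idem]
  have s : ∀ z : X.E, z ⊔ X.ι T ⊔ X.flat = z ⊔ X.flat := fun z => by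
    rw [sup_assoc, sup_eq_right.2 (X.ι_le_flat T)]
  have h2 : rk (x ⊓ y ⊔ X.flat) ≤ rk ((x ⊔ X.ι T) ⊓ (y ⊔ X.ι T) ⊔ X.flat) :=
    rk_mono (sup_le_sup_right (inf_le_inf le_sup_left le_sup_left) _)
  rw [trace_inf] at f4
  rw [s] at f2 f3
  rw [t2] at f2 f4
  rw [t3] at f3 f4
  rw [inf_idem] at f4
  rw [e1] at h1
  simp only [rk_ι] at f1 f2 f3 f4
  omega

/-- The rank function of the pushout is
`rk (x₁, x₂) = rk x₁ + rk x₂ - rk (ι₁⁻¹(x₁ ∧ F_{ι₁}))`, and the pushout is geometric. -/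
theorem pushout_geometric (X₁ X₂ : ModularExtension L) :
    (∀ p : Pushout X₁ X₂, rk p + rk (X₁.trace p.1.1) = rk p.1.1 + rk p.1.2) ∧
      IsGeometricLattice (Pushout X₁ X₂) := by
  have := X₁.geometric.finite
  have := X₂.geometric.finite
  have := X₁.geometric.atomistic
  have := X₂.geometric.atomistic
  have hatom : IsAtomistic (Pushout X₁ X₂) := by
    refine ⟨fun b => ⟨{a | IsAtom a ∧ a ≤ b}, ⟨fun a ha => ha.2, fun c hc => ?_⟩,
      fun a ha => ha.1⟩⟩
    constructor
    · by_contra hbc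
      obtain ⟨p, hp, hpb, hpc⟩ := exists_atom_le_not_le hbc
      exact hpc (inl_le_iff.1 (hc ⟨X₁.isAtom_inl X₂ hp, inl_le_iff.2 hpb⟩))
    · by_contra hbc
      obtain ⟨p, hp, hpb, hpc⟩ := exists_atom_le_not_le hbc
      exact hpc (inr_le_iff.1 (hc ⟨X₁.isAtom_inr X₂ hp, inr_le_iff.2 hpb⟩))
  have hF1 : rk X₁.flat = rk (⊤ : L) := X₁.rk_ι ⊤
  have hF2 : rk X₂.flat = rk (⊤ : L) := X₂.rk_ι ⊤
  have hle : ∀ p : Pushout X₁ X₂, rk (X₁.trace p.1.1) ≤ rk p.1.1 := fun p => by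
    rw [← X₁.rk_ι, ι_trace]
    exact rk_mono inf_le_left
  -- the same rank function, written symmetrically
  have hc1 : ∀ p : Pushout X₁ X₂, rk (p.1.1 ⊔ X₁.flat) + rk (X₁.trace p.1.1)
      = rk p.1.1 + rk (⊤ : L) := fun p => by
    have := X₁.rk_sup_flat p.1.1
    rwa [rk_ι, hF1] at this
  have hc2 : ∀ p : Pushout X₁ X₂, rk (p.1.2 ⊔ X₂.flat) + rk (X₁.trace p.1.1)
      = rk p.1.2 + rk (⊤ : L) := fun p => by
    have := X₂.rk_sup_flat p.1.2
    rwa [rk_ι, hF2, ← p.2] at this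
  have := of_rank (fun p : Pushout X₁ X₂ => rk p.1.1 + rk p.1.2 - rk (X₁.trace p.1.1)) ?_ ?_ ?_ ?_
  · refine ⟨fun p => ?_, this.2⟩
    rw [this.1 p]
    have := hle p
    omega
  · show rk (⊥ : X₁.E) + rk (⊥ : X₂.E) - _ = 0
    simp [rk_bot]
  · intro p q h
    have k1 := hc1 p
    have k2 := hc1 q
    have k3 := hle p
    have k4 := hle q
    have m1 : rk (p.1.1 ⊔ X₁.flat) ≤ rk (q.1.1 ⊔ X₁.flat) := rk_mono (sup_le_sup_right h.le.1 _)
    have m2 : rk p.1.2 ≤ rk q.1.2 := rk_mono h.le.2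
    show rk p.1.1 + rk p.1.2 - rk (X₁.trace p.1.1) < rk q.1.1 + rk q.1.2 - rk (X₁.trace q.1.1)
    by_cases hpq : p.1.2 = q.1.2
    · have ht : X₁.trace p.1.1 = X₁.trace q.1.1 := by rw [p.2, q.2, hpq]
      have h1 : p.1.1 < q.1.1 :=
        lt_of_le_of_ne h.le.1 fun e => h.ne (Subtype.ext (Prod.ext e hpq))
      have h2 := rk_strictMono h1
      rw [ht] at k3 ⊢
      omega
    · have h1 := rk_strictMono (lt_of_le_of_ne h.le.2 hpq)
      omega
  · intro a ha
    by_cases h : a.1.1 = ⊥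
    · have h0 : a.1.2 ≠ ⊥ := fun h' => ha.1 (Subtype.ext (Prod.ext h h'))
      obtain ⟨p, hp, hpa, -⟩ := exists_atom_le_not_le (fun h' => h0 (le_bot_iff.1 h') :
        ¬ a.1.2 ≤ ⊥)
      have h1 : X₁.inr X₂ p = a :=
        (ha.le_iff_eq (X₁.isAtom_inr X₂ hp).1).1 (inr_le_iff.2 hpa)
      have h2 : a.1.2 = p := by rw [← h1]; rfl
      simp [h, h2, rk_bot, rk_atom hp]
    · obtain ⟨p, hp, hpa, -⟩ := exists_atom_le_not_le (fun h' => h (le_bot_iff.1 h') :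
        ¬ a.1.1 ≤ ⊥)
      have h1 : X₁.inl X₂ p = a :=
        (ha.le_iff_eq (X₁.isAtom_inl X₂ hp).1).1 (inl_le_iff.2 hpa)
      rw [← h1]
      show rk p + rk (X₂.ι (X₁.trace p)) - rk (X₁.trace p) ≤ 1
      rw [rk_ι, rk_atom hp]
      omega
  · intro p q
    show rk (p.1.1 ⊓ q.1.1) + rk (p.1.2 ⊓ q.1.2) - rk (X₁.trace (p.1.1 ⊓ q.1.1)) +
      (rk (p ⊔ q).1.1 + rk (p ⊔ q).1.2 - rk (X₁.trace (p ⊔ q).1.1)) ≤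
      rk p.1.1 + rk p.1.2 - rk (X₁.trace p.1.1) + (rk q.1.1 + rk q.1.2 - rk (X₁.trace q.1.1))
    have a1 := hc1 p
    have a2 := hc1 q
    have a3 := hc1 (p ⊓ q)
    have a4 := hc1 (p ⊔ q)
    have b1 := hc2 p
    have b2 := hc2 q
    have b3 := hc2 (p ⊓ q)
    have b4 := hc2 (p ⊔ q)
    have c1 := hle p
    have c2 := hle q
    have c3 := hle (p ⊓ q)
    have c4 := hle (p ⊔ q)
    have d1 := X₁.trace_sup_submodular p.1.1 q.1.1
    have d2 := X₂.trace_sup_submodular p.1.2 q.1.2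
    have i1 : (p ⊓ q).1.1 = p.1.1 ⊓ q.1.1 := rfl
    have i2 : (p ⊓ q).1.2 = p.1.2 ⊓ q.1.2 := rfl
    have j1 : (p ⊔ q).1.1 ⊔ X₁.flat = p.1.1 ⊔ q.1.1 ⊔ X₁.flat := by
      show _ ⊔ X₁.ι _ ⊔ X₁.flat = _
      rw [sup_assoc, sup_eq_right.2 (X₁.ι_le_flat _)]
    have j2 : (p ⊔ q).1.2 ⊔ X₂.flat = p.1.2 ⊔ q.1.2 ⊔ X₂.flat := by
      show _ ⊔ X₂.ι _ ⊔ X₂.flat = _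
      rw [sup_assoc, sup_eq_right.2 (X₂.ι_le_flat _)]
    have j3 : X₁.trace (p ⊔ q).1.1 = X₁.trace (p.1.1 ⊔ q.1.1) ⊔ X₂.trace (p.1.2 ⊔ q.1.2) := by
      show X₁.trace (_ ⊔ X₁.ι _) = _
      rw [trace_sup_ι, ← sup_assoc, sup_idem]
    have e1 := hL.semimodular (X₁.trace (p.1.1 ⊔ q.1.1)) (X₂.trace (p.1.2 ⊔ q.1.2))
    have e2 : rk (X₁.trace p.1.1 ⊔ X₁.trace q.1.1) ≤
        rk (X₁.trace (p.1.1 ⊔ q.1.1) ⊓ X₂.trace (p.1.2 ⊔ q.1.2)) := by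
      refine rk_mono (le_inf (sup_le (X₁.trace_mono le_sup_left) (X₁.trace_mono le_sup_right)) ?_)
      rw [p.2, q.2]
      exact sup_le (X₂.trace_mono le_sup_left) (X₂.trace_mono le_sup_right)
    have e3 := hL.semimodular (X₁.trace p.1.1) (X₁.trace q.1.1)
    rw [i1, trace_inf] at a3 c3
    rw [i1, i2, trace_inf] at b3
    rw [j1, j3] at a4
    rw [j2, j3] at b4
    rw [j3] at c4 ⊢
    rw [trace_inf]
    rw [← p.2, ← q.2] at d2
    omega

instance (X₁ X₂ : ModularExtension L) : IsGeometricLattice (Pushout X₁ X₂) :=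
  (pushout_geometric X₁ X₂).2

/-- The pushout `E₁ ∪_L E₂` as a modular extension of `L`. -/
noncomputable def pushout (X₁ X₂ : ModularExtension L) : ModularExtension L where
  E := Pushout X₁ X₂
  ι l := ⟨(X₁.ι l, X₂.ι l), by rw [trace_ι, trace_ι]⟩
  isEmbedding :=
    { injective := fun a b h => X₁.isEmbedding.injective (congrArg (fun p => p.1.1) h)
      map_sup := fun a b => by
        apply Subtype.ext
        show (X₁.ι (a ⊔ b), X₂.ι (a ⊔ b)) = (X₁.ι a ⊔ X₁.ι b ⊔ X₁.ι _, X₂.ι a ⊔ X₂.ι b ⊔ X₂.ι _)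
        simp only [← X₁.isEmbedding.map_sup, ← X₂.isEmbedding.map_sup, trace_ι, sup_idem]
      map_atom := fun a ha => by
        have h := X₁.isAtom_inl X₂ (X₁.isEmbedding.map_atom a ha)
        simpa only [inl, trace_ι] using h }
  range_ι := by
    ext p
    constructor
    · rintro ⟨l, rfl⟩
      exact ⟨X₁.ι_le_flat l, X₂.ι_le_flat l⟩
    · rintro ⟨h1, h2⟩
      refine ⟨X₁.trace p.1.1, Subtype.ext (Prod.ext ?_ ?_)⟩
      · show X₁.ι (X₁.trace p.1.1) = _
        rw [ι_trace, inf_eq_left]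
        exact h1
      · show X₂.ι (X₁.trace p.1.1) = _
        rw [p.2, ι_trace, inf_eq_left]
        exact h2
  isModular := by
    intro p
    have r := (pushout_geometric X₁ X₂).1
    set F : Pushout X₁ X₂ := ⟨(X₁.ι ⊤, X₂.ι ⊤), by rw [trace_ι, trace_ι]⟩ with hF
    have r1 := r F
    have r2 := r p
    have r3 := r (F ⊓ p)
    have r4 := r (F ⊔ p)
    have i1 : (F ⊓ p).1.1 = X₁.ι (X₁.trace p.1.1) := by
      rw [ι_trace, inf_comm]; rfl
    have i2 : (F ⊓ p).1.2 = X₂.ι (X₁.trace p.1.1) := by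
      rw [p.2, ι_trace, inf_comm]; rfl
    have j1 : (F ⊔ p).1.1 = p.1.1 ⊔ X₁.flat := by
      show X₁.flat ⊔ p.1.1 ⊔ X₁.ι _ = _
      rw [sup_eq_left.2 ((X₁.ι_le_flat _).trans le_sup_left), sup_comm]
    have j2 : (F ⊔ p).1.2 = p.1.2 ⊔ X₂.flat := by
      show X₂.flat ⊔ p.1.2 ⊔ X₂.ι _ = _
      rw [sup_eq_left.2 ((X₂.ι_le_flat _).trans le_sup_left), sup_comm]
    have t1 : X₁.trace (F ⊔ p).1.1 = ⊤ := by
      rw [j1]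
      exact top_le_iff.1 (X₁.le_trace_iff.2 le_sup_right)
    have s1 := X₁.rk_sup_flat p.1.1
    have s2 := X₂.rk_sup_flat p.1.2
    have hF1 : rk X₁.flat = rk (⊤ : L) := X₁.rk_ι ⊤
    have hF2 : rk X₂.flat = rk (⊤ : L) := X₂.rk_ι ⊤
    have f1 : F.1.1 = X₁.ι ⊤ := rfl
    have f2 : F.1.2 = X₂.ι ⊤ := rfl
    rw [f1, f2, trace_ι, rk_ι, rk_ι] at r1
    rw [i1, i2, trace_ι, rk_ι, rk_ι] at r3
    rw [t1, j1, j2] at r4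
    rw [hF1, rk_ι] at s1
    rw [hF2, rk_ι, ← p.2] at s2
    omega

end Pushout

end ModularExtension
/-! ### Commutative differential graded algebras -/

open scoped TensorProduct

/-- The structure of a (cohomologically `ℤ`-graded, unital) cdga on a rational vector space. -/
structure CDGA (A : Type*) [AddCommGroup A] [Module ℚ A] where
  gr : ℤ → Submodule ℚ A
  isInternal : DirectSum.IsInternal gr
  one : A
  mul : A →ₗ[ℚ] A →ₗ[ℚ] A
  d : A →ₗ[ℚ] A
  one_mem : one ∈ gr 0
  mul_mem : ∀ {i j : ℤ} {a b : A}, a ∈ gr i → b ∈ gr j → mul a b ∈ gr (i + j)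
  one_mul : ∀ a, mul one a = a
  mul_one : ∀ a, mul a one = a
  mul_assoc : ∀ a b c, mul (mul a b) c = mul a (mul b c)
  mul_comm : ∀ {i j : ℤ} {a b : A}, a ∈ gr i → b ∈ gr j →
    mul a b = (-1 : ℚ) ^ (i * j) • mul b a
  d_mem : ∀ {i : ℤ} {a : A}, a ∈ gr i → d a ∈ gr (i + 1)
  d_d : ∀ a, d (d a) = 0
  d_mul : ∀ {i : ℤ} {a : A} (b : A), a ∈ gr i →
    d (mul a b) = mul (d a) b + (-1 : ℚ) ^ i • mul a (d b)

namespace CDGA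

variable {A : Type v} [AddCommGroup A] [Module ℚ A] {B : Type w} [AddCommGroup B] [Module ℚ B]

/-- An isomorphism of cdgas: a linear isomorphism that preserves the degrees, the unit, the product
and the differential. -/
structure Iso (S : CDGA A) (T : CDGA B) extends A ≃ₗ[ℚ] B where
  map_gr : ∀ (n : ℤ) (a : A), toFun a ∈ T.gr n ↔ a ∈ S.gr n
  map_one : toFun S.one = T.one
  map_mul : ∀ a b, toFun (S.mul a b) = T.mul (toFun a) (toFun b)
  map_d : ∀ a, toFun (S.d a) = T.d (toFun a)

@[elab_as_elim]
theorem induction_gr (S : CDGA A) {P : A → Prop} (a : A) (h0 : P 0)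
    (hadd : ∀ x y, P x → P y → P (x + y)) (h : ∀ i, ∀ x ∈ S.gr i, P x) : P a := by
  have ha : a ∈ iSup S.gr := by
    rw [S.isInternal.submodule_iSup_eq_top]; exact Submodule.mem_top
  exact Submodule.iSup_induction S.gr (motive := P) ha h h0 hadd

/-- The decomposition of a cdga into its homogeneous components. -/
noncomputable def dec (S : CDGA A) : A ≃ₗ[ℚ] DirectSum ℤ fun i => S.gr i :=
  (LinearEquiv.ofBijective (DirectSum.coeLinearMap S.gr) (by exact S.isInternal)).symm

theorem dec_of_mem (S : CDGA A) {i : ℤ} {a : A} (ha : a ∈ S.gr i) :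
    S.dec a = DirectSum.lof ℚ ℤ (fun i => S.gr i) i ⟨a, ha⟩ := by
  rw [dec, LinearEquiv.symm_apply_eq]
  exact (DirectSum.coeLinearMap_lof S.gr i ⟨a, ha⟩).symm

/-- The linear involution that is `(-1) ^ i` on the component of degree `i`. -/
noncomputable def sgn (S : CDGA A) : A →ₗ[ℚ] A :=
  DirectSum.toModule ℚ ℤ A (fun i => (-1 : ℚ) ^ i • (S.gr i).subtype) ∘ₗ S.dec.toLinearMap

theorem sgn_of_mem (S : CDGA A) {i : ℤ} {a : A} (ha : a ∈ S.gr i) :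
    S.sgn a = (-1 : ℚ) ^ i • a := by
  simp [sgn, S.dec_of_mem ha]

/-- The differential `d (a ⊗ b) = d a ⊗ b + (-1) ^ |a| a ⊗ d b`. -/
noncomputable def tensorD (S : CDGA A) (T : CDGA B) : A ⊗[ℚ] B →ₗ[ℚ] A ⊗[ℚ] B :=
  TensorProduct.map S.d LinearMap.id + TensorProduct.map S.sgn T.d

/-- The product `(a ⊗ b) (a' ⊗ b') = (-1) ^ (|a'| |b|) (a a') ⊗ (b b')`, obtained by splitting `b`
into its parts of even and of odd degree. -/
noncomputable def tensorMul (S : CDGA A) (T : CDGA B) :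
    A ⊗[ℚ] B →ₗ[ℚ] A ⊗[ℚ] B →ₗ[ℚ] A ⊗[ℚ] B :=
  TensorProduct.lift <| LinearMap.mk₂ ℚ
    (fun a b =>
      TensorProduct.map (S.mul a) (T.mul ((1 / 2 : ℚ) • (b + T.sgn b))) +
      TensorProduct.map (S.mul a ∘ₗ S.sgn) (T.mul ((1 / 2 : ℚ) • (b - T.sgn b))))
    (fun a a' b => by
      simp only [map_add, LinearMap.add_comp, TensorProduct.map_add_left]; abel)
    (fun c a b => by
      simp only [map_smul, LinearMap.smul_comp, TensorProduct.map_smul_left, smul_add])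
    (fun a b b' => by
      have e1 : (1 / 2 : ℚ) • (b + b' + T.sgn (b + b'))
          = (1 / 2 : ℚ) • (b + T.sgn b) + (1 / 2 : ℚ) • (b' + T.sgn b') := by
        rw [map_add, ← smul_add]; congr 1; abel
      have e2 : (1 / 2 : ℚ) • (b + b' - T.sgn (b + b'))
          = (1 / 2 : ℚ) • (b - T.sgn b) + (1 / 2 : ℚ) • (b' - T.sgn b') := by
        rw [map_add, ← smul_add]; congr 1; abel
      rw [e1, e2]
      simp only [map_add, TensorProduct.map_add_right]; abel)
    (fun c a b => by
      simp only [map_smul, ← smul_add, ← smul_sub, smul_comm (1 / 2 : ℚ) c,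
        TensorProduct.map_smul_right])

theorem neg_one_zpow_mul_self (i : ℤ) : (-1 : ℚ) ^ i * (-1 : ℚ) ^ i = 1 := by
  rw [← mul_zpow]; simp

theorem tensorMul_tmul (S : CDGA A) (T : CDGA B) {i j : ℤ} (a : A) {b : B} {a' : A} (b' : B)
    (hb : b ∈ T.gr j) (ha' : a' ∈ S.gr i) :
    tensorMul S T (a ⊗ₜ b) (a' ⊗ₜ b') = (-1 : ℚ) ^ (i * j) • (S.mul a a' ⊗ₜ T.mul b b') := by
  simp only [tensorMul, TensorProduct.lift.tmul, LinearMap.mk₂_apply, LinearMap.add_apply,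
    TensorProduct.map_tmul, LinearMap.comp_apply, S.sgn_of_mem ha', T.sgn_of_mem hb]
  rcases Int.even_or_odd j with hj | hj
  · rw [hj.neg_one_zpow, (hj.mul_left i).neg_one_zpow]
    simp only [one_smul, sub_self, smul_zero, map_zero, LinearMap.zero_apply,
      TensorProduct.tmul_zero, add_zero, ← two_smul ℚ b, smul_smul]
    norm_num
  · have h : (-1 : ℚ) ^ (i * j) = (-1 : ℚ) ^ i := by
      rcases Int.even_or_odd i with hi | hi
      · rw [hi.neg_one_zpow, (hi.mul_right j).neg_one_zpow]
      · rw [hi.neg_one_zpow, (hi.mul hj).neg_one_zpow]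
    rw [hj.neg_one_zpow, h]
    simp only [neg_smul, one_smul, add_neg_cancel, smul_zero, map_zero, LinearMap.zero_apply,
      TensorProduct.tmul_zero, zero_add, sub_neg_eq_add, ← two_smul ℚ b, smul_smul, map_smul,
      TensorProduct.smul_tmul']
    norm_num

theorem tensorD_tmul (S : CDGA A) (T : CDGA B) {i : ℤ} {a : A} (b : B) (ha : a ∈ S.gr i) :
    tensorD S T (a ⊗ₜ b) = S.d a ⊗ₜ b + (-1 : ℚ) ^ i • (a ⊗ₜ T.d b) := by
  simp [tensorD, S.sgn_of_mem ha, TensorProduct.smul_tmul']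

/-- The degree `n` part of `A ⊗ B`: the span of the `a ⊗ b` with `|a| + |b| = n`. -/
def tensorGr (S : CDGA A) (T : CDGA B) (n : ℤ) : Submodule ℚ (A ⊗[ℚ] B) :=
  Submodule.span ℚ {x | ∃ (i j : ℤ) (a : A) (b : B),
    i + j = n ∧ a ∈ S.gr i ∧ b ∈ T.gr j ∧ x = a ⊗ₜ b}

theorem tmul_mem_tensorGr (S : CDGA A) (T : CDGA B) {i j : ℤ} {a : A} {b : B}
    (ha : a ∈ S.gr i) (hb : b ∈ T.gr j) : a ⊗ₜ b ∈ tensorGr S T (i + j) :=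
  Submodule.subset_span ⟨i, j, a, b, rfl, ha, hb, rfl⟩

@[elab_as_elim]
theorem tensor_induction (S : CDGA A) (T : CDGA B) {P : A ⊗[ℚ] B → Prop} (x : A ⊗[ℚ] B)
    (h0 : P 0) (hadd : ∀ x y, P x → P y → P (x + y))
    (h : ∀ (i j : ℤ) (a : A) (b : B), a ∈ S.gr i → b ∈ T.gr j → P (a ⊗ₜ b)) : P x := by
  induction x using TensorProduct.induction_on with
  | zero => exact h0
  | add x y hx hy => exact hadd x y hx hy
  | tmul a b =>
    refine S.induction_gr a (by rwa [TensorProduct.zero_tmul])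
      (fun x y hx hy => by rw [TensorProduct.add_tmul]; exact hadd _ _ hx hy) fun i a ha => ?_
    exact T.induction_gr b (by rwa [TensorProduct.tmul_zero])
      (fun x y hx hy => by rw [TensorProduct.tmul_add]; exact hadd _ _ hx hy)
      fun j b hb => h i j a b ha hb

/-- The decomposition of a tensor by total degree. -/
noncomputable def tensorDec (S : CDGA A) (T : CDGA B) :
    A ⊗[ℚ] B →ₗ[ℚ] DirectSum ℤ fun _ => A ⊗[ℚ] B :=
  TensorProduct.lift <|
    DirectSum.toModule ℚ ℤ _ (fun i => LinearMap.flip <|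
      DirectSum.toModule ℚ ℤ _ (fun j =>
        ((TensorProduct.mk ℚ A B).flip.compl₁₂ (T.gr j).subtype (S.gr i).subtype).compr₂
          (DirectSum.lof ℚ ℤ (fun _ => A ⊗[ℚ] B) (i + j))) ∘ₗ T.dec.toLinearMap) ∘ₗ
      S.dec.toLinearMap

theorem tensorDec_tmul (S : CDGA A) (T : CDGA B) {i j : ℤ} {a : A} {b : B}
    (ha : a ∈ S.gr i) (hb : b ∈ T.gr j) :
    tensorDec S T (a ⊗ₜ b) = DirectSum.lof ℚ ℤ (fun _ => A ⊗[ℚ] B) (i + j) (a ⊗ₜ b) := by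
  simp [tensorDec, S.dec_of_mem ha, T.dec_of_mem hb]

theorem tensorDec_of_mem (S : CDGA A) (T : CDGA B) {n : ℤ} {x : A ⊗[ℚ] B}
    (hx : x ∈ tensorGr S T n) :
    tensorDec S T x = DirectSum.lof ℚ ℤ (fun _ => A ⊗[ℚ] B) n x := by
  induction hx using Submodule.span_induction with
  | mem x h =>
    obtain ⟨i, j, a, b, rfl, ha, hb, rfl⟩ := h
    exact tensorDec_tmul S T ha hb
  | zero => simp
  | add x y _ _ hx hy => rw [map_add, map_add, hx, hy]
  | smul c x _ hx => rw [map_smul, map_smul, hx]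

theorem tensor_isInternal (S : CDGA A) (T : CDGA B) : DirectSum.IsInternal (tensorGr S T) := by
  constructor
  · intro x y hxy
    have key : ∀ (m : ℤ) (z : DirectSum ℤ fun n => tensorGr S T n),
        DirectSum.component ℚ ℤ (fun _ => A ⊗[ℚ] B) m
          (tensorDec S T (DirectSum.coeLinearMap (tensorGr S T) z)) = (z m : A ⊗[ℚ] B) := by
      intro m z
      induction z using DirectSum.induction_on with
      | zero => simp
      | add x y hx hy => simp only [map_add, hx, hy]; rfl
      | of n z =>
        have := tensorDec_of_mem S T z.2
        rw [← DirectSum.lof_eq_of ℚ, DirectSum.coeLinearMap_lof, this]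
        by_cases h : n = m
        · subst h
          simp [DirectSum.component.lof_self, DirectSum.lof_apply]
        · rw [DirectSum.component.of, dif_neg h, DirectSum.lof_eq_of, DirectSum.of_eq_of_ne]
          · rfl
          · exact fun e => h e.symm
    refine DFinsupp.ext fun m => Subtype.ext ?_
    rw [← key m x, ← key m y]
    congr 2
  · intro x
    refine tensor_induction S T x ⟨0, map_zero _⟩ ?_ ?_
    · rintro _ _ ⟨x, rfl⟩ ⟨y, rfl⟩
      exact ⟨x + y, map_add _ _ _⟩
    · intro i j a b ha hb
      exact ⟨DirectSum.of (fun n => tensorGr S T n) (i + j) ⟨_, tmul_mem_tensorGr S T ha hb⟩,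
        DirectSum.coeAddMonoidHom_of _ _ _⟩

/-- The tensor product of two cdgas. -/
noncomputable def tensor (S : CDGA A) (T : CDGA B) : CDGA (A ⊗[ℚ] B) where
  gr := tensorGr S T
  isInternal := tensor_isInternal S T
  one := S.one ⊗ₜ T.one
  mul := tensorMul S T
  d := tensorD S T
  one_mem := by simpa using tmul_mem_tensorGr S T S.one_mem T.one_mem
  mul_mem := by
    intro i j x y hx hy
    induction hx using Submodule.span_induction with
    | zero => simp
    | add x y _ _ hx hy => rw [map_add]; exact Submodule.add_mem _ hx hy
    | smul c x _ hx => rw [map_smul]; exact Submodule.smul_mem _ _ hx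
    | mem x h =>
      obtain ⟨p, q, a, b, rfl, ha, hb, rfl⟩ := h
      induction hy using Submodule.span_induction with
      | zero => simp
      | add x y _ _ hx hy => rw [map_add]; exact Submodule.add_mem _ hx hy
      | smul c x _ hx => rw [map_smul]; exact Submodule.smul_mem _ _ hx
      | mem y h =>
        obtain ⟨p', q', a', b', rfl, ha', hb', rfl⟩ := h
        rw [tensorMul_tmul S T a b' hb ha']
        refine Submodule.smul_mem _ _ ?_
        rw [add_add_add_comm]
        exact tmul_mem_tensorGr S T (S.mul_mem ha ha') (T.mul_mem hb hb')
  one_mul := by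
    intro x
    refine tensor_induction S T x (map_zero _) (fun x y hx hy => by rw [map_add, hx, hy]) ?_
    intro i j a b ha hb
    rw [tensorMul_tmul S T _ _ T.one_mem ha, S.one_mul, T.one_mul]
    simp
  mul_one := by
    intro x
    refine tensor_induction S T x (by simp) (fun x y hx hy => by
      rw [map_add, LinearMap.add_apply, hx, hy]) ?_
    intro i j a b ha hb
    rw [tensorMul_tmul S T _ _ hb S.one_mem, S.mul_one, T.mul_one]
    simp
  mul_assoc := by
    intro x y z
    refine tensor_induction S T x (by simp) (fun x y hx hy => by
      simp only [map_add, LinearMap.add_apply, hx, hy]) ?_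
    intro i j a b ha hb
    refine tensor_induction S T y (by simp) (fun x y hx hy => by
      simp only [map_add, LinearMap.add_apply, hx, hy]) ?_
    intro i' j' a' b' ha' hb'
    refine tensor_induction S T z (by simp) (fun x y hx hy => by
      simp only [map_add, hx, hy]) ?_
    intro i'' j'' a'' b'' ha'' hb''
    rw [tensorMul_tmul S T _ _ hb ha', tensorMul_tmul S T _ _ hb' ha'', map_smul, map_smul,
      LinearMap.smul_apply, tensorMul_tmul S T _ _ (T.mul_mem hb hb') ha'',
      tensorMul_tmul S T _ _ hb (S.mul_mem ha' ha''), S.mul_assoc, T.mul_assoc, smul_smul,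
      smul_smul, ← zpow_add₀ (by norm_num), ← zpow_add₀ (by norm_num)]
    congr 2
    ring
  mul_comm := by
    intro n m x y hx hy
    induction hx using Submodule.span_induction with
    | zero => simp
    | add x y _ _ hx hy => simp only [map_add, LinearMap.add_apply, hx, hy, smul_add]
    | smul c x _ hx => simp only [map_smul, LinearMap.smul_apply, hx, smul_comm c]
    | mem x h =>
      obtain ⟨p, q, a, b, rfl, ha, hb, rfl⟩ := h
      induction hy using Submodule.span_induction with
      | zero => simp
      | add x y _ _ hx hy => simp only [map_add, LinearMap.add_apply, hx, hy, smul_add]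
      | smul c x _ hx => simp only [map_smul, LinearMap.smul_apply, hx, smul_comm c]
      | mem y h =>
        obtain ⟨p', q', a', b', rfl, ha', hb', rfl⟩ := h
        rw [tensorMul_tmul S T a b' hb ha', tensorMul_tmul S T a' b hb' ha,
          S.mul_comm ha ha', T.mul_comm hb hb', TensorProduct.smul_tmul_smul, smul_smul,
          smul_smul]
        congr 1
        have e : (p + q) * (p' + q') + p * q' = p * p' + q * q' + p' * q + 2 * (p * q') := by ring
        rw [← zpow_add₀ (by norm_num), ← zpow_add₀ (by norm_num), ← zpow_add₀ (by norm_num), e,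
          zpow_add₀ (by norm_num) _ (2 * (p * q')), (even_two_mul _).neg_one_zpow, _root_.mul_one]
        congr 1
        ring
  d_mem := by
    intro n x hx
    induction hx using Submodule.span_induction with
    | zero => simp
    | add x y _ _ hx hy => rw [map_add]; exact Submodule.add_mem _ hx hy
    | smul c x _ hx => rw [map_smul]; exact Submodule.smul_mem _ _ hx
    | mem x h =>
      obtain ⟨p, q, a, b, rfl, ha, hb, rfl⟩ := h
      rw [tensorD_tmul S T b ha]
      refine Submodule.add_mem _ ?_ (Submodule.smul_mem _ _ ?_)
      · rw [add_right_comm]; exact tmul_mem_tensorGr S T (S.d_mem ha) hb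
      · rw [add_assoc]; exact tmul_mem_tensorGr S T ha (T.d_mem hb)
  d_d := by
    intro x
    refine tensor_induction S T x (by simp) (fun x y hx hy => by
      simp only [map_add, hx, hy, add_zero]) ?_
    intro i j a b ha hb
    rw [tensorD_tmul S T b ha, map_add, map_smul, tensorD_tmul S T _ (S.d_mem ha),
      tensorD_tmul S T _ ha, S.d_d, T.d_d, zpow_add₀ (by norm_num)]
    simp
  d_mul := by
    intro n x y hx
    induction hx using Submodule.span_induction with
    | zero => simp
    | add x y _ _ hx hy => simp only [map_add, LinearMap.add_apply, hx, hy, smul_add]; abel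
    | smul c x _ hx => simp only [map_smul, LinearMap.smul_apply, hx, smul_add, smul_comm c]
    | mem x h =>
      obtain ⟨p, q, a, b, rfl, ha, hb, rfl⟩ := h
      refine tensor_induction S T y (by simp) (fun x y hx hy => by
        simp only [map_add, hx, hy, smul_add]; abel) ?_
      intro i j a' b' ha' hb'
      have n0 : (-1 : ℚ) ≠ 0 := by norm_num
      rw [tensorMul_tmul S T a b' hb ha', map_smul, tensorD_tmul S T _ (S.mul_mem ha ha'),
        S.d_mul _ ha, T.d_mul _ hb, tensorD_tmul S T b ha, tensorD_tmul S T b' ha', map_add,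
        LinearMap.add_apply, map_smul, LinearMap.smul_apply, map_add, map_smul,
        tensorMul_tmul S T _ _ hb ha', tensorMul_tmul S T _ _ (T.d_mem hb) ha',
        tensorMul_tmul S T _ _ hb (S.d_mem ha'), tensorMul_tmul S T _ _ hb ha']
      simp only [TensorProduct.add_tmul, TensorProduct.tmul_add, TensorProduct.tmul_smul,
        ← TensorProduct.smul_tmul', smul_add, smul_smul, ← zpow_add₀ n0]
      have c1 : (-1 : ℚ) ^ (i * q + p) = (-1 : ℚ) ^ (p + q + (i + 1) * q) := by
        rw [show p + q + (i + 1) * q = i * q + p + 2 * q by ring, zpow_add₀ n0 _ (2 * q),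
          (even_two_mul _).neg_one_zpow, _root_.mul_one]
      have c2 : (-1 : ℚ) ^ (i * q + (p + i)) = (-1 : ℚ) ^ (p + i * (q + 1)) := by
        congr 1; ring
      have c3 : (-1 : ℚ) ^ (i * q + (p + i + q)) = (-1 : ℚ) ^ (p + q + (i + i * q)) := by
        congr 1; ring
      rw [c1, c2, c3]
      abel

end CDGA
/-! ### Modular diagrams and the space they span -/

/-- A modular diagram of `L`: a modular extension of `L` together with a word in its atoms. -/
structure ModularDiagram (L : Type u) [Lattice L] [BoundedOrder L] extends
    ModularExtension L where
  J : List E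
  isAtom : ∀ H ∈ J, IsAtom H

/-- The trivial modular extension `id : L → L`. -/
def ModularExtension.refl (L : Type u) [Lattice L] [BoundedOrder L] [IsGeometricLattice L] :
    ModularExtension L where
  E := L
  ι := id
  isEmbedding := ⟨Function.injective_id, fun _ _ => rfl, fun _ h => h⟩
  range_ι := by ext x; simp
  isModular := fun x => by simp [add_comm]

namespace ModularDiagram

variable {L : Type u} [Lattice L] [BoundedOrder L]

/-- The join of the atoms of the word `J`. -/
def join (Γ : ModularDiagram L) : Γ.E := (Γ.J : Multiset Γ.E).sup

/-- `deg (E, ι, J) = |J| - 2 (rk ⋁J - rk (⋁J ∧ F_ι))`. -/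
noncomputable def deg (Γ : ModularDiagram L) : ℤ :=
  (Γ.J.length : ℤ) - 2 * ((rk Γ.join : ℤ) - (rk (Γ.join ⊓ Γ.flat) : ℤ))

/-- `H` is a bridge if it is the only atom of `J` not below some flat `F ≥ F_ι`. -/
def IsBridge (Γ : ModularDiagram L) (H : Γ.E) : Prop :=
  H ∈ Γ.J ∧ ∃ F : Γ.E, Γ.flat ≤ F ∧ ¬ H ≤ F ∧ ∀ K ∈ Γ.J, K ≠ H → K ≤ F

/-- `H ∈ J` is contractible if it is neither a bridge nor below `F_ι`. -/
def IsContractible (Γ : ModularDiagram L) (H : Γ.E) : Prop :=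
  H ∈ Γ.J ∧ ¬ Γ.IsBridge H ∧ ¬ H ≤ Γ.flat

/-- The contraction `Γ / H = ([H, ⊤], H ∨ ι, H ∨ (J ∖ H))` at the letter `H` in position `i` of a
word `J` without repetitions. -/
def contract [IsGeometricLattice L] (Γ : ModularDiagram L) (hJ : Γ.J.Nodup)
    (i : Fin Γ.J.length) (hi : ¬ Γ.J.get i ≤ Γ.flat) : ModularDiagram L where
  toModularExtension :=
    Γ.toModularExtension.contract (Γ.J.get i) (Γ.isAtom _ (List.get_mem _ _)) hi
  J := (Γ.J.eraseIdx i).map fun K => (⟨Γ.J.get i ⊔ K, le_sup_left⟩ : Set.Ici (Γ.J.get i))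
  isAtom := by
    intro H hH
    obtain ⟨K, hK, rfl⟩ := List.mem_map.1 hH
    have hKJ : K ∈ Γ.J := List.mem_of_mem_eraseIdx hK
    have hat := Γ.isAtom _ (List.get_mem Γ.J i)
    have hne : ¬ K ≤ Γ.J.get i := by
      intro hle
      have e : K = Γ.J.get i := (hat.le_iff_eq (Γ.isAtom K hKJ).1).1 hle
      obtain ⟨j, hj, hji, hjK⟩ := List.mem_eraseIdx_iff_getElem.1 hK
      exact hji ((hJ.getElem_inj_iff).1 (hjK.trans e))
    refine isAtom_of_rk (E := Set.Ici (Γ.J.get i)) ?_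
    have h1 := (Ici_geometric (Γ.J.get i)).1 ⟨Γ.J.get i ⊔ K, le_sup_left⟩
    have h2 := rk_sup_atom (Γ.isAtom K hKJ) hne
    change _ = rk (Γ.J.get i ⊔ K) at h1
    rw [h2] at h1
    show rk (⟨Γ.J.get i ⊔ K, le_sup_left⟩ : Set.Ici (Γ.J.get i)) = 1
    omega

/-- The diagram `(L, id, ∅)`. -/
def empty (L : Type u) [Lattice L] [BoundedOrder L] [IsGeometricLattice L] :
    ModularDiagram L where
  toModularExtension := ModularExtension.refl L
  J := []
  isAtom := by simp

/-- `Γ₁ • Γ₂ = (E₁ ∪_L E₂, ι₁₂, J₁ ∪ J₂)`, the letters of `J₁` coming first. -/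
noncomputable def glue [IsGeometricLattice L] (Γ₁ Γ₂ : ModularDiagram L) : ModularDiagram L where
  toModularExtension := Γ₁.toModularExtension.pushout Γ₂.toModularExtension
  J := Γ₁.J.map (Γ₁.toModularExtension.inl Γ₂.toModularExtension) ++
    Γ₂.J.map (Γ₁.toModularExtension.inr Γ₂.toModularExtension)
  isAtom := by
    intro H hH
    rcases List.mem_append.1 hH with h | h
    · obtain ⟨K, hK, rfl⟩ := List.mem_map.1 h
      exact ModularExtension.isAtom_inl _ _ (Γ₁.isAtom K hK)
    · obtain ⟨K, hK, rfl⟩ := List.mem_map.1 h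
      exact ModularExtension.isAtom_inr _ _ (Γ₂.isAtom K hK)

/-- The product `(E₁ × E₂, ι₁ × ι₂, J₁ ⊔ J₂)` of a diagram of `L₁` and a diagram of `L₂`, the
letters of `J₁` coming first. -/
def prod {L₁ L₂ : Type u} [Lattice L₁] [BoundedOrder L₁] [IsGeometricLattice L₁]
    [Lattice L₂] [BoundedOrder L₂] [IsGeometricLattice L₂]
    (Γ₁ : ModularDiagram L₁) (Γ₂ : ModularDiagram L₂) : ModularDiagram (L₁ × L₂) where
  toModularExtension := Γ₁.toModularExtension.prod Γ₂.toModularExtension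
  J := Γ₁.J.map (fun H => ((H, ⊥) : Γ₁.E × Γ₂.E)) ++ Γ₂.J.map (fun H => ((⊥, H) : Γ₁.E × Γ₂.E))
  isAtom := by
    intro H hH
    rcases List.mem_append.1 hH with h | h
    · obtain ⟨K, hK, rfl⟩ := List.mem_map.1 h
      exact isAtom_prod_left (Γ₁.isAtom K hK)
    · obtain ⟨K, hK, rfl⟩ := List.mem_map.1 h
      exact isAtom_prod_right (Γ₂.isAtom K hK)

end ModularDiagram

section MD

variable (L : Type u) [Lattice L] [BoundedOrder L]

open Finsupp in
open Classical in
/-- The relations that define the space of modular diagrams. -/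
inductive MDRel : (ModularDiagram L →₀ ℚ) → Prop
  /-- Transposing two neighbouring letters of `J` changes the sign. -/
  | swap (X : ModularExtension L) (J₁ J₂ : List X.E) (H K : X.E)
      (h : ∀ M ∈ J₁ ++ H :: K :: J₂, IsAtom M) (h' : ∀ M ∈ J₁ ++ K :: H :: J₂, IsAtom M) :
      MDRel (single ⟨X, J₁ ++ H :: K :: J₂, h⟩ 1 + single ⟨X, J₁ ++ K :: H :: J₂, h'⟩ 1)
  /-- Diagrams related by an embedding of lattices of the same rank are identified. -/
  | embed (Γ Γ' : ModularDiagram L) (φ : Γ.E → Γ'.E) (hφ : IsEmbedding φ)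
      (hrk : rk (⊤ : Γ.E) = rk (⊤ : Γ'.E)) (hι : ∀ l, Γ'.ι l = φ (Γ.ι l))
      (hJ : Γ'.J = Γ.J.map φ) :
      MDRel (single Γ 1 - single Γ' 1)
  /-- `(E, ι, J) = 0` if `F_ι ∨ ⋁J < ⊤`. -/
  | join_lt (Γ : ModularDiagram L) (h : Γ.flat ⊔ Γ.join < ⊤) : MDRel (single Γ 1)
  /-- `(E, ι, J) = 0` if `E` is a product `E₁ × E₂` of non-trivial geometric lattices and `F_ι`
  lies in `E₁ × {⊥}`. -/
  | product (Γ : ModularDiagram L) (E₁ E₂ : Type u) [Lattice E₁] [BoundedOrder E₁]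
      [IsGeometricLattice E₁] [Nontrivial E₁] [Lattice E₂] [BoundedOrder E₂]
      [IsGeometricLattice E₂] [Nontrivial E₂] (e : Γ.E ≃o E₁ × E₂) (h : (e Γ.flat).2 = ⊥) :
      MDRel (single Γ 1)
  /-- `(E, ι, J) = 0` if exactly two letters of `J` are not below some modular `F ≥ F_ι`. -/
  | modular (Γ : ModularDiagram L) (F : Γ.E) (hF : IsModular F) (hle : Γ.flat ≤ F)
      (h : (Γ.J.filter fun H => ¬ H ≤ F).length = 2) : MDRel (single Γ 1)

/-- The rational vector space `MD(L)` of modular diagrams of `L`. -/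
noncomputable abbrev MD : Type (u + 1) :=
  (ModularDiagram L →₀ ℚ) ⧸ Submodule.span ℚ {x | MDRel L x}

variable {L}

/-- The class of a modular diagram in `MD(L)`. -/
noncomputable def MD.mk (Γ : ModularDiagram L) : MD L :=
  Submodule.Quotient.mk (Finsupp.single Γ 1)

variable (L) in
/-- The degree `n` part of `MD(L)`, spanned by the modular diagrams of degree `n`. -/
noncomputable def MD.gr (n : ℤ) : Submodule ℚ (MD L) :=
  Submodule.span ℚ {x | ∃ Γ : ModularDiagram L, Γ.deg = n ∧ MD.mk Γ = x}

theorem MD.span_mk : Submodule.span ℚ (Set.range (MD.mk (L := L))) = ⊤ := by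
  rw [eq_top_iff]
  rintro x -
  obtain ⟨f, rfl⟩ := Submodule.Quotient.mk_surjective _ x
  induction f using Finsupp.induction_linear with
  | zero => exact Submodule.zero_mem _
  | add f g hf hg => exact Submodule.add_mem _ hf hg
  | single Γ c =>
    have h : Finsupp.single Γ c = c • Finsupp.single Γ (1 : ℚ) := by simp
    rw [h, Submodule.Quotient.mk_smul]
    exact Submodule.smul_mem _ _ (Submodule.subset_span ⟨Γ, rfl⟩)

open Classical in
/-- The cdga structure of `MD(L)`: the cdga structure on the vector space `MD(L)`, graded by the
degree of diagrams, whose unit is the class of `(L, id, ∅)`, whose product is given on diagrams by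
pushouts along `L` and whose differential is given on diagrams by the alternating sum of the
contractions at the contractible letters of `J`. (Diagrams whose word `J` has a repetition are zero
in `MD(L)`, so that the last condition determines the differential.) -/
structure MDAlgebra (L : Type u) [Lattice L] [BoundedOrder L] [IsGeometricLattice L] extends
    CDGA (MD L) where
  gr_eq : gr = MD.gr L
  one_eq : one = MD.mk (ModularDiagram.empty L)
  mul_mk : ∀ Γ₁ Γ₂ : ModularDiagram L, mul (MD.mk Γ₁) (MD.mk Γ₂) = MD.mk (Γ₁.glue Γ₂)
  d_mk : ∀ (Γ : ModularDiagram L) (hJ : Γ.J.Nodup), d (MD.mk Γ) =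
    ∑ i : Fin Γ.J.length, if h : Γ.IsContractible (Γ.J.get i) then
      (-1 : ℚ) ^ (i : ℕ) • MD.mk (Γ.contract hJ i h.2.2) else 0

theorem MD.mk_swap (X : ModularExtension L) (J₁ J₂ : List X.E) (H K : X.E)
    (h : ∀ M ∈ J₁ ++ H :: K :: J₂, IsAtom M) (h' : ∀ M ∈ J₁ ++ K :: H :: J₂, IsAtom M) :
    MD.mk ⟨X, J₁ ++ H :: K :: J₂, h⟩ = - MD.mk ⟨X, J₁ ++ K :: H :: J₂, h'⟩ := by
  rw [eq_neg_iff_add_eq_zero]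
  exact (Submodule.Quotient.mk_eq_zero _).2
    (Submodule.subset_span (MDRel.swap X J₁ J₂ H K h h'))

theorem MD.mk_eq_zero_of_adjacent (X : ModularExtension L) (J₂ : List X.E) (H : X.E)
    (J₃ : List X.E) : ∀ (J₁ : List X.E) (h : ∀ M ∈ J₁ ++ H :: J₂ ++ H :: J₃, IsAtom M),
    MD.mk ⟨X, J₁ ++ H :: J₂ ++ H :: J₃, h⟩ = 0 := by
  induction J₂ with
  | nil =>
    intro J₁ h
    have h2 : ∀ M ∈ J₁ ++ H :: H :: J₃, IsAtom M := by simpa using h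
    have := MD.mk_swap X J₁ J₃ H H h2 h2
    rw [eq_neg_iff_add_eq_zero, ← two_smul ℚ, smul_eq_zero] at this
    simpa using this.resolve_left two_ne_zero
  | cons K J₂ ih =>
    intro J₁ h
    have h2 : ∀ M ∈ J₁ ++ H :: K :: (J₂ ++ H :: J₃), IsAtom M := by simpa using h
    have h3 : ∀ M ∈ J₁ ++ K :: H :: (J₂ ++ H :: J₃), IsAtom M := by
      intro M hM; apply h2; simp only [List.mem_append, List.mem_cons] at hM ⊢; tauto
    have := MD.mk_swap X J₁ (J₂ ++ H :: J₃) H K h2 h3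
    have h4 := ih (J₁ ++ [K]) (by simpa using h3)
    simp only [List.append_assoc, List.cons_append, List.nil_append] at h4 this ⊢
    rw [this, h4, neg_zero]

theorem MD.mk_eq_zero_of_not_nodup (Γ : ModularDiagram L) (h : ¬ Γ.J.Nodup) : MD.mk Γ = 0 := by
  obtain ⟨X, J, hJ⟩ := Γ
  obtain ⟨H, hH⟩ : ∃ H, [H, H].Sublist J := by
    simpa [List.nodup_iff_sublist] using h
  obtain ⟨J₁, J', rfl, h1, h2⟩ := List.append_sublist_iff (l₁ := [H]) (l₂ := [H]) |>.1 hH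
  obtain ⟨A, B, rfl⟩ := List.append_of_mem (List.singleton_sublist.1 h1)
  obtain ⟨C, D, rfl⟩ := List.append_of_mem (List.singleton_sublist.1 h2)
  have := MD.mk_eq_zero_of_adjacent X (B ++ C) H D A (by simpa using hJ)
  simpa using this

/-- There is at most one such structure. -/
theorem MDAlgebra.unique [IsGeometricLattice L] (S T : MDAlgebra L) : S = T := by
  have hm : S.mul = T.mul := by
    refine LinearMap.ext_on_range (v := MD.mk (L := L)) MD.span_mk fun Γ₁ => ?_
    refine LinearMap.ext_on_range (v := MD.mk (L := L)) MD.span_mk fun Γ₂ => ?_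
    rw [S.mul_mk, T.mul_mk]
  have hd : S.d = T.d := by
    refine LinearMap.ext_on_range (v := MD.mk (L := L)) MD.span_mk fun Γ => ?_
    by_cases h : Γ.J.Nodup
    · rw [S.d_mk Γ h, T.d_mk Γ h]
    · rw [MD.mk_eq_zero_of_not_nodup Γ h, map_zero, map_zero]
  obtain ⟨⟨_, _, _, _, _⟩, hg, ho⟩ := S
  obtain ⟨⟨_, _, _, _, _⟩, hg', ho'⟩ := T
  simp only at hm hd hg ho hg' ho'
  subst hm hd hg ho hg' ho'
  rfl

end MD

end ModularDiagrams

open ModularDiagrams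

/-!
A diagram with the word `J` in the modular extension `X` is written `MD.word X J`. A function of
extensions and words which respects the five relations (`IsInvariant`) extends to `MD(L)`
(`MD.lift`); the structure maps and the isomorphism arise in this way.

*The differential.* It is the alternating sum `altSum` of the contractions `MD.dTerm X H R` at the
letters `H`, where `R` consists of the other letters. The delicate relation is the one for a modular
flat `G` outside of which there are exactly two letters `A` and `B`. Unless both contractions are
zero, `A ∨ ·` and `B ∨ ·` both identify `[⊥, G]` with the contracted extension, so that the
contractions at `A` and at `B` give the same diagram, and these terms cancel
(`MD.dTerm_comm_of_isModular`); a contraction at any other letter is again of this form. Contracting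
`H` and then `K` is admissible if and only if contracting `K` and then `H` is, with the same result
(`MD.ddTerm_comm`), whence `d² = 0` by antisymmetry.

*The product.* The pushout of two extensions is again modular, and it respects the relations in each
of the two arguments. A letter of the first word can be contracted in the pushout exactly when it
can in the first extension, and contracting commutes with the pushout (`poContract`). This is the
Leibniz rule.

*Extensions of a product.* Let `F₁` and `F₂` be the images of `(⊤, ⊥)` and `(⊥, ⊤)` in a modular
extension `E` of `L₁ × L₂`. Modularity of `F₁ ∨ F₂` and the splitting of the interval below it give
`rk (F₁ ∨ s) + rk (F₂ ∨ s) ≤ rk (F₁ ∨ F₂ ∨ s) + rk s` for all `s`. By induction, all atoms of `E`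
can be distributed between `F₁` and `F₂` with this inequality kept (`exists_rk_add_rk_le`). At
`s = ⊥` this yields flats `P ≥ F₁` and `Q ≥ F₂` such that every atom lies below one of them and
`rk P + rk Q ≤ rk E`. Hence `E ≅ [⊥, P] × [⊥, Q]` (`ModularExtension.exists_isSep`), and the two
factors are modular extensions of `L₁` and `L₂`.

*The isomorphism.* The comparison map `MD.tensorHom` sends a pair of diagrams to their product. Its
inverse `MD.unprodHom` separates a diagram of `L₁ × L₂`: its letters are sorted into those below `P`
and those below `Q`, with the sign of this shuffle (`MD.sepWord`). The flats `P` and `Q` are not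
unique, but if there are two choices, then each of them has a factor from which a product factor
splits off, and both separated diagrams vanish (`MD.sepWord_eq`). If exactly two letters lie outside
of a modular flat, then either they belong to the same factor, where the same holds, or each of them
is a bridge of its factor; and a diagram with a bridge is zero, since it is the image of a product
with the rank one lattice spanned by the bridge (`MD.word_eq_zero_of_bridge`).
-/

namespace ModularDiagrams

/-! ### Alternating sums over the letters of a word -/

section AltSum

variable {α : Type*} {β : Type*} {V : Type*} [AddCommGroup V] {W : Type*} [AddCommGroup W]

/-- `altSum f J = ∑ i, (-1) ^ i • f Jᵢ (J ∖ Jᵢ)`: the alternating sum over the letters of `J` of a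
function of a letter and of the word that remains when it is deleted. -/
def altSum : (α → List α → V) → List α → V
  | _, [] => 0
  | f, H :: B => f H B - altSum (fun K R => f K (H :: R)) B

@[simp] theorem altSum_nil (f : α → List α → V) : altSum f [] = 0 := by rw [altSum]

theorem altSum_cons (f : α → List α → V) (H : α) (B : List α) :
    altSum f (H :: B) = f H B - altSum (fun K R => f K (H :: R)) B := by rw [altSum]

theorem altSum_congr {f g : α → List α → V} {J : List α}
    (h : ∀ H R, (H :: R).Perm J → f H R = g H R) : altSum f J = altSum g J := by
  induction J generalizing f g with
  | nil => simp
  | cons K B ih =>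
    rw [altSum_cons, altSum_cons, h K B (List.Perm.refl _)]
    congr 1
    exact ih fun H R hp => h H (K :: R) ((List.Perm.swap K H R).trans (hp.cons K))

theorem altSum_eq_zero {f : α → List α → V} {J : List α}
    (h : ∀ H R, (H :: R).Perm J → f H R = 0) : altSum f J = 0 := by
  induction J generalizing f with
  | nil => simp
  | cons K B ih =>
    rw [altSum_cons, h K B (List.Perm.refl _), zero_sub, neg_eq_zero]
    exact ih fun H R hp => h H (K :: R) ((List.Perm.swap K H R).trans (hp.cons K))

theorem map_altSum {G : Type*} [FunLike G V W] [AddMonoidHomClass G V W] (φ : G)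
    (f : α → List α → V) (J : List α) :
    φ (altSum f J) = altSum (fun H R => φ (f H R)) J := by
  induction J generalizing f with
  | nil => simp
  | cons K B ih => rw [altSum_cons, altSum_cons, map_sub, ih]

theorem altSum_map (f : β → List β → V) (φ : α → β) (J : List α) :
    altSum f (J.map φ) = altSum (fun H R => f (φ H) (R.map φ)) J := by
  induction J generalizing f with
  | nil => simp
  | cons K B ih => rw [List.map_cons, altSum_cons, altSum_cons, ih]; simp

theorem altSum_append (f : α → List α → V) (A B : List α) :
    altSum f (A ++ B) = altSum (fun H R => f H (R ++ B)) A +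
      (-1 : ℤ) ^ A.length • altSum (fun H R => f H (A ++ R)) B := by
  induction A generalizing f with
  | nil => simp
  | cons K A ih =>
    rw [List.cons_append, altSum_cons, altSum_cons, ih, List.length_cons, pow_succ]
    simp only [List.cons_append, mul_neg, mul_one, neg_smul]
    abel

theorem altSum_add (f g : α → List α → V) (J : List α) :
    altSum (fun H R => f H R + g H R) J = altSum f J + altSum g J := by
  induction J generalizing f g with
  | nil => simp
  | cons K B ih => rw [altSum_cons, altSum_cons, altSum_cons, ih]; abel

theorem altSum_neg (f : α → List α → V) (J : List α) :
    altSum (fun H R => - f H R) J = - altSum f J := by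
  induction J generalizing f with
  | nil => simp
  | cons K B ih => rw [altSum_cons, altSum_cons, ih]; abel

theorem altSum_sub (f g : α → List α → V) (J : List α) :
    altSum (fun H R => f H R - g H R) J = altSum f J - altSum g J := by
  simp only [sub_eq_add_neg, altSum_add, altSum_neg]

theorem altSum_mem {S : Type*} [SetLike S V] [AddSubgroupClass S V] (s : S)
    {f : α → List α → V} {J : List α}
    (h : ∀ H R, (H :: R).Perm J → f H R ∈ s) : altSum f J ∈ s := by
  induction J generalizing f with
  | nil => rw [altSum_nil]; exact zero_mem s
  | cons K B ih =>
    rw [altSum_cons]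
    exact sub_mem (h K B (List.Perm.refl _))
      (ih fun H R hp => h H (K :: R) ((List.Perm.swap K H R).trans (hp.cons K)))

/-- Deleting two letters in both orders gives terms of opposite sign. -/
theorem altSum_altSum_eq_zero (g : α → α → List α → V) (J : List α)
    (h : ∀ H ∈ J, ∀ K ∈ J, ∀ R, g H K R = g K H R) :
    altSum (fun H R => altSum (g H) R) J = 0 := by
  induction J generalizing g with
  | nil => simp
  | cons H B ih =>
    rw [altSum_cons]
    simp only [altSum_cons, altSum_sub]
    rw [ih (fun H' K S => g H' K (H :: S)) fun K hK M hM R =>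
      h K (List.mem_cons_of_mem _ hK) M (List.mem_cons_of_mem _ hM) _, sub_zero, sub_eq_zero]
    refine altSum_congr fun K R hp => ?_
    exact h H List.mem_cons_self K (List.mem_cons_of_mem _ (hp.subset List.mem_cons_self)) _

/-- The alternating sum in terms of the positions of the letters. -/
theorem altSum_eq_sum [Module ℚ V] (f : α → List α → V) (J : List α) :
    altSum f J = ∑ i : Fin J.length, (-1 : ℚ) ^ (i : ℕ) • f (J.get i) (J.eraseIdx i) := by
  induction J generalizing f with
  | nil => simp
  | cons K B ih =>
    rw [altSum_cons, ih]
    erw [Fin.sum_univ_succ]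
    simp [pow_succ, sub_eq_add_neg]

end AltSum

/-! ### Antisymmetric functions of words -/

section Antisymmetric

variable {α : Type*} {V : Type*} [AddCommGroup V]

/-- Functions of words that change their sign when two neighbouring letters are transposed. -/
def Antisymm (f : List α → V) : Prop :=
  ∀ (A B : List α) (H K : α), f (A ++ H :: K :: B) = - f (A ++ K :: H :: B)

theorem Antisymm.append_left {f : List α → V} (hf : Antisymm f) (C : List α) :
    Antisymm fun J => f (C ++ J) := fun A B H K => by
  simpa only [List.append_assoc] using hf (C ++ A) B H K

theorem Antisymm.append_right {f : List α → V} (hf : Antisymm f) (C : List α) :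
    Antisymm fun J => f (J ++ C) := fun A B H K => by
  simpa only [List.append_assoc, List.cons_append] using hf A (B ++ C) H K

theorem Antisymm.cons {f : List α → V} (hf : Antisymm f) (H : α) :
    Antisymm fun J => f (H :: J) := hf.append_left [H]

theorem Antisymm.map {β : Type*} {f : List β → V} (hf : Antisymm f) (φ : α → β) :
    Antisymm fun J : List α => f (J.map φ) := fun A B H K => by
  simpa using hf (A.map φ) (B.map φ) (φ H) (φ K)

theorem Antisymm.neg_smul_cons {f : List α → V} (hf : Antisymm f) (H : α) (A B : List α) :
    f (H :: (A ++ B)) = (-1 : ℤ) ^ A.length • f (A ++ H :: B) := by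
  induction A generalizing f with
  | nil => simp
  | cons K A ih =>
    have h := hf [] (A ++ B) H K
    simp only [List.nil_append] at h
    rw [List.cons_append, h, ih (hf.cons K), List.length_cons, pow_succ]
    simp

/-- Exchanging two blocks of lengths `m` and `n` contributes the sign `(-1) ^ (m * n)`. -/
theorem Antisymm.append_comm {f : List α → V} (hf : Antisymm f) (A B : List α) :
    f (A ++ B) = (-1 : ℤ) ^ (A.length * B.length) • f (B ++ A) := by
  induction A generalizing f with
  | nil => simp
  | cons K A ih =>
    have h := ih (hf.cons K)
    rw [List.cons_append, h, hf.neg_smul_cons, smul_smul, List.length_cons, ← pow_add]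
    congr 2
    ring

theorem Antisymm.eq_or_eq_neg_of_perm {f : List α → V} (hf : Antisymm f) {A B : List α}
    (h : A.Perm B) : f A = f B ∨ f A = - f B := by
  induction h generalizing f with
  | nil => exact Or.inl rfl
  | cons K _ ih => exact ih (hf.cons K)
  | swap K H R => exact Or.inr (hf [] R H K)
  | trans _ _ h1 h2 =>
    rcases h1 hf with h | h <;> rcases h2 hf with h' | h' <;> simp [h, h']

theorem Antisymm.eq_zero_of_perm {f : List α → V} (hf : Antisymm f) {A B : List α}
    (h : A.Perm B) (hB : f B = 0) : f A = 0 := by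
  rcases hf.eq_or_eq_neg_of_perm h with h | h <;> simp [h, hB]

theorem Antisymm.eq_zero_of_not_nodup [Module ℚ V] {f : List α → V} (hf : Antisymm f)
    {J : List α} (h : ¬ J.Nodup) : f J = 0 := by
  classical
  obtain ⟨H, hH⟩ : ∃ H, [H, H].Sublist J := by
    simpa [List.nodup_iff_sublist] using h
  obtain ⟨l, hl⟩ := hH.exists_perm_append
  refine hf.eq_zero_of_perm hl ?_
  have := hf [] l H H
  simp only [List.nil_append] at this
  rw [eq_neg_iff_add_eq_zero, ← two_smul ℚ, smul_eq_zero] at this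
  simpa using this.resolve_left two_ne_zero

theorem Antisymm.altSum {f : α → List α → V} (hf : ∀ H, Antisymm (f H)) :
    Antisymm (altSum f) := by
  intro A B H K
  induction A generalizing f with
  | nil =>
    have h : ∀ (M : α) (R : List α), f M (H :: K :: R) = - f M (K :: H :: R) := fun M R =>
      hf M [] R H K
    simp only [List.nil_append, altSum_cons, h, altSum_neg]
    abel
  | cons M A ih =>
    rw [List.cons_append, List.cons_append, altSum_cons, altSum_cons, hf M A B H K,
      ih fun N => (hf N).cons M]
    abel

end Antisymmetric

/-! ### Embeddings, lower intervals and direct decompositions -/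

section Lattice

theorem rk_orderIso {E : Type*} [Lattice E] {E' : Type*} [Lattice E'] (e : E ≃o E') (x : E) :
    rk (e x) = rk x := by
  simp [rk, Order.height_orderIso]

variable {E : Type*} [Lattice E] [BoundedOrder E] {E' : Type*} [Lattice E'] [BoundedOrder E']

theorem IsEmbedding.le_iff_le {φ : E → E'} (h : IsEmbedding φ) {x y : E} : φ x ≤ φ y ↔ x ≤ y := by
  rw [← sup_eq_right, ← h.map_sup, h.injective.eq_iff, sup_eq_right]

theorem IsEmbedding.strictMono {φ : E → E'} (h : IsEmbedding φ) : StrictMono φ := fun _ _ hxy =>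
  lt_of_le_of_ne (h.le_iff_le.2 hxy.le) fun e => hxy.ne (h.injective e)

theorem IsEmbedding.map_bot [hE : IsGeometricLattice E] [Nontrivial E] {φ : E → E'}
    (h : IsEmbedding φ) : φ ⊥ = ⊥ := by
  have := hE.atomistic
  obtain ⟨a, ha, -, -⟩ := exists_atom_le_not_le (bot_lt_top (α := E)).not_ge
  exact (h.map_atom a ha).2 _ (h.strictMono ha.bot_lt)

/-- Embeddings preserve the rank, because `rk ∘ φ` is a strictly monotone submodular function that
is one on the atoms. -/
theorem IsEmbedding.rk_map [hE : IsGeometricLattice E] [Nontrivial E] [hE' : IsGeometricLattice E']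
    {φ : E → E'} (h : IsEmbedding φ) (x : E) : rk (φ x) = rk x := by
  have := hE.finite
  have := hE.atomistic
  refine ((of_rank (fun x : E => rk (φ x)) ?_ ?_ ?_ ?_).1 x).symm
  · simp [h.map_bot, rk_bot]
  · intro x y hxy
    exact rk_strictMono (h.strictMono hxy)
  · intro a ha
    exact (rk_atom (h.map_atom a ha)).le
  · intro x y
    have h1 := hE'.semimodular (φ x) (φ y)
    have h2 : rk (φ (x ⊓ y)) ≤ rk (φ x ⊓ φ y) :=
      rk_mono (le_inf (h.le_iff_le.2 inf_le_left) (h.le_iff_le.2 inf_le_right))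
    simp only [h.map_sup]
    omega

theorem IsEmbedding.isAtom_iff [IsGeometricLattice E] [Nontrivial E] [IsGeometricLattice E']
    {φ : E → E'} (h : IsEmbedding φ) {x : E} : IsAtom (φ x) ↔ IsAtom x :=
  ⟨fun ha => isAtom_of_rk (by rw [← h.rk_map, rk_atom ha]), h.map_atom x⟩

theorem isEmbedding_orderIso (e : E ≃o E') : IsEmbedding e where
  injective := e.injective
  map_sup := e.map_sup
  map_atom a ha := (OrderIso.isAtom_iff e a).2 ha

theorem isModular_top : IsModular (⊤ : E) := fun x => by simp [add_comm]

theorem le_of_isAtom_of_inf_ne_bot {a x : E} (ha : IsAtom a) (h : a ⊓ x ≠ ⊥) : a ≤ x := by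
  rcases ha.le_iff.1 (inf_le_left : a ⊓ x ≤ a) with h' | h'
  · exact absurd h' h
  · exact inf_eq_left.1 h'

theorem inf_eq_bot_of_isAtom {a x : E} (ha : IsAtom a) (h : ¬ a ≤ x) : a ⊓ x = ⊥ := by
  by_contra h'
  exact h (le_of_isAtom_of_inf_ne_bot ha h')

/-- `E` is the direct product of `[⊥, P]` and `[⊥, Q]`: every atom is below `P` or `Q`, and the
ranks of `P` and `Q` add up to at most the rank of `E`. -/
structure IsSplit (P Q : E) : Prop where
  rk_le : rk P + rk Q ≤ rk (⊤ : E)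
  atom_le : ∀ a : E, IsAtom a → a ≤ P ∨ a ≤ Q

theorem IsSplit.symm {P Q : E} (h : IsSplit P Q) : IsSplit Q P :=
  ⟨by rw [add_comm]; exact h.rk_le, fun a ha => (h.atom_le a ha).symm⟩

theorem IsSplit.of_orderIso {E₁ E₂ : Type*} [Lattice E₁] [BoundedOrder E₁] [IsGeometricLattice E₁]
    [Lattice E₂] [BoundedOrder E₂] [IsGeometricLattice E₂] (e : E ≃o E₁ × E₂) :
    IsSplit (e.symm (⊤, ⊥)) (e.symm (⊥, ⊤)) := by
  constructor
  · rw [rk_orderIso, rk_orderIso, ← rk_orderIso e ⊤, prod_geometric.1, prod_geometric.1,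
      prod_geometric.1]
    simp [rk_bot]
  · intro a ha
    rw [OrderIso.le_symm_apply, OrderIso.le_symm_apply]
    have h1 : rk (e a) = 1 := by rw [rk_orderIso, rk_atom ha]
    rw [prod_geometric.1] at h1
    by_cases h2 : rk (e a).2 = 0
    · left
      refine ⟨le_top, ?_⟩
      exact (eq_of_le_of_rk_le bot_le (by rw [h2]; exact Nat.zero_le _)).ge
    · right
      refine ⟨?_, le_top⟩
      exact (eq_of_le_of_rk_le bot_le (by omega)).ge

variable [hE : IsGeometricLattice E]

theorem le_of_forall_atom {x y : E} (h : ∀ a, IsAtom a → a ≤ x → a ≤ y) : x ≤ y := by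
  have := hE.atomistic
  by_contra hxy
  obtain ⟨a, ha, hax, hay⟩ := exists_atom_le_not_le hxy
  exact hay (h a ha hax)

theorem isAtom_iff_rk {a : E} : IsAtom a ↔ rk a = 1 := ⟨rk_atom, isAtom_of_rk⟩

/-- The exchange property. -/
theorem le_sup_exchange {a b x : E} (ha : IsAtom a) (hb : IsAtom b) (hax : ¬ a ≤ x)
    (h : a ≤ x ⊔ b) : b ≤ x ⊔ a := by
  by_cases hbx : b ≤ x
  · exact hbx.trans le_sup_left
  have h1 := rk_sup_atom ha hax
  have h2 := rk_sup_atom hb hbx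
  rw [eq_of_le_of_rk_le (sup_le le_sup_left h : x ⊔ a ≤ x ⊔ b) (by omega)]
  exact le_sup_right

/-- Lower intervals of geometric lattices are geometric, with the same rank. -/
theorem Iic_geometric (P : E) :
    (∀ x : Set.Iic P, rk x = rk x.1) ∧ IsGeometricLattice (Set.Iic P) := by
  have := hE.finite
  have hat : ∀ p : E, IsAtom p → ∀ h : p ≤ P, IsAtom (⟨p, h⟩ : Set.Iic P) := by
    intro p hp h
    refine ⟨fun e => hp.1 (congrArg Subtype.val e), fun b hb => Subtype.ext (hp.2 b.1 hb)⟩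
  have hatom : IsAtomistic (Set.Iic P) := by
    refine ⟨fun b => ⟨{a | IsAtom a ∧ a ≤ b}, ⟨fun a ha => ha.2, fun c hc => ?_⟩,
      fun a ha => ha.1⟩⟩
    show b.1 ≤ c.1
    refine le_of_forall_atom fun a ha hab => ?_
    exact hc (a := (⟨a, hab.trans b.2⟩ : Set.Iic P)) ⟨hat a ha _, hab⟩
  refine of_rank (fun x : Set.Iic P => rk x.1) rk_bot (fun x y h => rk_strictMono h) ?_ ?_
  · intro a ha
    have h0 : a.1 ≠ ⊥ := fun h => ha.1 (Subtype.ext h)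
    have h1 : IsAtom a.1 := ⟨h0, fun b hb =>
      congrArg Subtype.val (ha.2 (⟨b, hb.le.trans a.2⟩ : Set.Iic P) hb)⟩
    exact (rk_atom h1).le
  · intro x y
    exact hE.semimodular x.1 y.1

instance (P : E) : IsGeometricLattice (Set.Iic P) := (Iic_geometric P).2

theorem isAtom_Iic_iff {P : E} {x : Set.Iic P} : IsAtom x ↔ IsAtom x.1 := by
  rw [isAtom_iff_rk, isAtom_iff_rk, (Iic_geometric P).1]

theorem isAtom_Ici_iff {H : E} (hH : IsAtom H) {K : E} (hK : IsAtom K) :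
    IsAtom (⟨H ⊔ K, le_sup_left⟩ : Set.Ici H) ↔ K ≠ H := by
  have h1 := (Ici_geometric H).1 ⟨H ⊔ K, le_sup_left⟩
  rw [isAtom_iff_rk]
  simp only [rk_atom hH] at h1
  constructor
  · rintro h2 rfl
    have h3 : rk (K ⊔ K) = 1 := by rw [sup_idem, rk_atom hH]
    omega
  · intro hne
    have h3 := rk_sup_atom hK (fun h => hne ((hH.le_iff_eq hK.1).1 h))
    rw [rk_atom hH] at h3
    omega

namespace IsSplit

variable {P Q : E}

theorem sup_eq (h : IsSplit P Q) : P ⊔ Q = ⊤ :=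
  top_le_iff.1 (le_of_forall_atom fun a ha _ =>
    (h.atom_le a ha).elim (fun h => h.trans le_sup_left) fun h => h.trans le_sup_right)

theorem inf_eq (h : IsSplit P Q) : P ⊓ Q = ⊥ := by
  have h1 := hE.semimodular P Q
  have h2 := h.rk_le
  rw [h.sup_eq] at h1
  refine (eq_of_le_of_rk_le bot_le ?_).symm
  rw [rk_bot]; omega

theorem rk_add (h : IsSplit P Q) : rk P + rk Q = rk (⊤ : E) := by
  have h1 := hE.semimodular P Q
  have h2 := h.rk_le
  rw [h.sup_eq] at h1
  omega

theorem inf_sup_inf (h : IsSplit P Q) (z : E) : (z ⊓ P) ⊔ (z ⊓ Q) = z := by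
  refine le_antisymm (sup_le inf_le_left inf_le_left) (le_of_forall_atom fun a ha haz => ?_)
  rcases h.atom_le a ha with h' | h'
  · exact (le_inf haz h').trans le_sup_left
  · exact (le_inf haz h').trans le_sup_right

/-- Ranks add up across a direct decomposition: otherwise submodularity would make the rank of
`P ⊔ Q = ⊤` too small. -/
theorem rk_sup (h : IsSplit P Q) {x y : E} (hx : x ≤ P) (hy : y ≤ Q) :
    rk (x ⊔ y) = rk x + rk y := by
  have h0 := h.rk_add
  have h1 := hE.semimodular P (x ⊔ y)
  have h2 := hE.semimodular (P ⊔ y) Q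
  have h3 := hE.semimodular x y
  have h4 : rk x ≤ rk (P ⊓ (x ⊔ y)) := rk_mono (le_inf hx le_sup_left)
  have h5 : rk y ≤ rk ((P ⊔ y) ⊓ Q) := rk_mono (le_inf le_sup_right hy)
  have e1 : P ⊔ (x ⊔ y) = P ⊔ y := by rw [← sup_assoc, sup_eq_left.2 hx]
  have e2 : P ⊔ y ⊔ Q = ⊤ := by rw [sup_assoc, sup_eq_right.2 hy, h.sup_eq]
  rw [e1] at h1
  rw [e2] at h2
  omega

theorem rk_eq (h : IsSplit P Q) (z : E) : rk z = rk (z ⊓ P) + rk (z ⊓ Q) := by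
  rw [← h.rk_sup inf_le_right inf_le_right, h.inf_sup_inf]

theorem sup_inf_left (h : IsSplit P Q) {x y : E} (hx : x ≤ P) (hy : y ≤ Q) :
    (x ⊔ y) ⊓ P = x := by
  symm
  refine eq_of_le_of_rk_le (le_inf le_sup_left hx) ?_
  have h1 : (x ⊔ y) ⊓ P ⊔ y = x ⊔ y :=
    le_antisymm (sup_le inf_le_left le_sup_right)
      (sup_le ((le_inf le_sup_left hx).trans le_sup_left) le_sup_right)
  have h2 := h.rk_sup (inf_le_right : (x ⊔ y) ⊓ P ≤ P) hy
  rw [h1, h.rk_sup hx hy] at h2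
  omega

theorem sup_inf_right (h : IsSplit P Q) {x y : E} (hx : x ≤ P) (hy : y ≤ Q) :
    (x ⊔ y) ⊓ Q = y := by
  rw [sup_comm, h.symm.sup_inf_left hy hx]

theorem sup_inf (h : IsSplit P Q) (x y : E) : (x ⊔ y) ⊓ P = (x ⊓ P) ⊔ (y ⊓ P) := by
  have e : x ⊔ y = ((x ⊓ P) ⊔ (y ⊓ P)) ⊔ ((x ⊓ Q) ⊔ (y ⊓ Q)) := by
    rw [sup_sup_sup_comm, h.inf_sup_inf, h.inf_sup_inf]
  conv_lhs => rw [e]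
  exact h.sup_inf_left (sup_le inf_le_right inf_le_right) (sup_le inf_le_right inf_le_right)

/-- The isomorphism `E ≃ [⊥, P] × [⊥, Q]`. -/
def orderIso (h : IsSplit P Q) : E ≃o Set.Iic P × Set.Iic Q where
  toFun z := (⟨z ⊓ P, inf_le_right⟩, ⟨z ⊓ Q, inf_le_right⟩)
  invFun p := p.1.1 ⊔ p.2.1
  left_inv z := h.inf_sup_inf z
  right_inv p := Prod.ext (Subtype.ext (h.sup_inf_left p.1.2 p.2.2))
    (Subtype.ext (h.sup_inf_right p.1.2 p.2.2))
  map_rel_iff' {x y} := by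
    constructor
    · intro hxy
      rw [← h.inf_sup_inf x, ← h.inf_sup_inf y]
      exact sup_le_sup hxy.1 hxy.2
    · intro hxy
      exact ⟨inf_le_inf_right _ hxy, inf_le_inf_right _ hxy⟩

theorem not_le_iff (h : IsSplit P Q) {a : E} (ha : IsAtom a) : ¬ a ≤ P ↔ a ≤ Q := by
  refine ⟨(h.atom_le a ha).resolve_left, fun hQ hP => ha.1 ?_⟩
  rw [← le_bot_iff, ← h.inf_eq]
  exact le_inf hP hQ

/-- The complementary factor of a direct factor is unique. -/
theorem right_unique (h : IsSplit P Q) {Q' : E} (h' : IsSplit P Q') : Q = Q' := by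
  refine le_antisymm (le_of_forall_atom fun a ha haQ => ?_) (le_of_forall_atom fun a ha haQ => ?_)
  · exact (h'.not_le_iff ha).1 ((h.not_le_iff ha).2 haQ)
  · exact (h.not_le_iff ha).1 ((h'.not_le_iff ha).2 haQ)

/-- Direct decompositions induce direct decompositions of lower intervals. -/
theorem iic (h : IsSplit P Q) (R : E) :
    IsSplit (⟨P ⊓ R, inf_le_right⟩ : Set.Iic R) ⟨Q ⊓ R, inf_le_right⟩ := by
  have r := (Iic_geometric R).1
  constructor
  · rw [r, r, r]
    show rk (P ⊓ R) + rk (Q ⊓ R) ≤ rk R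
    rw [h.rk_eq R, inf_comm P, inf_comm Q]
  · intro a ha
    rcases h.atom_le a.1 (isAtom_Iic_iff.1 ha) with h1 | h1
    · exact Or.inl (le_inf h1 a.2)
    · exact Or.inr (le_inf h1 a.2)

end IsSplit

theorem isSplit_prod {E₁ E₂ : Type*} [Lattice E₁] [BoundedOrder E₁] [IsGeometricLattice E₁]
    [Lattice E₂] [BoundedOrder E₂] [IsGeometricLattice E₂] :
    IsSplit ((⊤, ⊥) : E₁ × E₂) (⊥, ⊤) :=
  IsSplit.of_orderIso (OrderIso.refl (E₁ × E₂))

/-- A modular element meets each direct factor in a modular element of that factor. -/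
theorem IsModular.inf_split {P Q G : E} (hG : IsModular G) (h : IsSplit P Q) :
    IsModular (⟨G ⊓ P, inf_le_right⟩ : Set.Iic P) := by
  intro x
  have r := (Iic_geometric P).1
  rw [r, r, r, r]
  have h1 := hG x.1
  have h2 := h.rk_eq (G ⊔ x.1)
  have h3 := h.rk_eq G
  have h4 : x.1 ⊓ P = x.1 := inf_eq_left.2 x.2
  have h5 : x.1 ⊓ Q = ⊥ := by
    rw [← le_bot_iff, ← h.inf_eq]
    exact inf_le_inf_right _ x.2
  rw [h.sup_inf, h.symm.sup_inf, h4, h5, sup_bot_eq] at h2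
  have h6 : G ⊓ P ⊓ x.1 = G ⊓ x.1 := by rw [inf_assoc, inf_comm P, h4]
  show rk (G ⊓ P ⊓ x.1) + rk (G ⊓ P ⊔ x.1) = rk (G ⊓ P) + rk x.1
  rw [h6]
  omega

theorem IsModular.iic {G P : E} (hG : IsModular G) (hP : G ≤ P) :
    IsModular (⟨G, hP⟩ : Set.Iic P) := by
  intro x
  have r := (Iic_geometric P).1
  rw [r, r, r, r]
  exact hG x.1

theorem IsModular.ici {G H : E} (hG : IsModular G) (hH : H ≤ G) :
    IsModular (⟨G, hH⟩ : Set.Ici H) := by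
  intro x
  have r := (Ici_geometric H).1
  have h1 := r (⟨G, hH⟩ ⊓ x)
  have h2 := r (⟨G, hH⟩ ⊔ x)
  have h3 := r ⟨G, hH⟩
  have h4 := r x
  have h5 : rk (G ⊓ x.1) + rk (G ⊔ x.1) = rk G + rk x.1 := hG x.1
  change _ = rk (G ⊓ x.1) at h1
  change _ = rk (G ⊔ x.1) at h2
  simp only at h3
  omega

theorem isModular_prod {E₁ E₂ : Type*} [Lattice E₁] [BoundedOrder E₁] [IsGeometricLattice E₁]
    [Lattice E₂] [BoundedOrder E₂] [IsGeometricLattice E₂] {G₁ : E₁} {G₂ : E₂}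
    (h₁ : IsModular G₁) (h₂ : IsModular G₂) : IsModular ((G₁, G₂) : E₁ × E₂) := by
  intro x
  have h1 := h₁ x.1
  have h2 := h₂ x.2
  simp only [prod_geometric.1, Prod.fst_inf, Prod.snd_inf, Prod.fst_sup, Prod.snd_sup]
  omega

end Lattice

/-! ### Words in a modular extension -/

namespace ModularExtension

section Basic

variable {L : Type u} [Lattice L] [BoundedOrder L]

instance [Nontrivial L] (X : ModularExtension L) : Nontrivial X.E :=
  X.isEmbedding.injective.nontrivial

/-- The flat spanned by `F_ι` and the letters of `J`. -/
def span (X : ModularExtension L) (J : List X.E) : X.E := X.flat ⊔ (J : Multiset X.E).sup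

theorem span_le_iff (X : ModularExtension L) {J : List X.E} {x : X.E} :
    X.span J ≤ x ↔ X.flat ≤ x ∧ ∀ H ∈ J, H ≤ x := by
  rw [span, sup_le_iff, Multiset.sup_le]
  rfl

theorem flat_le_span (X : ModularExtension L) (J : List X.E) : X.flat ≤ X.span J := le_sup_left

theorem le_span (X : ModularExtension L) {J : List X.E} {H : X.E} (h : H ∈ J) : H ≤ X.span J :=
  (X.span_le_iff.1 le_rfl).2 H h

theorem span_nil (X : ModularExtension L) : X.span [] = X.flat := by simp [span]

theorem span_cons (X : ModularExtension L) (H : X.E) (J : List X.E) :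
    X.span (H :: J) = H ⊔ X.span J := by
  simp only [span, ← Multiset.cons_coe, Multiset.sup_cons]
  exact sup_left_comm _ _ _

theorem span_perm (X : ModularExtension L) {J J' : List X.E} (h : J.Perm J') :
    X.span J = X.span J' := by
  simp only [span, Multiset.coe_eq_coe.2 h]

/-- An embedding of modular extensions of `L` of the same rank. -/
structure IsFullEmbedding (X Y : ModularExtension L) (φ : X.E → Y.E) : Prop extends
    IsEmbedding φ where
  rk_top : rk (⊤ : X.E) = rk (⊤ : Y.E)
  map_ι : ∀ l, Y.ι l = φ (X.ι l)

theorem isFullEmbedding_orderIso {X Y : ModularExtension L} (e : X.E ≃o Y.E)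
    (h : ∀ l, e (X.ι l) = Y.ι l) : IsFullEmbedding X Y e where
  toIsEmbedding := isEmbedding_orderIso e
  rk_top := by rw [← rk_orderIso e, e.map_top]
  map_ι l := (h l).symm

namespace IsFullEmbedding

variable {X Y : ModularExtension L} {φ : X.E → Y.E}

theorem map_flat (h : IsFullEmbedding X Y φ) : φ X.flat = Y.flat := (h.map_ι ⊤).symm

theorem map_span (h : IsFullEmbedding X Y φ) (J : List X.E) :
    φ (X.span J) = Y.span (J.map φ) := by
  induction J with
  | nil => rw [List.map_nil, span_nil, span_nil, h.map_flat]
  | cons H J ih => rw [List.map_cons, span_cons, span_cons, h.map_sup, ih]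

theorem map_trace [Nontrivial L] [IsGeometricLattice L] (h : IsFullEmbedding X Y φ) (x : X.E) :
    Y.trace (φ x) = X.trace x := by
  symm
  refine eq_of_le_of_rk_le ?_ ?_
  · rw [le_trace_iff, h.map_ι, h.le_iff_le, ι_trace]
    exact inf_le_left
  · have h1 := X.rk_sup_flat x
    have h2 := Y.rk_sup_flat (φ x)
    rw [← h.map_flat, ← h.map_sup, h.rk_map, h.rk_map, h.rk_map] at h2
    rw [rk_ι] at h1 h2
    omega

end IsFullEmbedding

/-- The extension `E` is a product of two geometric lattices, the second of which is not trivial,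
and `F_ι` lies in the first factor. -/
def Splits (X : ModularExtension L) : Prop :=
  ∃ P Q : X.E, IsSplit P Q ∧ X.flat ≤ P ∧ Q ≠ ⊥

/-- The degree of the diagram with the word `J`, written in terms of the flat spanned by `F_ι` and
`J`: as `F_ι` is modular, `rk (⋁J) - rk (⋁J ∧ F_ι)` is the rank of this flat over `F_ι`. -/
noncomputable def wordDeg (X : ModularExtension L) (J : List X.E) : ℤ :=
  (J.length : ℤ) - 2 * ((rk (X.span J) : ℤ) - (rk X.flat : ℤ))

theorem wordDeg_perm (X : ModularExtension L) {J J' : List X.E} (h : J.Perm J') :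
    X.wordDeg J = X.wordDeg J' := by
  rw [wordDeg, wordDeg, X.span_perm h, h.length_eq]

theorem IsFullEmbedding.wordDeg [Nontrivial L] {X Y : ModularExtension L} {φ : X.E → Y.E}
    (h : IsFullEmbedding X Y φ) (J : List X.E) : Y.wordDeg (J.map φ) = X.wordDeg J := by
  rw [ModularExtension.wordDeg, ModularExtension.wordDeg, ← h.map_span, ← h.map_flat, h.rk_map,
    h.rk_map, List.length_map]

/-- The parity of the degree is the parity of the length of the word. -/
theorem neg_one_zpow_wordDeg (X : ModularExtension L) (J : List X.E) :
    (-1 : ℚ) ^ X.wordDeg J = (-1 : ℚ) ^ J.length := by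
  rw [wordDeg, zpow_sub₀ (by norm_num), (even_two_mul _).neg_one_zpow, div_one, zpow_natCast]

/-- The lower interval `[⊥, P]` as a modular extension, for a flat `P ≥ F_ι`. -/
@[reducible] def restrict (X : ModularExtension L) (P : X.E) (hP : X.flat ≤ P) :
    ModularExtension L where
  E := Set.Iic P
  ι l := ⟨X.ι l, (X.ι_le_flat l).trans hP⟩
  isEmbedding :=
    { injective := fun _ _ h => X.isEmbedding.injective (congrArg Subtype.val h)
      map_sup := fun _ _ => Subtype.ext (X.isEmbedding.map_sup _ _)
      map_atom := fun a ha => isAtom_Iic_iff.2 (X.isEmbedding.map_atom a ha) }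
  range_ι := by
    ext x
    constructor
    · rintro ⟨l, rfl⟩
      exact X.ι_le_flat l
    · intro hx
      obtain ⟨a, ha⟩ := X.exists_ι_eq (show x.1 ≤ X.flat from hx)
      exact ⟨a, Subtype.ext ha⟩
  isModular := X.isModular.iic hP

/-- The product of a modular extension of `L` with a geometric lattice `B`, as a modular extension
of `L`. -/
@[reducible] def addFactor (X : ModularExtension L) (B : Type u) [Lattice B] [BoundedOrder B]
    [IsGeometricLattice B] : ModularExtension L where
  E := X.E × B
  ι l := (X.ι l, ⊥)
  isEmbedding :=
    { injective := fun _ _ h => X.isEmbedding.injective (congrArg Prod.fst h)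
      map_sup := fun _ _ => Prod.ext (X.isEmbedding.map_sup _ _) (sup_idem ⊥).symm
      map_atom := fun a ha => isAtom_prod_left (X.isEmbedding.map_atom a ha) }
  range_ι := by
    ext x
    constructor
    · rintro ⟨l, rfl⟩
      exact ⟨X.ι_le_flat l, le_rfl⟩
    · rintro ⟨h1, h2⟩
      obtain ⟨a, ha⟩ := X.exists_ι_eq h1
      exact ⟨a, Prod.ext ha (le_bot_iff.1 h2).symm⟩
  isModular := isModular_prod X.isModular fun x => by simp

theorem splits_addFactor (X : ModularExtension L) (B : Type u) [Lattice B] [BoundedOrder B]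
    [IsGeometricLattice B] [Nontrivial B] : (X.addFactor B).Splits :=
  ⟨(⊤, ⊥), (⊥, ⊤), isSplit_prod, ⟨le_top, le_rfl⟩, fun h => top_ne_bot (congrArg Prod.snd h)⟩

/-- A direct decomposition of `E` whose first factor contains `F_ι` but not `P` induces one of
`[⊥, P]`. -/
theorem splits_restrict (X : ModularExtension L) {P : X.E} (hP : X.flat ≤ P) {R S : X.E}
    (h : IsSplit R S) (hR : X.flat ≤ R) (hPR : ¬ P ≤ R) : (X.restrict P hP).Splits := by
  refine ⟨_, _, h.iic P, le_inf hR hP, fun h0 => hPR ?_⟩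
  have h1 : S ⊓ P = ⊥ := congrArg Subtype.val h0
  have h2 := h.inf_sup_inf P
  rw [inf_comm P S, h1, sup_bot_eq] at h2
  exact inf_eq_left.1 h2

end Basic

end ModularExtension

open ModularExtension

section Word

variable {L : Type u} [Lattice L] [BoundedOrder L]

open Classical in
/-- The class of the diagram `(E, ι, J)`, set to be zero if some letter of `J` is not an atom. -/
noncomputable def MD.word (X : ModularExtension L) (J : List X.E) : MD L :=
  if h : ∀ H ∈ J, IsAtom H then MD.mk ⟨X, J, h⟩ else 0

theorem MD.word_of_isAtom (X : ModularExtension L) {J : List X.E} (h : ∀ H ∈ J, IsAtom H) :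
    MD.word X J = MD.mk ⟨X, J, h⟩ := dif_pos h

theorem MD.word_of_not_isAtom (X : ModularExtension L) {J : List X.E} {H : X.E} (hH : H ∈ J)
    (h : ¬ IsAtom H) : MD.word X J = 0 := dif_neg fun h' => h (h' H hH)

theorem MD.mk_eq_word (Γ : ModularDiagram L) : MD.mk Γ = MD.word Γ.toModularExtension Γ.J :=
  (MD.word_of_isAtom _ Γ.isAtom).symm

theorem MD.mk_eq_zero {Γ : ModularDiagram L} (h : MDRel L (Finsupp.single Γ 1)) : MD.mk Γ = 0 :=
  (Submodule.Quotient.mk_eq_zero _).2 (Submodule.subset_span h)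

theorem ModularDiagram.deg_eq (Γ : ModularDiagram L) :
    Γ.deg = Γ.toModularExtension.wordDeg Γ.J := by
  have h : rk (Γ.flat ⊓ Γ.join) + rk (Γ.flat ⊔ Γ.join) = rk Γ.flat + rk Γ.join := Γ.isModular _
  rw [ModularDiagram.deg, wordDeg, inf_comm]
  change _ = (Γ.J.length : ℤ) - 2 * ((rk (Γ.flat ⊔ Γ.join) : ℤ) - (rk Γ.flat : ℤ))
  omega

theorem MD.word_mem_gr (X : ModularExtension L) (J : List X.E) :
    MD.word X J ∈ MD.gr L (X.wordDeg J) := by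
  by_cases h : ∀ H ∈ J, IsAtom H
  · rw [MD.word_of_isAtom X h]
    exact Submodule.subset_span ⟨_, ModularDiagram.deg_eq _, rfl⟩
  · rw [MD.word, dif_neg h]
    exact Submodule.zero_mem _

theorem MD.word_antisymm (X : ModularExtension L) : Antisymm (MD.word X) := by
  intro A B H K
  by_cases h : ∀ M ∈ A ++ H :: K :: B, IsAtom M
  · have h' : ∀ M ∈ A ++ K :: H :: B, IsAtom M := fun M hM => h M <| by
      simp only [List.mem_append, List.mem_cons] at hM ⊢; tauto
    rw [MD.word_of_isAtom X h, MD.word_of_isAtom X h', MD.mk_swap]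
  · have h' : ¬ ∀ M ∈ A ++ K :: H :: B, IsAtom M := fun h' => h fun M hM => h' M <| by
      simp only [List.mem_append, List.mem_cons] at hM ⊢; tauto
    rw [MD.word, MD.word, dif_neg h, dif_neg h', neg_zero]

theorem MD.word_map [Nontrivial L] {X Y : ModularExtension L} {φ : X.E → Y.E}
    (h : IsFullEmbedding X Y φ) (J : List X.E) : MD.word Y (J.map φ) = MD.word X J := by
  by_cases hJ : ∀ H ∈ J, IsAtom H
  · have hJ' : ∀ H ∈ J.map φ, IsAtom H := by
      simpa only [List.forall_mem_map, h.isAtom_iff] using hJ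
    rw [MD.word_of_isAtom X hJ, MD.word_of_isAtom Y hJ', eq_comm, ← sub_eq_zero, MD.mk, MD.mk,
      ← Submodule.Quotient.mk_sub]
    exact (Submodule.Quotient.mk_eq_zero _).2 (Submodule.subset_span
      (MDRel.embed ⟨X, J, hJ⟩ ⟨Y, J.map φ, hJ'⟩ φ h.toIsEmbedding h.rk_top h.map_ι rfl))
  · have hJ' : ¬ ∀ H ∈ J.map φ, IsAtom H := by
      simpa only [List.forall_mem_map, h.isAtom_iff] using hJ
    rw [MD.word, MD.word, dif_neg hJ, dif_neg hJ']

theorem MD.word_eq_zero_of_span {X : ModularExtension L} {J : List X.E} (h : X.span J ≠ ⊤) :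
    MD.word X J = 0 := by
  by_cases hJ : ∀ H ∈ J, IsAtom H
  · rw [MD.word_of_isAtom X hJ]
    exact MD.mk_eq_zero (MDRel.join_lt _ (lt_top_iff_ne_top.2 h))
  · rw [MD.word, dif_neg hJ]

theorem ModularExtension.flat_ne_bot [Nontrivial L] (X : ModularExtension L) : X.flat ≠ ⊥ :=
  fun h => bot_ne_top (X.isEmbedding.injective (X.ι_bot.trans h.symm))

theorem MD.word_eq_zero_of_splits [Nontrivial L] {X : ModularExtension L} (h : X.Splits)
    (J : List X.E) : MD.word X J = 0 := by
  by_cases hJ : ∀ H ∈ J, IsAtom H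
  · rw [MD.word_of_isAtom X hJ]
    obtain ⟨P, Q, hPQ, hF, hQ⟩ := h
    have : Nontrivial (Set.Iic P) := ⟨⟨⊥, ⊤, fun h => X.flat_ne_bot
      (le_bot_iff.1 (hF.trans (congrArg Subtype.val h).ge))⟩⟩
    have : Nontrivial (Set.Iic Q) := ⟨⟨⊥, ⊤, fun h => hQ (congrArg Subtype.val h).symm⟩⟩
    refine MD.mk_eq_zero (MDRel.product _ (Set.Iic P) (Set.Iic Q) hPQ.orderIso ?_)
    refine Subtype.ext (le_bot_iff.1 ?_)
    show X.flat ⊓ Q ≤ ⊥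
    rw [← hPQ.inf_eq]
    exact inf_le_inf_right _ hF
  · rw [MD.word, dif_neg hJ]

theorem MD.word_eq_zero_of_isModular {X : ModularExtension L} {G A B : X.E} {R : List X.E}
    (hG : IsModular G) (hF : X.flat ≤ G) (hA : ¬ A ≤ G) (hB : ¬ B ≤ G) (hR : ∀ K ∈ R, K ≤ G) :
    MD.word X (A :: B :: R) = 0 := by
  by_cases hJ : ∀ H ∈ A :: B :: R, IsAtom H
  · rw [MD.word_of_isAtom X hJ]
    classical
    refine MD.mk_eq_zero (MDRel.modular _ G hG hF ?_)
    have : R.filter (fun H => decide ¬ H ≤ G) = [] := by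
      rw [List.filter_eq_nil_iff]
      intro K hK
      simpa using hR K hK
    simp_all
  · rw [MD.word, dif_neg hJ]

/-- A word with a bridge `H` is zero: the product of `[⊥, G]` and `[⊥, H]` embeds into the extension
with the same rank, and `F_ι` lies in its first factor. -/
theorem MD.word_eq_zero_of_bridge [Nontrivial L] {X : ModularExtension L} {G H : X.E}
    (hF : X.flat ≤ G) (hH : IsAtom H) (hHG : ¬ H ≤ G) {J : List X.E}
    (hJ : ∀ K ∈ J, K ≤ G ∨ K = H) : MD.word X J = 0 := by
  by_cases hs : X.span J = ⊤
  swap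
  · exact MD.word_eq_zero_of_span hs
  have htop : G ⊔ H = ⊤ := by
    rw [← top_le_iff, ← hs, span_le_iff]
    exact ⟨hF.trans le_sup_left, fun K hK => (hJ K hK).elim (fun h => h.trans le_sup_left)
      fun h => h.le.trans le_sup_right⟩
  have hr := rk_sup_atom hH hHG
  have hinf : ∀ x ≤ G, (x ⊔ H) ⊓ G = x := by
    intro x hx
    have h1 : ¬ H ≤ x := fun h => hHG (h.trans hx)
    have h2 := rk_sup_atom hH h1
    have h3 : (x ⊔ H) ⊓ G < x ⊔ H := lt_of_le_of_ne inf_le_left fun h =>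
      hHG (le_sup_right.trans (inf_eq_left.1 h))
    have h4 := rk_strictMono h3
    exact (eq_of_le_of_rk_le (le_inf le_sup_left hx) (by omega)).symm
  have hinf' : ∀ x ≤ G, ∀ y ≤ H, (x ⊔ y) ⊓ G = x := by
    intro x hx y hy
    rcases hH.le_iff.1 hy with rfl | rfl
    · rw [sup_bot_eq, inf_eq_left.2 hx]
    · exact hinf x hx
  have : Nontrivial (Set.Iic H) := ⟨⟨⊥, ⊤, fun h => hH.1 (congrArg Subtype.val h).symm⟩⟩
  have hφ : IsFullEmbedding ((X.restrict G hF).addFactor (Set.Iic H)) X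
      (fun p => p.1.1 ⊔ p.2.1) :=
    { injective := by
        intro p q hpq
        change p.1.1 ⊔ p.2.1 = q.1.1 ⊔ q.2.1 at hpq
        have h1 : p.1.1 = q.1.1 := by
          rw [← hinf' p.1.1 p.1.2 p.2.1 p.2.2, hpq, hinf' q.1.1 q.1.2 q.2.1 q.2.2]
        refine Prod.ext (Subtype.ext h1) (Subtype.ext ?_)
        have key : ∀ y ≤ H, ∀ z ≤ H, p.1.1 ⊔ y = p.1.1 ⊔ z → y ≤ z := by
          intro y hy z hz e
          rcases hH.le_iff.1 hy with rfl | rfl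
          · exact bot_le
          rcases hH.le_iff.1 hz with rfl | rfl
          · rw [sup_bot_eq] at e
            exact absurd (le_sup_right.trans (e.le.trans p.1.2)) hHG
          · exact le_rfl
        rw [← h1] at hpq
        exact le_antisymm (key _ p.2.2 _ q.2.2 hpq) (key _ q.2.2 _ p.2.2 hpq.symm)
      map_sup := fun p q => sup_sup_sup_comm _ _ _ _
      map_atom := by
        intro p hp
        have h1 := rk_atom hp
        rw [prod_geometric.1, (Iic_geometric G).1, (Iic_geometric H).1] at h1
        have h2 := X.geometric.semimodular p.1.1 p.2.1
        refine isAtom_of_rk (le_antisymm (by omega) ?_)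
        by_contra h0
        have h3 : rk p.1.1 ≤ rk (p.1.1 ⊔ p.2.1) := rk_mono le_sup_left
        have h4 : rk p.2.1 ≤ rk (p.1.1 ⊔ p.2.1) := rk_mono le_sup_right
        omega
      rk_top := by
        rw [prod_geometric.1, (Iic_geometric G).1, (Iic_geometric H).1, ← htop, hr]
        show rk G + rk H = _
        rw [rk_atom hH]
      map_ι := fun l => (sup_bot_eq (X.ι l)).symm }
  have hmap : (J.map fun K => ((⟨K ⊓ G, inf_le_right⟩, ⟨K ⊓ H, inf_le_right⟩) :
      Set.Iic G × Set.Iic H)).map (fun p => p.1.1 ⊔ p.2.1) = J := by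
    rw [List.map_map]
    refine (List.map_congr_left fun K hK => ?_).trans (List.map_id J)
    show K ⊓ G ⊔ K ⊓ H = K
    rcases hJ K hK with h | rfl
    · rw [inf_eq_left.2 h, sup_eq_left]
      exact inf_le_left
    · rw [inf_idem, sup_eq_right]
      exact inf_le_left
  rw [← hmap]
  exact (MD.word_map hφ _).trans
    (MD.word_eq_zero_of_splits (splits_addFactor (X.restrict G hF) (Set.Iic H)) _)

/-! ### Functions on diagrams that respect the relations -/

variable {V : Type*} [AddCommGroup V] [Module ℚ V]

/-- Functions of the modular extensions of `L` and of the words in their atoms that respect the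
relations of `MD(L)`. -/
structure IsInvariant (f : ∀ X : ModularExtension L, List X.E → V) : Prop where
  antisymm : ∀ X, Antisymm (f X)
  map : ∀ {X Y : ModularExtension L} {φ : X.E → Y.E}, IsFullEmbedding X Y φ →
    ∀ J : List X.E, (∀ H ∈ J, IsAtom H) → f Y (J.map φ) = f X J
  span : ∀ {X : ModularExtension L} {J : List X.E}, (∀ H ∈ J, IsAtom H) → X.span J ≠ ⊤ → f X J = 0
  splits : ∀ {X : ModularExtension L} {J : List X.E}, (∀ H ∈ J, IsAtom H) → X.Splits → f X J = 0
  modular : ∀ {X : ModularExtension L} {G A B : X.E} {R : List X.E},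
    (∀ H ∈ A :: B :: R, IsAtom H) → IsModular G → X.flat ≤ G → ¬ A ≤ G → ¬ B ≤ G →
    (∀ K ∈ R, K ≤ G) → f X (A :: B :: R) = 0

theorem IsInvariant.mkQ {f : ∀ X : ModularExtension L, List X.E → V} (hf : IsInvariant f) :
    Submodule.span ℚ {x | MDRel L x} ≤ LinearMap.ker
      (Finsupp.linearCombination ℚ fun Γ : ModularDiagram L => f Γ.toModularExtension Γ.J) := by
  classical
  rw [Submodule.span_le]
  intro x hx
  rw [SetLike.mem_coe, LinearMap.mem_ker]
  cases hx with
  | swap X A B H K h h' => simp [hf.antisymm X A B H K]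
  | embed Γ Γ' φ hφ hrk hι hJ =>
    simp only [map_sub, Finsupp.linearCombination_single, one_smul]
    rw [hJ, hf.map ⟨hφ, hrk, hι⟩ Γ.J Γ.isAtom, sub_self]
  | join_lt Γ h =>
    simp only [Finsupp.linearCombination_single, one_smul]
    exact hf.span Γ.isAtom h.ne
  | product Γ E₁ E₂ e h =>
    simp only [Finsupp.linearCombination_single, one_smul]
    refine hf.splits Γ.isAtom ⟨_, _, IsSplit.of_orderIso e, ?_, fun h0 => ?_⟩
    · rw [OrderIso.le_symm_apply]
      exact ⟨le_top, h.le⟩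
    · rw [OrderIso.symm_apply_eq, e.map_bot] at h0
      exact top_ne_bot (congrArg Prod.snd h0)
  | modular Γ F hF hle h =>
    simp only [Finsupp.linearCombination_single, one_smul]
    obtain ⟨A, B, hAB⟩ := List.length_eq_two.1 h
    have hp := List.filter_append_perm (fun H => decide ¬ H ≤ F) Γ.J
    rw [hAB] at hp
    refine (hf.antisymm _).eq_zero_of_perm hp.symm ?_
    have hA : A ∈ Γ.J.filter (fun H => decide ¬ H ≤ F) := by rw [hAB]; simp
    have hB : B ∈ Γ.J.filter (fun H => decide ¬ H ≤ F) := by rw [hAB]; simp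
    refine hf.modular (fun H hH => Γ.isAtom H (hp.subset hH)) hF hle ?_ ?_ ?_
    · simpa using (List.mem_filter.1 hA).2
    · simpa using (List.mem_filter.1 hB).2
    · intro K hK
      simpa using (List.mem_filter.1 hK).2

/-- The linear map on `MD(L)` given by a function that respects the relations. -/
noncomputable def MD.lift (f : ∀ X : ModularExtension L, List X.E → V) (hf : IsInvariant f) :
    MD L →ₗ[ℚ] V :=
  Submodule.liftQ _ (Finsupp.linearCombination ℚ fun Γ : ModularDiagram L =>
    f Γ.toModularExtension Γ.J) hf.mkQ

theorem MD.lift_mk (f : ∀ X : ModularExtension L, List X.E → V) (hf : IsInvariant f)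
    (Γ : ModularDiagram L) : MD.lift f hf (MD.mk Γ) = f Γ.toModularExtension Γ.J := by
  rw [MD.lift, MD.mk, Submodule.liftQ_apply, Finsupp.linearCombination_single, one_smul]

theorem MD.lift_word (f : ∀ X : ModularExtension L, List X.E → V) (hf : IsInvariant f)
    (X : ModularExtension L) {J : List X.E} (hJ : ∀ H ∈ J, IsAtom H) :
    MD.lift f hf (MD.word X J) = f X J := by
  rw [MD.word_of_isAtom X hJ, MD.lift_mk]

theorem MD.hom_ext {φ ψ : MD L →ₗ[ℚ] V}
    (h : ∀ (X : ModularExtension L) (J : List X.E), (∀ H ∈ J, IsAtom H) →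
      φ (MD.word X J) = ψ (MD.word X J)) : φ = ψ :=
  LinearMap.ext_on_range (v := MD.mk (L := L)) MD.span_mk fun Γ => by
    rw [MD.mk_eq_word]; exact h _ _ Γ.isAtom

/-- A statement about `MD(L)` may be checked on words. -/
@[elab_as_elim]
theorem MD.induction {p : MD L → Prop} (x : MD L) (hz : p 0) (ha : ∀ x y, p x → p y → p (x + y))
    (hs : ∀ (c : ℚ) x, p x → p (c • x))
    (h : ∀ (X : ModularExtension L) (J : List X.E), (∀ H ∈ J, IsAtom H) → p (MD.word X J)) :
    p x := by
  have hx : x ∈ Submodule.span ℚ (Set.range (MD.mk (L := L))) := by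
    rw [MD.span_mk]; trivial
  induction hx using Submodule.span_induction with
  | zero => exact hz
  | add x y _ _ hx hy => exact ha x y hx hy
  | smul c x _ hx => exact hs c x hx
  | mem x hx =>
    obtain ⟨Γ, rfl⟩ := hx
    rw [MD.mk_eq_word]
    exact h _ _ Γ.isAtom

@[elab_as_elim]
theorem MD.gr_induction {n : ℤ} {p : MD L → Prop} {x : MD L} (hx : x ∈ MD.gr L n) (hz : p 0)
    (ha : ∀ x y, p x → p y → p (x + y)) (hs : ∀ (c : ℚ) x, p x → p (c • x))
    (h : ∀ (X : ModularExtension L) (J : List X.E), (∀ H ∈ J, IsAtom H) → X.wordDeg J = n →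
      p (MD.word X J)) : p x := by
  induction hx using Submodule.span_induction with
  | zero => exact hz
  | add x y _ _ hx hy => exact ha x y hx hy
  | smul c x _ hx => exact hs c x hx
  | mem x hx =>
    obtain ⟨Γ, hΓ, rfl⟩ := hx
    rw [MD.mk_eq_word]
    rw [ModularDiagram.deg_eq] at hΓ
    exact h _ _ Γ.isAtom hΓ

/-! ### The grading -/

/-- The decomposition of an element of `MD(L)` by degree. -/
noncomputable def MD.dec [Nontrivial L] : MD L →ₗ[ℚ] DirectSum ℤ fun _ => MD L :=
  MD.lift (fun X J => DirectSum.lof ℚ ℤ (fun _ => MD L) (X.wordDeg J) (MD.word X J))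
    { antisymm := fun X A B H K => by
        show DirectSum.lof _ _ _ _ _ = - DirectSum.lof _ _ _ _ _
        rw [MD.word_antisymm, map_neg, X.wordDeg_perm (List.Perm.append_left A
          (List.Perm.swap K H B))]
      map := fun h J _ => by rw [MD.word_map h, h.wordDeg]
      span := fun _ h => by rw [MD.word_eq_zero_of_span h, map_zero]
      splits := fun _ h => by rw [MD.word_eq_zero_of_splits h, map_zero]
      modular := fun _ hG hF hA hB hR => by
        rw [MD.word_eq_zero_of_isModular hG hF hA hB hR, map_zero] }

theorem MD.dec_of_mem [Nontrivial L] {n : ℤ} {x : MD L} (hx : x ∈ MD.gr L n) :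
    MD.dec x = DirectSum.lof ℚ ℤ (fun _ => MD L) n x := by
  refine MD.gr_induction hx (by simp) (fun x y hx hy => by rw [map_add, map_add, hx, hy])
    (fun c x hx => by rw [map_smul, map_smul, hx]) ?_
  rintro X J hJ rfl
  rw [MD.dec, MD.lift_word _ _ X hJ]

theorem MD.gr_isInternal [Nontrivial L] : DirectSum.IsInternal (MD.gr L) := by
  constructor
  · intro x y hxy
    have key : ∀ (m : ℤ) (z : DirectSum ℤ fun n => MD.gr L n),
        DirectSum.component ℚ ℤ (fun _ => MD L) m
          (MD.dec (DirectSum.coeLinearMap (MD.gr L) z)) = (z m : MD L) := by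
      intro m z
      induction z using DirectSum.induction_on with
      | zero => simp
      | add x y hx hy => simp only [map_add, hx, hy]; rfl
      | of n z =>
        have := MD.dec_of_mem z.2
        rw [← DirectSum.lof_eq_of ℚ, DirectSum.coeLinearMap_lof, this]
        by_cases h : n = m
        · subst h
          simp [DirectSum.component.lof_self, DirectSum.lof_apply]
        · rw [DirectSum.component.of, dif_neg h, DirectSum.lof_eq_of, DirectSum.of_eq_of_ne]
          · rfl
          · exact fun e => h e.symm
    refine DFinsupp.ext fun m => Subtype.ext ?_
    rw [← key m x, ← key m y]
    congr 2
  · intro x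
    refine MD.induction x ⟨0, map_zero _⟩ ?_ ?_ fun X J _ => ?_
    · rintro _ _ ⟨x, rfl⟩ ⟨y, rfl⟩
      exact ⟨x + y, map_add _ _ _⟩
    · rintro c _ ⟨x, rfl⟩
      exact ⟨c • x, map_smul (DirectSum.coeLinearMap (MD.gr L)) c x⟩
    · exact ⟨DirectSum.of (fun n => MD.gr L n) _ ⟨_, MD.word_mem_gr X J⟩,
        DirectSum.coeAddMonoidHom_of _ _ _⟩

end Word

/-! ### Contractions -/

section

section Ici

variable {E : Type*} [Lattice E] [BoundedOrder E] [hE : IsGeometricLattice E]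

theorem exists_atom_of_isAtom_Ici {H : E} {a : Set.Ici H} (ha : IsAtom a) :
    ∃ b, IsAtom b ∧ ¬ b ≤ H ∧ a.1 = H ⊔ b := by
  have := hE.atomistic
  have h1 := (Ici_geometric H).1 a
  rw [rk_atom ha] at h1
  obtain ⟨b, hb, hba, hbH⟩ := exists_atom_le_not_le (a := H) (b := a.1)
    fun h => by have := rk_mono h; omega
  refine ⟨b, hb, hbH, (eq_of_le_of_rk_le (sup_le a.2 hba) ?_).symm⟩
  rw [rk_sup_atom hb hbH]
  omega

/-- A direct decomposition induces one of the upper interval of an atom of the first factor. -/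
theorem IsSplit.ici {P Q H : E} (h : IsSplit P Q) (hH : IsAtom H) (hHP : H ≤ P) :
    IsSplit (⟨P, hHP⟩ : Set.Ici H) ⟨Q ⊔ H, le_sup_right⟩ := by
  have r := (Ici_geometric H).1
  constructor
  · have h1 := r ⟨P, hHP⟩
    have h2 := r ⟨Q ⊔ H, le_sup_right⟩
    have h3 := r ⊤
    have h4 : ¬ H ≤ Q := fun hQ => (h.symm.not_le_iff hH).2 hHP hQ
    have h5 := rk_sup_atom hH h4
    have h6 := h.rk_add
    have h7 := rk_atom hH
    change _ = rk (⊤ : E) at h3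
    simp only at h1 h2
    omega
  · intro a ha
    obtain ⟨b, hb, -, hab⟩ := exists_atom_of_isAtom_Ici ha
    rcases h.atom_le b hb with h1 | h1
    · exact Or.inl (show a.1 ≤ P from hab.le.trans (sup_le hHP h1))
    · exact Or.inr (show a.1 ≤ Q ⊔ H from hab.le.trans (sup_le le_sup_right
        (h1.trans le_sup_left)))

end Ici

variable {L : Type u} [Lattice L] [BoundedOrder L] [IsGeometricLattice L]

namespace ModularExtension

/-- The map `x ↦ H ∨ x` from `E` to the contraction `[H, ⊤]`. -/
def toContract (X : ModularExtension L) {H : X.E} (hH : IsAtom H) (hHF : ¬ H ≤ X.flat)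
    (x : X.E) : (X.contract H hH hHF).E :=
  (⟨H ⊔ x, le_sup_left⟩ : Set.Ici H)

/-- The inclusion of `[H, ⊤]` into `E`. -/
def ofContract (X : ModularExtension L) {H : X.E} {hH : IsAtom H} {hHF : ¬ H ≤ X.flat}
    (x : (X.contract H hH hHF).E) : X.E :=
  Subtype.val (p := fun y => y ∈ Set.Ici H) x

section Contract

variable (X : ModularExtension L) {H : X.E} {hH : IsAtom H} {hHF : ¬ H ≤ X.flat}

theorem ofContract_toContract (x : X.E) : X.ofContract (X.toContract hH hHF x) = H ⊔ x := rfl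

theorem ofContract_injective :
    Function.Injective (X.ofContract : (X.contract H hH hHF).E → X.E) := fun _ _ h => Subtype.ext h

theorem ofContract_le_iff {x y : (X.contract H hH hHF).E} :
    X.ofContract x ≤ X.ofContract y ↔ x ≤ y := Iff.rfl

theorem le_ofContract (x : (X.contract H hH hHF).E) : H ≤ X.ofContract x := x.2

theorem toContract_ofContract (x : (X.contract H hH hHF).E) :
    X.toContract hH hHF (X.ofContract x) = x :=
  Subtype.ext (sup_eq_right.2 (X.le_ofContract x))

theorem ofContract_sup (x y : (X.contract H hH hHF).E) :
    X.ofContract (x ⊔ y) = X.ofContract x ⊔ X.ofContract y := rfl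

theorem ofContract_top : X.ofContract (⊤ : (X.contract H hH hHF).E) = ⊤ := rfl

theorem ofContract_ι (l : L) : X.ofContract ((X.contract H hH hHF).ι l) = H ⊔ X.ι l := rfl

theorem ofContract_flat : X.ofContract (X.contract H hH hHF).flat = H ⊔ X.flat := rfl

theorem toContract_le_iff {x : X.E} {y : (X.contract H hH hHF).E} :
    X.toContract hH hHF x ≤ y ↔ x ≤ X.ofContract y := by
  rw [← X.ofContract_le_iff, ofContract_toContract, sup_le_iff, and_iff_right (X.le_ofContract y)]

theorem isAtom_toContract_iff {K : X.E} (hK : IsAtom K) :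
    IsAtom (X.toContract hH hHF K) ↔ K ≠ H := isAtom_Ici_iff hH hK

theorem ofContract_span (R : List X.E) :
    X.ofContract ((X.contract H hH hHF).span (R.map (X.toContract hH hHF))) =
      X.span (H :: R) := by
  induction R with
  | nil => rw [List.map_nil, span_nil, span_cons, span_nil, ofContract_flat]
  | cons K R ih =>
    rw [List.map_cons, span_cons, ofContract_sup, ih, ofContract_toContract, span_cons,
      span_cons, span_cons, sup_sup_sup_comm, sup_idem]

theorem rk_contract (x : (X.contract H hH hHF).E) : rk x + 1 = rk (X.ofContract x) := by
  have := (Ici_geometric H).1 x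
  rw [rk_atom hH] at this
  exact this

theorem wordDeg_contract (R : List X.E) :
    (X.contract H hH hHF).wordDeg (R.map (X.toContract hH hHF)) = X.wordDeg (H :: R) + 1 := by
  have h1 := X.rk_contract ((X.contract H hH hHF).span (R.map (X.toContract hH hHF)))
  have h2 := X.rk_contract (X.contract H hH hHF).flat
  have h3 := rk_sup_atom hH hHF
  rw [ofContract_span] at h1
  rw [ofContract_flat, sup_comm] at h2
  rw [wordDeg, wordDeg, List.length_map, List.length_cons]
  push_cast
  omega

end Contract

/-- Full embeddings induce full embeddings of contractions. -/
theorem IsFullEmbedding.contract [Nontrivial L] {X Y : ModularExtension L} {φ : X.E → Y.E}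
    (h : IsFullEmbedding X Y φ) {H : X.E} (hH : IsAtom H) (hHF : ¬ H ≤ X.flat)
    (hH' : IsAtom (φ H)) (hHF' : ¬ φ H ≤ Y.flat) :
    IsFullEmbedding (X.contract H hH hHF) (Y.contract (φ H) hH' hHF')
      (fun x => Y.toContract hH' hHF' (φ (X.ofContract x))) := by
  have key : ∀ x : (X.contract H hH hHF).E,
      Y.ofContract (Y.toContract hH' hHF' (φ (X.ofContract x))) = φ (X.ofContract x) := fun x => by
    rw [ofContract_toContract, sup_eq_right, h.le_iff_le]
    exact X.le_ofContract x
  exact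
  { injective := fun x y hxy => X.ofContract_injective (h.injective (by
      rw [← key x, ← key y]
      exact congrArg Y.ofContract hxy))
    map_sup := fun x y => Y.ofContract_injective ((key (x ⊔ y)).trans (by
      rw [ofContract_sup, ofContract_sup, key, key, h.map_sup]))
    map_atom := fun a ha => by
      have h1 := X.rk_contract a
      have h2 := Y.rk_contract (Y.toContract hH' hHF' (φ (X.ofContract a)))
      have h3 := h.rk_map (X.ofContract a)
      have h4 := rk_atom ha
      rw [key] at h2
      exact isAtom_of_rk (by omega)
    rk_top := by
      have h1 := X.rk_contract (⊤ : (X.contract H hH hHF).E)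
      have h2 := Y.rk_contract (⊤ : (Y.contract (φ H) hH' hHF').E)
      have h3 := h.rk_top
      rw [ofContract_top] at h1 h2
      omega
    map_ι := fun l => Y.ofContract_injective (by
      rw [key, ofContract_ι, ofContract_ι, h.map_sup, h.map_ι]) }

/-- If `G` is a modular flat complementary to the atom `A`, then `[⊥, G] ≃ [A, ⊤]`. -/
theorem isFullEmbedding_restrict_contract (X : ModularExtension L) {G A : X.E}
    (hG : IsModular G) (hF : X.flat ≤ G) (hA : IsAtom A) (hAG : ¬ A ≤ G) (htop : A ⊔ G = ⊤) :
    IsFullEmbedding (X.restrict G hF) (X.contract A hA fun h => hAG (h.trans hF))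
      (fun x => X.toContract _ _ x.1) where
  injective x y hxy := by
    have h1 : A ⊔ x.1 = A ⊔ y.1 := congrArg X.ofContract hxy
    have h2 : ∀ z : Set.Iic G, G ⊓ (z.1 ⊔ A) = z.1 := fun z => by
      rw [hG.inf_sup z.2, inf_comm, inf_eq_bot_of_isAtom hA hAG, sup_bot_eq]
    exact Subtype.ext (by rw [← h2 x, ← h2 y, sup_comm, h1, sup_comm])
  map_sup x y := X.ofContract_injective (sup_sup_distrib_left A x.1 y.1)
  map_atom a ha := (X.isAtom_toContract_iff (isAtom_Iic_iff.1 ha)).2 fun h => hAG (h ▸ a.2)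
  rk_top := by
    have h1 := X.rk_contract (⊤ : (X.contract A hA fun h => hAG (h.trans hF)).E)
    have h2 := rk_sup_atom hA hAG
    rw [(Iic_geometric G).1]
    rw [sup_comm, htop] at h2
    rw [ofContract_top] at h1
    show rk G = _
    omega
  map_ι l := rfl

theorem ofContract_ofContract_swap (X : ModularExtension L) {H K : X.E} {hH : IsAtom H}
    {hHF : ¬ H ≤ X.flat} {hK : IsAtom K} {hKF : ¬ K ≤ X.flat}
    {h1 : IsAtom (X.toContract hH hHF K)} {h2 : IsAtom (X.toContract hK hKF H)}
    {h1F : ¬ X.toContract hH hHF K ≤ (X.contract H hH hHF).flat}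
    {h2F : ¬ X.toContract hK hKF H ≤ (X.contract K hK hKF).flat}
    (x : ((X.contract H hH hHF).contract _ h1 h1F).E) :
    X.ofContract ((X.contract K hK hKF).ofContract ((X.contract K hK hKF).toContract h2 h2F
      (X.toContract hK hKF (X.ofContract ((X.contract H hH hHF).ofContract x))))) =
    X.ofContract ((X.contract H hH hHF).ofContract x) := by
  have h3 := X.le_ofContract ((X.contract H hH hHF).ofContract x)
  have h4 := X.toContract_le_iff.1 ((X.contract H hH hHF).le_ofContract x)
  rw [ofContract_toContract, ofContract_sup, ofContract_toContract, ofContract_toContract]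
  exact le_antisymm (sup_le (sup_le h4 h3) (sup_le h4 le_rfl)) (le_sup_right.trans le_sup_right)

/-- The result of contracting two letters does not depend on their order. -/
theorem isFullEmbedding_contract_contract (X : ModularExtension L) {H K : X.E}
    (hH : IsAtom H) (hHF : ¬ H ≤ X.flat) (hK : IsAtom K) (hKF : ¬ K ≤ X.flat)
    (h1 : IsAtom (X.toContract hH hHF K)) (h2 : IsAtom (X.toContract hK hKF H))
    (h1F : ¬ X.toContract hH hHF K ≤ (X.contract H hH hHF).flat)
    (h2F : ¬ X.toContract hK hKF H ≤ (X.contract K hK hKF).flat) :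
    IsFullEmbedding ((X.contract H hH hHF).contract _ h1 h1F)
      ((X.contract K hK hKF).contract _ h2 h2F)
      (fun x => (X.contract K hK hKF).toContract h2 h2F
        (X.toContract hK hKF (X.ofContract ((X.contract H hH hHF).ofContract x)))) := by
  refine isFullEmbedding_orderIso (X := (X.contract H hH hHF).contract _ h1 h1F)
      (Y := (X.contract K hK hKF).contract _ h2 h2F)
      { toFun := fun x => (X.contract K hK hKF).toContract h2 h2F
          (X.toContract hK hKF (X.ofContract ((X.contract H hH hHF).ofContract x)))
        invFun := fun x => (X.contract H hH hHF).toContract h1 h1F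
          (X.toContract hH hHF (X.ofContract ((X.contract K hK hKF).ofContract x)))
        left_inv := fun x => ?_
        right_inv := fun x => ?_
        map_rel_iff' := fun {x y} => ?_ } fun l => ?_
  · refine ofContract_injective _ (X.ofContract_injective ?_)
    rw [ofContract_ofContract_swap, ofContract_ofContract_swap]
  · refine ofContract_injective _ (X.ofContract_injective ?_)
    rw [ofContract_ofContract_swap, ofContract_ofContract_swap]
  · rw [← ofContract_le_iff, ← X.ofContract_le_iff]
    simp only [Equiv.coe_fn_mk]
    rw [ofContract_ofContract_swap, ofContract_ofContract_swap]
    rfl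
  · refine ofContract_injective _ (X.ofContract_injective ?_)
    refine (X.ofContract_ofContract_swap _).trans ?_
    rw [ofContract_ι, ofContract_ι, ofContract_sup, ofContract_sup, ofContract_toContract,
      ofContract_toContract, ofContract_ι, ofContract_ι, sup_comm K H, ← sup_assoc, ← sup_assoc,
      sup_eq_left.2 (le_sup_left : H ≤ H ⊔ K), sup_eq_left.2 (le_sup_right : K ≤ H ⊔ K)]

end ModularExtension

/-! ### The differential -/

open Classical in
/-- The class of the contraction at the letter `H` of the diagram with the word `H :: R`, set to be
zero if `H` lies below `F_ι`. -/
noncomputable def MD.contractWord (X : ModularExtension L) (H : X.E) (R : List X.E) : MD L :=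
  if h : IsAtom H ∧ ¬ H ≤ X.flat then
    MD.word (X.contract H h.1 h.2) (R.map (X.toContract h.1 h.2)) else 0

open Classical in
/-- The contribution of the letter `H` to the differential of the word `H :: R`: the contraction at
`H` unless `H` is a bridge, that is, unless `H` is not spanned by `F_ι` and `R`. -/
noncomputable def MD.dTerm (X : ModularExtension L) (H : X.E) (R : List X.E) : MD L :=
  if H ≤ X.span R then MD.contractWord X H R else 0

/-- The differential of the diagram with the word `J`. -/
noncomputable def MD.dWord (X : ModularExtension L) (J : List X.E) : MD L :=
  altSum (MD.dTerm X) J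

theorem MD.contractWord_eq (X : ModularExtension L) {H : X.E} (hH : IsAtom H)
    (hHF : ¬ H ≤ X.flat) (R : List X.E) : MD.contractWord X H R =
      MD.word (X.contract H hH hHF) (R.map (X.toContract hH hHF)) :=
  dif_pos ⟨hH, hHF⟩

theorem MD.contractWord_eq_zero (X : ModularExtension L) {H : X.E} (h : H ≤ X.flat)
    (R : List X.E) : MD.contractWord X H R = 0 := dif_neg fun h' => h'.2 h

theorem MD.dTerm_of_le {X : ModularExtension L} {H : X.E} {R : List X.E} (h : H ≤ X.span R) :
    MD.dTerm X H R = MD.contractWord X H R := if_pos h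

theorem MD.dTerm_of_not_le {X : ModularExtension L} {H : X.E} {R : List X.E}
    (h : ¬ H ≤ X.span R) : MD.dTerm X H R = 0 := if_neg h

theorem MD.dTerm_eq_zero_of_le {X : ModularExtension L} {H : X.E} {R : List X.E}
    (h : H ≤ X.flat) : MD.dTerm X H R = 0 := by
  rw [MD.dTerm, MD.contractWord_eq_zero X h, ite_self]

theorem MD.dTerm_eq_zero {X : ModularExtension L} {H : X.E} {R : List X.E}
    (h : ∀ (hH : IsAtom H) (hHF : ¬ H ≤ X.flat), H ≤ X.span R →
      MD.word (X.contract H hH hHF) (R.map (X.toContract hH hHF)) = 0) :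
    MD.dTerm X H R = 0 := by
  by_cases h1 : H ≤ X.span R
  · rw [MD.dTerm_of_le h1, MD.contractWord]
    split_ifs with h2
    · exact h h2.1 h2.2 h1
    · rfl
  · exact MD.dTerm_of_not_le h1

theorem MD.dTerm_antisymm (X : ModularExtension L) (H : X.E) : Antisymm (MD.dTerm X H) := by
  intro A B K M
  rw [MD.dTerm, MD.dTerm, X.span_perm (List.Perm.append_left A (List.Perm.swap M K B))]
  split_ifs with h1
  · rw [MD.contractWord, MD.contractWord]
    split_ifs with h2
    · exact (MD.word_antisymm (X.contract H h2.1 h2.2)).map _ A B K M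
    · rw [neg_zero]
  · rw [neg_zero]

theorem MD.dTerm_mem_gr (X : ModularExtension L) (H : X.E) (R : List X.E) :
    MD.dTerm X H R ∈ MD.gr L (X.wordDeg (H :: R) + 1) := by
  rw [MD.dTerm]
  split_ifs with h1
  · rw [MD.contractWord]
    split_ifs with h2
    · rw [← X.wordDeg_contract (hH := h2.1) (hHF := h2.2)]
      exact MD.word_mem_gr _ _
    · exact Submodule.zero_mem _
  · exact Submodule.zero_mem _

theorem MD.dTerm_map [Nontrivial L] {X Y : ModularExtension L} {φ : X.E → Y.E}
    (h : IsFullEmbedding X Y φ) (H : X.E) (R : List X.E) :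
    MD.dTerm Y (φ H) (R.map φ) = MD.dTerm X H R := by
  rw [MD.dTerm, MD.dTerm, ← h.map_span, h.le_iff_le]
  split_ifs with h1
  · by_cases h2 : IsAtom H ∧ ¬ H ≤ X.flat
    · have h2' : IsAtom (φ H) ∧ ¬ φ H ≤ Y.flat := by
        rwa [h.isAtom_iff, ← h.map_flat, h.le_iff_le]
      rw [MD.contractWord_eq X h2.1 h2.2, MD.contractWord_eq Y h2'.1 h2'.2,
        ← MD.word_map (h.contract h2.1 h2.2 h2'.1 h2'.2), List.map_map, List.map_map]
      congr 1
      refine List.map_congr_left fun K _ => ofContract_injective _ ?_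
      simp only [Function.comp_apply, ofContract_toContract, h.map_sup]
      rw [← sup_assoc, sup_idem]
    · have h2' : ¬ (IsAtom (φ H) ∧ ¬ φ H ≤ Y.flat) := by
        rwa [h.isAtom_iff, ← h.map_flat, h.le_iff_le]
      rw [MD.contractWord, MD.contractWord, dif_neg h2, dif_neg h2']
  · rfl

theorem MD.dTerm_eq_zero_of_span {X : ModularExtension L} {H : X.E} {R : List X.E}
    (h : X.span (H :: R) ≠ ⊤) : MD.dTerm X H R = 0 := by
  refine MD.dTerm_eq_zero fun hH hHF _ => MD.word_eq_zero_of_span fun h' => h ?_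
  rw [← X.ofContract_span (hH := hH) (hHF := hHF), h', ofContract_top]

/-- If the extension splits, then so does its contraction at `H`, unless `[⊥, H]` is the factor that
is split off; but then `H` is a bridge. -/
theorem MD.dTerm_eq_zero_of_splits [Nontrivial L] {X : ModularExtension L} {H : X.E}
    {R : List X.E} (h : X.Splits) (hR : ∀ K ∈ R, IsAtom K) : MD.dTerm X H R = 0 := by
  refine MD.dTerm_eq_zero fun hH hHF hspan => ?_
  obtain ⟨P, Q, hPQ, hF, hQ⟩ := h
  by_cases hmem : H ∈ R
  · refine MD.word_of_not_isAtom _ (List.mem_map_of_mem hmem) fun h => ?_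
    exact (X.isAtom_toContract_iff hH).1 h rfl
  refine MD.word_eq_zero_of_splits ?_ _
  rcases hPQ.atom_le H hH with h | h
  · refine ⟨_, _, hPQ.ici hH h, sup_le h hF, fun h0 => ?_⟩
    have h1 : Q ⊔ H = H := congrArg Subtype.val h0
    have h2 : Q ≤ P := le_sup_left.trans (h1.le.trans h)
    exact hQ (by rw [← le_bot_iff, ← hPQ.inf_eq]; exact le_inf h2 le_rfl)
  · refine ⟨_, _, (hPQ.symm.ici hH h).symm, sup_le le_sup_right (hF.trans le_sup_left),
      fun h0 => ?_⟩
    -- Here the second factor is `[⊥, H]`, and the other letters all lie in the first one.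
    have h1 : Q = H := congrArg Subtype.val h0
    have h2 : X.span R ≤ P := by
      rw [span_le_iff]
      refine ⟨hF, fun K hK => (hPQ.atom_le K (hR K hK)).resolve_right fun hKQ => hmem ?_⟩
      rw [h1] at hKQ
      rwa [← (hH.le_iff_eq (hR K hK).1).1 hKQ]
    exact (hPQ.not_le_iff hH).2 h (hspan.trans h2)

/-- Contracting one of the two letters outside of a complementary modular flat `G`. -/
theorem MD.contractWord_of_isModular [Nontrivial L] {X : ModularExtension L} {G A B : X.E}
    {R : List X.E} (hG : IsModular G) (hF : X.flat ≤ G) (hA : IsAtom A) (hAG : ¬ A ≤ G)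
    (htop : A ⊔ G = ⊤) (hR : ∀ K ∈ R, K ≤ G) :
    MD.contractWord X A (B :: R) = MD.word (X.restrict G hF)
      ((⟨(A ⊔ B) ⊓ G, inf_le_right⟩ : Set.Iic G) ::
        R.map fun K => (⟨K ⊓ G, inf_le_right⟩ : Set.Iic G)) := by
  have hAF : ¬ A ≤ X.flat := fun h => hAG (h.trans hF)
  rw [MD.contractWord_eq X hA hAF,
    ← MD.word_map (X.isFullEmbedding_restrict_contract hG hF hA hAG htop), List.map_cons,
    List.map_cons, List.map_map]
  congr 2
  · refine X.ofContract_injective ?_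
    show A ⊔ B = A ⊔ (A ⊔ B) ⊓ G
    have h1 := hG (A ⊔ B)
    rw [← sup_assoc, sup_comm G, htop, top_sup_eq] at h1
    have h2 := rk_sup_atom hA hAG
    rw [sup_comm, htop] at h2
    have h3 : ¬ A ≤ (A ⊔ B) ⊓ G := fun h => hAG (h.trans inf_le_right)
    have h4 := rk_sup_atom hA h3
    rw [inf_comm] at h1
    symm
    refine eq_of_le_of_rk_le (sup_le le_sup_left inf_le_left) ?_
    rw [sup_comm A (_ ⊓ _)]
    omega
  · refine List.map_congr_left fun K hK => X.ofContract_injective ?_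
    show A ⊔ K = A ⊔ K ⊓ G
    rw [inf_eq_left.2 (hR K hK)]

/-- If `A` and `B` are the only letters outside of a modular flat, then the contractions at `A` and
at `B` cancel in the differential. -/
theorem MD.dTerm_comm_of_isModular [Nontrivial L] {X : ModularExtension L} {G A B : X.E}
    {R : List X.E} (hG : IsModular G) (hF : X.flat ≤ G) (hA : IsAtom A) (hB : IsAtom B)
    (hAG : ¬ A ≤ G) (hBG : ¬ B ≤ G) (hR : ∀ K ∈ R, K ≤ G) :
    MD.dTerm X A (B :: R) = MD.dTerm X B (A :: R) := by
  by_cases hs : X.span (A :: B :: R) = ⊤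
  swap
  · rw [MD.dTerm_eq_zero_of_span hs, MD.dTerm_eq_zero_of_span]
    rwa [X.span_perm (List.Perm.swap A B R)]
  have hRG : X.span R ≤ G := X.span_le_iff.2 ⟨hF, hR⟩
  have hiff : A ≤ X.span (B :: R) ↔ B ≤ X.span (A :: R) := by
    rw [span_cons, span_cons, sup_comm B, sup_comm A]
    exact ⟨le_sup_exchange hA hB fun h => hAG (h.trans hRG),
      le_sup_exchange hB hA fun h => hBG (h.trans hRG)⟩
  by_cases h : A ≤ X.span (B :: R)
  · have hle : ∀ {C D : X.E}, C ≤ X.span (D :: R) → C ≤ D ⊔ G := fun h =>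
      h.trans (by rw [span_cons]; exact sup_le_sup_left hRG _)
    have htop : ∀ {C D : X.E}, X.span (C :: D :: R) = ⊤ → D ≤ C ⊔ G → C ⊔ G = ⊤ :=
      fun {C D} h h' => by
        rw [← top_le_iff, ← h, span_le_iff]
        refine ⟨hF.trans le_sup_right, fun K hK => ?_⟩
        rcases List.mem_cons.1 hK with rfl | hK
        · exact le_sup_left
        rcases List.mem_cons.1 hK with rfl | hK
        · exact h'
        · exact (hR K hK).trans le_sup_right
    have hs' : X.span (B :: A :: R) = ⊤ := by rwa [X.span_perm (List.Perm.swap A B R)]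
    rw [MD.dTerm_of_le h, MD.dTerm_of_le (hiff.1 h),
      MD.contractWord_of_isModular hG hF hA hAG (htop hs (hle (hiff.1 h))) hR,
      MD.contractWord_of_isModular hG hF hB hBG (htop hs' (hle h)) hR]
    congr 3
    rw [sup_comm]
  · rw [MD.dTerm_of_not_le h, MD.dTerm_of_not_le fun h' => h (hiff.2 h')]

theorem MD.dTerm_eq_zero_of_isModular {X : ModularExtension L} {G A B M : X.E}
    {R : List X.E} (hG : IsModular G) (hF : X.flat ≤ G) (hMG : M ≤ G)
    (hAG : ¬ A ≤ G) (hBG : ¬ B ≤ G) (hR : ∀ K ∈ R, K ≤ G) :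
    MD.dTerm X M (A :: B :: R) = 0 := by
  refine MD.dTerm_eq_zero fun hM hMF _ => ?_
  rw [List.map_cons, List.map_cons]
  refine MD.word_eq_zero_of_isModular (X := X.contract M hM hMF) (hG.ici hMG)
    (sup_le hMG hF) (fun h => hAG (le_sup_right.trans h)) (fun h => hBG (le_sup_right.trans h)) ?_
  intro K hK
  obtain ⟨K, _, rfl⟩ := List.mem_map.1 hK
  exact sup_le hMG (hR _ ‹_›)

theorem MD.isInvariant_dWord [Nontrivial L] : IsInvariant (MD.dWord (L := L)) where
  antisymm X := Antisymm.altSum (MD.dTerm_antisymm X)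
  map h J _ := by
    rw [MD.dWord, MD.dWord, altSum_map]
    exact altSum_congr fun H R _ => MD.dTerm_map h H R
  span _ h := altSum_eq_zero fun H R hp => MD.dTerm_eq_zero_of_span fun h' =>
    h (by rw [← h', ModularExtension.span_perm _ hp])
  splits hJ h := altSum_eq_zero fun H R hp => MD.dTerm_eq_zero_of_splits h fun K hK =>
    hJ K (hp.subset (List.mem_cons_of_mem _ hK))
  modular := by
    intro X G A B R hJ hG hF hA hB hR
    rw [MD.dWord, altSum_cons, altSum_cons, MD.dTerm_comm_of_isModular hG hF (hJ A (by simp))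
      (hJ B (by simp)) hA hB hR, sub_sub_cancel]
    exact altSum_eq_zero fun M S hp => MD.dTerm_eq_zero_of_isModular hG hF
      (hR M (hp.subset List.mem_cons_self)) hA hB
      fun K hK => hR K (hp.subset (List.mem_cons_of_mem _ hK))

/-- The differential of `MD(L)`. -/
noncomputable def MD.d [Nontrivial L] : MD L →ₗ[ℚ] MD L := MD.lift MD.dWord MD.isInvariant_dWord

theorem MD.d_mem [Nontrivial L] {n : ℤ} {x : MD L} (hx : x ∈ MD.gr L n) :
    MD.d x ∈ MD.gr L (n + 1) := by
  refine MD.gr_induction hx (by simp) (fun x y hx hy => by rw [map_add]; exact add_mem hx hy)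
    (fun c x hx => by rw [map_smul]; exact Submodule.smul_mem _ _ hx) ?_
  rintro X J hJ rfl
  rw [MD.d, MD.lift_word _ _ X hJ]
  refine altSum_mem _ fun H R hp => ?_
  rw [← X.wordDeg_perm hp]
  exact MD.dTerm_mem_gr X H R

open Classical in
/-- The contribution to `d ∘ d` of contracting first `H` and then `K`. -/
noncomputable def MD.ddTerm (X : ModularExtension L) (H K : X.E) (S : List X.E) : MD L :=
  if h : IsAtom H ∧ ¬ H ≤ X.flat then
    if H ≤ X.span (K :: S) then
      MD.dTerm (X.contract H h.1 h.2) (X.toContract h.1 h.2 K) (S.map (X.toContract h.1 h.2))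
    else 0
  else 0

theorem MD.d_dTerm [Nontrivial L] {X : ModularExtension L} {H : X.E} {R : List X.E}
    (h : (H :: R).Nodup) (hR : ∀ K ∈ H :: R, IsAtom K) :
    MD.d (MD.dTerm X H R) = altSum (MD.ddTerm X H) R := by
  have hH := hR H List.mem_cons_self
  by_cases hHF : H ≤ X.flat
  · rw [MD.dTerm_eq_zero_of_le hHF, map_zero, eq_comm]
    exact altSum_eq_zero fun K S _ => dif_neg fun h => h.2 hHF
  by_cases hs : H ≤ X.span R
  · rw [MD.dTerm_of_le hs, MD.contractWord_eq X hH hHF, MD.d, MD.lift_word, MD.dWord, altSum_map]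
    · refine altSum_congr fun K S hp => ?_
      rw [MD.ddTerm, dif_pos ⟨hH, hHF⟩, if_pos (by rwa [X.span_perm hp])]
    · intro K hK
      obtain ⟨M, hM, rfl⟩ := List.mem_map.1 hK
      refine (X.isAtom_toContract_iff (hR M (List.mem_cons_of_mem _ hM))).2 ?_
      rintro rfl
      exact (List.nodup_cons.1 h).1 hM
  · rw [MD.dTerm_of_not_le hs, map_zero, eq_comm]
    refine altSum_eq_zero fun K S hp => ?_
    rw [MD.ddTerm, dif_pos ⟨hH, hHF⟩, if_neg (by rwa [X.span_perm hp])]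

theorem MD.ddTerm_eq_zero_of_not_le {X : ModularExtension L} {H K : X.E} {S : List X.E}
    (h : ¬ (H ≤ X.span (K :: S) ∧ K ≤ X.span (H :: S))) : MD.ddTerm X H K S = 0 := by
  rw [MD.ddTerm]
  split_ifs with h1 h2
  · refine MD.dTerm_of_not_le fun h3 => h ⟨h2, ?_⟩
    rwa [toContract_le_iff, ofContract_span] at h3
  · rfl
  · rfl

theorem MD.ddTerm_eq_zero_of_le {X : ModularExtension L} {H K : X.E} {S : List X.E}
    (h : ¬ (¬ H ≤ X.flat ∧ ¬ K ≤ X.flat ⊔ H)) : MD.ddTerm X H K S = 0 := by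
  rw [MD.ddTerm]
  split_ifs with h1 h2
  · refine MD.dTerm_eq_zero_of_le ?_
    rw [toContract_le_iff, ofContract_flat, sup_comm]
    by_contra h3
    exact h ⟨h1.2, h3⟩
  · rfl
  · rfl

/-- The two orders of contracting `H` and `K` are admissible at the same time, and give the same
result. -/
theorem MD.ddTerm_comm [Nontrivial L] {X : ModularExtension L} {H K : X.E} (hH : IsAtom H)
    (hK : IsAtom K) (S : List X.E) : MD.ddTerm X H K S = MD.ddTerm X K H S := by
  rcases eq_or_ne H K with rfl | hne
  · rfl
  by_cases hs : H ≤ X.span (K :: S) ∧ K ≤ X.span (H :: S)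
  swap
  · rw [MD.ddTerm_eq_zero_of_not_le hs, MD.ddTerm_eq_zero_of_not_le fun h => hs h.symm]
  have key : ∀ {H K : X.E}, IsAtom H → IsAtom K → (¬ H ≤ X.flat ∧ ¬ K ≤ X.flat ⊔ H) →
      (¬ K ≤ X.flat ∧ ¬ H ≤ X.flat ⊔ K) := fun hH hK h =>
    ⟨fun h' => h.2 (h'.trans le_sup_left), fun h' => h.2 (le_sup_exchange hH hK h.1 h')⟩
  by_cases hi : ¬ H ≤ X.flat ∧ ¬ K ≤ X.flat ⊔ H
  swap
  · rw [MD.ddTerm_eq_zero_of_le hi, MD.ddTerm_eq_zero_of_le fun h => hi (key hK hH h)]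
  have hi' := key hH hK hi
  have h1 : IsAtom (X.toContract hH hi.1 K) := (X.isAtom_toContract_iff hK).2 hne.symm
  have h2 : IsAtom (X.toContract hK hi'.1 H) := (X.isAtom_toContract_iff hH).2 hne
  have h1F : ¬ X.toContract hH hi.1 K ≤ (X.contract H hH hi.1).flat := by
    rw [toContract_le_iff, ofContract_flat, sup_comm]
    exact hi.2
  have h2F : ¬ X.toContract hK hi'.1 H ≤ (X.contract K hK hi'.1).flat := by
    rw [toContract_le_iff, ofContract_flat, sup_comm]
    exact hi'.2
  rw [MD.ddTerm, dif_pos ⟨hH, hi.1⟩, if_pos hs.1, MD.ddTerm, dif_pos ⟨hK, hi'.1⟩, if_pos hs.2,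
    MD.dTerm_of_le (by rw [toContract_le_iff, ofContract_span]; exact hs.2),
    MD.dTerm_of_le (by rw [toContract_le_iff, ofContract_span]; exact hs.1),
    MD.contractWord_eq _ h1 h1F, MD.contractWord_eq _ h2 h2F,
    ← MD.word_map (X.isFullEmbedding_contract_contract hH hi.1 hK hi'.1 h1 h2 h1F h2F),
    List.map_map, List.map_map, List.map_map]
  congr 1
  refine List.map_congr_left fun M _ => ofContract_injective _ (X.ofContract_injective ?_)
  simp only [Function.comp_apply]
  rw [ofContract_ofContract_swap]
  simp only [ofContract_toContract, ofContract_sup]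
  rw [sup_sup_sup_comm, sup_idem, sup_sup_sup_comm K H, sup_idem, ← sup_assoc, ← sup_assoc,
    sup_comm H K]

theorem MD.d_d [Nontrivial L] (x : MD L) : MD.d (MD.d x) = 0 := by
  refine MD.induction x (by simp) (fun x y hx hy => by simp [hx, hy])
    (fun c x hx => by simp [hx]) fun X J hJ => ?_
  by_cases hn : J.Nodup
  · rw [show MD.d (MD.word X J) = altSum (MD.dTerm X) J from MD.lift_word _ _ X hJ, map_altSum,
      altSum_congr fun H R hp => MD.d_dTerm (hp.nodup_iff.2 hn) fun K hK => hJ K (hp.subset hK)]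
    exact altSum_altSum_eq_zero _ _ fun H hH K hK S => MD.ddTerm_comm (hJ H hH) (hJ K hK) S
  · rw [(MD.word_antisymm X).eq_zero_of_not_nodup hn, map_zero, map_zero]

end

/-! ### Pushouts of modular extensions -/

namespace ModularExtension

variable {L : Type u} [Lattice L] [BoundedOrder L]

theorem trace_eq_top (X : ModularExtension L) {x : X.E} (h : X.flat ≤ x) : X.trace x = ⊤ :=
  top_le_iff.1 (X.le_trace_iff.2 h)

variable [IsGeometricLattice L]

/-- The first projection of `E₁ ∪_L E₂`. -/
def poFst (X Y : ModularExtension L) (p : (X.pushout Y).E) : X.E :=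
  Prod.fst (Subtype.val (p := fun p : X.E × Y.E => X.trace p.1 = Y.trace p.2) p)

/-- The second projection of `E₁ ∪_L E₂`. -/
def poSnd (X Y : ModularExtension L) (p : (X.pushout Y).E) : Y.E :=
  Prod.snd (Subtype.val (p := fun p : X.E × Y.E => X.trace p.1 = Y.trace p.2) p)

/-- The element `(x, y)` of `E₁ ∪_L E₂`. -/
def poMk (X Y : ModularExtension L) (x : X.E) (y : Y.E) (h : X.trace x = Y.trace y) :
    (X.pushout Y).E :=
  (⟨(x, y), h⟩ : Pushout X Y)

/-- The embedding of `E₁` into `E₁ ∪_L E₂`. -/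
noncomputable def poInl (X Y : ModularExtension L) (x : X.E) : (X.pushout Y).E := X.inl Y x

/-- The embedding of `E₂` into `E₁ ∪_L E₂`. -/
noncomputable def poInr (X Y : ModularExtension L) (y : Y.E) : (X.pushout Y).E := X.inr Y y

section API

variable (X Y : ModularExtension L)

theorem po_trace (p : (X.pushout Y).E) : X.trace (X.poFst Y p) = Y.trace (X.poSnd Y p) := p.2

variable {X Y}

theorem po_ext {p q : (X.pushout Y).E} (h1 : X.poFst Y p = X.poFst Y q)
    (h2 : X.poSnd Y p = X.poSnd Y q) : p = q :=
  Subtype.ext (Prod.ext h1 h2)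

theorem po_le_iff {p q : (X.pushout Y).E} :
    p ≤ q ↔ X.poFst Y p ≤ X.poFst Y q ∧ X.poSnd Y p ≤ X.poSnd Y q := Iff.rfl

theorem poFst_mk (x : X.E) (y : Y.E) (h : X.trace x = Y.trace y) :
    X.poFst Y (X.poMk Y x y h) = x := rfl

theorem poSnd_mk (x : X.E) (y : Y.E) (h : X.trace x = Y.trace y) :
    X.poSnd Y (X.poMk Y x y h) = y := rfl

theorem poFst_inl (x : X.E) : X.poFst Y (X.poInl Y x) = x := rfl

theorem poSnd_inl (x : X.E) : X.poSnd Y (X.poInl Y x) = Y.ι (X.trace x) := rfl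

theorem poFst_inr (y : Y.E) : X.poFst Y (X.poInr Y y) = X.ι (Y.trace y) := rfl

theorem poSnd_inr (y : Y.E) : X.poSnd Y (X.poInr Y y) = y := rfl

theorem poFst_ι (l : L) : X.poFst Y ((X.pushout Y).ι l) = X.ι l := rfl

theorem poSnd_ι (l : L) : X.poSnd Y ((X.pushout Y).ι l) = Y.ι l := rfl

theorem poFst_flat : X.poFst Y (X.pushout Y).flat = X.flat := rfl

theorem poSnd_flat : X.poSnd Y (X.pushout Y).flat = Y.flat := rfl

theorem poFst_top : X.poFst Y (⊤ : (X.pushout Y).E) = ⊤ := rfl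

theorem poSnd_top : X.poSnd Y (⊤ : (X.pushout Y).E) = ⊤ := rfl

theorem poFst_sup (p q : (X.pushout Y).E) : X.poFst Y (p ⊔ q) =
    X.poFst Y p ⊔ X.poFst Y q ⊔ X.ι (X.trace (X.poFst Y p ⊔ X.poFst Y q) ⊔
      Y.trace (X.poSnd Y p ⊔ X.poSnd Y q)) := rfl

theorem poSnd_sup (p q : (X.pushout Y).E) : X.poSnd Y (p ⊔ q) =
    X.poSnd Y p ⊔ X.poSnd Y q ⊔ Y.ι (X.trace (X.poFst Y p ⊔ X.poFst Y q) ⊔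
      Y.trace (X.poSnd Y p ⊔ X.poSnd Y q)) := rfl

theorem poFst_inf (p q : (X.pushout Y).E) :
    X.poFst Y (p ⊓ q) = X.poFst Y p ⊓ X.poFst Y q := rfl

theorem poSnd_inf (p q : (X.pushout Y).E) :
    X.poSnd Y (p ⊓ q) = X.poSnd Y p ⊓ X.poSnd Y q := rfl

theorem poInl_le_iff {x : X.E} {p : (X.pushout Y).E} : X.poInl Y x ≤ p ↔ x ≤ X.poFst Y p :=
  inl_le_iff

theorem poInr_le_iff {y : Y.E} {p : (X.pushout Y).E} : X.poInr Y y ≤ p ↔ y ≤ X.poSnd Y p :=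
  inr_le_iff

theorem rk_po (p : (X.pushout Y).E) :
    rk p + rk (X.trace (X.poFst Y p)) = rk (X.poFst Y p) + rk (X.poSnd Y p) :=
  (pushout_geometric X Y).1 p

theorem rk_poInl (x : X.E) : rk (X.poInl Y x) = rk x := by
  have := rk_po (X.poInl Y x)
  rw [poFst_inl, poSnd_inl, rk_ι] at this
  omega

theorem rk_poInr (y : Y.E) : rk (X.poInr Y y) = rk y := by
  have := rk_po (X.poInr Y y)
  rw [poFst_inr, poSnd_inr, rk_ι, trace_ι] at this
  omega

theorem isAtom_poInl_iff {x : X.E} : IsAtom (X.poInl Y x) ↔ IsAtom x := by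
  rw [isAtom_iff_rk, isAtom_iff_rk, rk_poInl]

theorem isAtom_poInr_iff {y : Y.E} : IsAtom (X.poInr Y y) ↔ IsAtom y := by
  rw [isAtom_iff_rk, isAtom_iff_rk, rk_poInr]

theorem trace_po (p : (X.pushout Y).E) : (X.pushout Y).trace p = X.trace (X.poFst Y p) := by
  refine eq_of_forall_le_iff fun a => ?_
  rw [le_trace_iff, po_le_iff, poFst_ι, poSnd_ι, ← X.le_trace_iff, ← Y.le_trace_iff, ← po_trace,
    and_self]

theorem po_span (J : List X.E) (K : List Y.E) :
    (X.pushout Y).span (J.map (X.poInl Y) ++ K.map (X.poInr Y)) =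
      X.poMk Y (X.span J) (Y.span K)
        (by rw [trace_eq_top _ (X.flat_le_span J), trace_eq_top _ (Y.flat_le_span K)]) := by
  refine eq_of_forall_ge_iff fun p => ?_
  rw [span_le_iff, po_le_iff, po_le_iff, poFst_flat, poSnd_flat, poFst_mk, poSnd_mk,
    span_le_iff, span_le_iff]
  simp only [List.mem_append, or_imp, forall_and, List.forall_mem_map, poInl_le_iff,
    poInr_le_iff]
  tauto

theorem po_wordDeg (J : List X.E) (K : List Y.E) :
    (X.pushout Y).wordDeg (J.map (X.poInl Y) ++ K.map (X.poInr Y)) =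
      X.wordDeg J + Y.wordDeg K := by
  have h1 := rk_po ((X.pushout Y).span (J.map (X.poInl Y) ++ K.map (X.poInr Y)))
  have h2 := X.rk_ι ⊤
  have h3 := Y.rk_ι ⊤
  have h4 := (X.pushout Y).rk_ι ⊤
  change rk X.flat = _ at h2
  change rk Y.flat = _ at h3
  change rk (X.pushout Y).flat = _ at h4
  have h5 := congrArg rk (X.trace_eq_top (X.flat_le_span J))
  rw [po_span, poFst_mk, poSnd_mk, ← po_span] at h1
  rw [wordDeg, wordDeg, wordDeg, List.length_append, List.length_map, List.length_map]
  push_cast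
  omega

theorem isModular_po {G : X.E} (hG : IsModular G) (hF : X.flat ≤ G) :
    IsModular (X.poMk Y G ⊤ (by rw [trace_eq_top _ hF, trace_top])) := by
  intro p
  have h1 := rk_po (X.poMk Y G ⊤ (by rw [trace_eq_top _ hF, trace_top]))
  have h2 := rk_po p
  have h3 := rk_po (X.poMk Y G ⊤ (by rw [trace_eq_top _ hF, trace_top]) ⊓ p)
  have h4 := rk_po (X.poMk Y G ⊤ (by rw [trace_eq_top _ hF, trace_top]) ⊔ p)
  have h5 := hG (X.poFst Y p)
  rw [poFst_inf, poSnd_inf, trace_inf, poFst_mk, poSnd_mk, top_inf_eq] at h3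
  have h7 := congrArg rk (X.trace_eq_top hF)
  have h8 : X.trace G ⊓ X.trace (X.poFst Y p) = X.trace (X.poFst Y p) := by
    rw [X.trace_eq_top hF, top_inf_eq]
  have h9 := congrArg rk h8
  have h6 : X.flat ≤ G ⊔ X.poFst Y p := hF.trans le_sup_left
  rw [poFst_sup, poSnd_sup, poFst_mk, poSnd_mk, top_sup_eq, top_sup_eq,
    sup_eq_left.2 ((X.ι_le_flat _).trans h6)] at h4
  have h10 := congrArg rk (X.trace_eq_top h6)
  rw [poFst_mk, poSnd_mk] at h1
  omega

/-- A factor of `E₁` that does not meet `F_ι` is also a factor of `E₁ ∪_L E₂`. -/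
theorem Splits.pushout (h : X.Splits) : (X.pushout Y).Splits := by
  obtain ⟨P, Q, hPQ, hF, hQ⟩ := h
  have hP : X.trace P = Y.trace ⊤ := by rw [trace_eq_top _ hF, trace_top]
  have hQt : X.trace Q = ⊥ := by
    apply X.isEmbedding.injective
    rw [ι_trace, ι_bot, ← le_bot_iff, ← hPQ.inf_eq, inf_comm]
    exact inf_le_inf_right _ hF
  refine ⟨X.poMk Y P ⊤ hP, X.poInl Y Q, ⟨?_, fun a ha => ?_⟩, ⟨hF, le_top⟩, fun h => hQ ?_⟩
  · have h1 := rk_po (X.poMk Y P ⊤ hP)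
    have h2 := rk_po (⊤ : (X.pushout Y).E)
    have h3 := hPQ.rk_add
    have h4 := congrArg rk (X.trace_eq_top hF)
    rw [poFst_mk, poSnd_mk] at h1
    rw [poFst_top, poSnd_top, trace_top] at h2
    rw [rk_poInl]
    omega
  · have hatom := X.geometric.atomistic
    by_cases h0 : X.poFst Y a ≤ P
    · exact Or.inl ⟨h0, le_top⟩
    · right
      obtain ⟨b, hb, hba, hbP⟩ := exists_atom_le_not_le h0
      have h1 : X.poInl Y b = a :=
        (ha.le_iff_eq (isAtom_poInl_iff.2 hb).1).1 (poInl_le_iff.2 hba)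
      rw [← h1, poInl_le_iff, poFst_inl]
      exact (hPQ.not_le_iff hb).1 hbP
  · have := congrArg (X.poFst Y) h
    exact this

/-! ### Isomorphisms of pushouts -/

theorem IsFullEmbedding.pushout [Nontrivial L] {X' : ModularExtension L} {φ : X.E → X'.E}
    (h : IsFullEmbedding X X' φ) (Y : ModularExtension L) :
    IsFullEmbedding (X.pushout Y) (X'.pushout Y) (fun p => X'.poMk Y (φ (X.poFst Y p))
      (X.poSnd Y p) (by rw [h.map_trace, po_trace])) where
  injective p q hpq := po_ext (h.injective (congrArg (X'.poFst Y) hpq))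
    (congrArg (X'.poSnd Y) hpq)
  map_sup p q := by
    apply po_ext
    · simp only [poFst_sup, poFst_mk, poSnd_mk, h.map_sup, h.map_ι, ← h.map_trace]
    · simp only [poSnd_sup, poFst_mk, poSnd_mk, ← h.map_trace, h.map_sup]
  map_atom p hp := by
    have h1 := rk_po p
    have h2 := rk_po (X'.poMk Y (φ (X.poFst Y p)) (X.poSnd Y p) (by rw [h.map_trace, po_trace]))
    have h3 := congrArg rk (h.map_trace (X.poFst Y p))
    rw [poFst_mk, poSnd_mk, h.rk_map] at h2
    rw [rk_atom hp] at h1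
    exact isAtom_of_rk (by omega)
  rk_top := by
    have h1 := rk_po (⊤ : (X.pushout Y).E)
    have h2 := rk_po (⊤ : (X'.pushout Y).E)
    have h3 := h.rk_top
    rw [poFst_top, poSnd_top, trace_top] at h1 h2
    omega
  map_ι l := by
    apply po_ext
    · rw [poFst_mk, poFst_ι, poFst_ι, h.map_ι]
    · rfl

theorem IsFullEmbedding.pushout_inl [Nontrivial L] {X' : ModularExtension L} {φ : X.E → X'.E}
    (h : IsFullEmbedding X X' φ) (x : X.E) :
    X'.poMk Y (φ (X.poFst Y (X.poInl Y x))) (X.poSnd Y (X.poInl Y x))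
      (by rw [h.map_trace, po_trace]) = X'.poInl Y (φ x) := by
  apply po_ext
  · rfl
  · rw [poSnd_mk, poSnd_inl, poSnd_inl, h.map_trace]

theorem IsFullEmbedding.pushout_inr [Nontrivial L] {X' : ModularExtension L} {φ : X.E → X'.E}
    (h : IsFullEmbedding X X' φ) (y : Y.E) :
    X'.poMk Y (φ (X.poFst Y (X.poInr Y y))) (X.poSnd Y (X.poInr Y y))
      (by rw [h.map_trace, po_trace]) = X'.poInr Y y := by
  apply po_ext
  · rw [poFst_mk, poFst_inr, poFst_inr, h.map_ι]
  · rfl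

variable (X Y)

/-- `E₁ ∪_L E₂ ≃ E₂ ∪_L E₁`. -/
noncomputable def poComm : (X.pushout Y).E ≃o (Y.pushout X).E where
  toFun p := Y.poMk X (X.poSnd Y p) (X.poFst Y p) (X.po_trace Y p).symm
  invFun p := X.poMk Y (Y.poSnd X p) (Y.poFst X p) (Y.po_trace X p).symm
  left_inv _ := rfl
  right_inv _ := rfl
  map_rel_iff' := and_comm

theorem isFullEmbedding_poComm : IsFullEmbedding (X.pushout Y) (Y.pushout X) (X.poComm Y) :=
  isFullEmbedding_orderIso _ fun _ => rfl

/-- `(E₁ ∪_L E₂) ∪_L E₃ ≃ E₁ ∪_L (E₂ ∪_L E₃)`. -/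
noncomputable def poAssoc (Z : ModularExtension L) :
    ((X.pushout Y).pushout Z).E ≃o (X.pushout (Y.pushout Z)).E where
  toFun p := X.poMk (Y.pushout Z) (X.poFst Y ((X.pushout Y).poFst Z p))
    (Y.poMk Z (X.poSnd Y ((X.pushout Y).poFst Z p)) ((X.pushout Y).poSnd Z p)
      (by rw [← po_trace, ← trace_po, po_trace])) (by rw [trace_po]; exact X.po_trace Y _)
  invFun p := (X.pushout Y).poMk Z (X.poMk Y (X.poFst (Y.pushout Z) p)
      (Y.poFst Z (X.poSnd (Y.pushout Z) p)) (by rw [po_trace, trace_po]))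
    (Y.poSnd Z (X.poSnd (Y.pushout Z) p))
      (by rw [trace_po, poFst_mk, po_trace, trace_po, po_trace])
  left_inv _ := rfl
  right_inv _ := rfl
  map_rel_iff' := and_assoc.symm

theorem isFullEmbedding_poAssoc (Z : ModularExtension L) :
    IsFullEmbedding ((X.pushout Y).pushout Z) (X.pushout (Y.pushout Z)) (X.poAssoc Y Z) :=
  isFullEmbedding_orderIso _ fun _ => rfl

/-- `L ∪_L E ≃ E`. -/
noncomputable def poRefl : ((ModularExtension.refl L).pushout X).E ≃o X.E where
  toFun p := (ModularExtension.refl L).poSnd X p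
  invFun x := (ModularExtension.refl L).poInr X x
  left_inv p := by
    refine po_ext ?_ rfl
    rw [poFst_inr, ← po_trace]
    apply (ModularExtension.refl L).isEmbedding.injective
    have h : ∀ x : (ModularExtension.refl L).E, (ModularExtension.refl L).ι x = x := fun _ => rfl
    rw [ι_trace]
    exact inf_eq_left.2 le_top
  right_inv _ := rfl
  map_rel_iff' {p q} := by
    refine ⟨fun h => ⟨?_, h⟩, fun h => h.2⟩
    have h1 : ∀ p, (ModularExtension.refl L).poFst X p =
        X.trace ((ModularExtension.refl L).poSnd X p) := fun p => by
      rw [← po_trace]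
      exact ((ModularExtension.refl L).trace_ι _).symm
    have h2 : (ModularExtension.refl L).poFst X p ≤ (ModularExtension.refl L).poFst X q := by
      rw [h1, h1]
      exact X.trace_mono h
    exact h2

theorem isFullEmbedding_poRefl :
    IsFullEmbedding ((ModularExtension.refl L).pushout X) X X.poRefl :=
  isFullEmbedding_orderIso _ fun _ => rfl

variable {X} {H : X.E} {hH : IsAtom H} {hHF : ¬ H ≤ X.flat}

theorem trace_contract (x : (X.contract H hH hHF).E) :
    (X.contract H hH hHF).trace x = X.trace (X.ofContract x) := by
  refine eq_of_forall_le_iff fun a => ?_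
  rw [le_trace_iff, le_trace_iff, ← X.ofContract_le_iff, ofContract_ι, sup_le_iff,
    and_iff_right (X.le_ofContract x)]

/-- Contracting a letter of the first factor commutes with pushouts. -/
noncomputable def poContract (hH' : IsAtom (X.poInl Y H))
    (hHF' : ¬ X.poInl Y H ≤ (X.pushout Y).flat) :
    ((X.pushout Y).contract (X.poInl Y H) hH' hHF').E ≃o ((X.contract H hH hHF).pushout Y).E where
  toFun p := (X.contract H hH hHF).poMk Y
    (X.toContract hH hHF (X.poFst Y ((X.pushout Y).ofContract p)))
    (X.poSnd Y ((X.pushout Y).ofContract p)) (by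
      rw [trace_contract, ofContract_toContract, ← po_trace,
        sup_eq_right.2 (poInl_le_iff.1 ((X.pushout Y).le_ofContract p))])
  invFun q := (X.pushout Y).toContract hH' hHF'
    (X.poMk Y (X.ofContract ((X.contract H hH hHF).poFst Y q)) ((X.contract H hH hHF).poSnd Y q)
      (by rw [← trace_contract, po_trace]))
  left_inv p := by
    refine ofContract_injective _ ?_
    rw [ofContract_toContract, sup_eq_right.2]
    · apply po_ext
      · rw [poFst_mk, poFst_mk, ofContract_toContract]
        exact sup_eq_right.2 (poInl_le_iff.1 ((X.pushout Y).le_ofContract p))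
      · rfl
    · rw [poInl_le_iff]
      exact X.le_ofContract _
  right_inv q := by
    have h : (X.pushout Y).ofContract ((X.pushout Y).toContract hH' hHF'
        (X.poMk Y (X.ofContract ((X.contract H hH hHF).poFst Y q))
          ((X.contract H hH hHF).poSnd Y q) (by rw [← trace_contract, po_trace]))) =
        X.poMk Y (X.ofContract ((X.contract H hH hHF).poFst Y q))
          ((X.contract H hH hHF).poSnd Y q) (by rw [← trace_contract, po_trace]) := by
      rw [ofContract_toContract, sup_eq_right, poInl_le_iff]
      exact X.le_ofContract _
    apply po_ext
    · rw [poFst_mk, h, poFst_mk, toContract_ofContract]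
    · rw [poSnd_mk, h, poSnd_mk]
  map_rel_iff' {p q} := by
    have h : ∀ p : ((X.pushout Y).contract (X.poInl Y H) hH' hHF').E,
        H ⊔ X.poFst Y ((X.pushout Y).ofContract p) = X.poFst Y ((X.pushout Y).ofContract p) :=
      fun p => sup_eq_right.2 (poInl_le_iff.1 ((X.pushout Y).le_ofContract p))
    simp only [Equiv.coe_fn_mk]
    rw [po_le_iff, poFst_mk, poSnd_mk, poFst_mk, poSnd_mk, ← X.ofContract_le_iff,
      ofContract_toContract, ofContract_toContract, h, h, ← po_le_iff, ofContract_le_iff]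

theorem poContract_toContract_le_iff (hH' : IsAtom (X.poInl Y H))
    (hHF' : ¬ X.poInl Y H ≤ (X.pushout Y).flat) (p : (X.pushout Y).E)
    (q : ((X.contract H hH hHF).pushout Y).E) :
    poContract Y (hH := hH) (hHF := hHF) hH' hHF' ((X.pushout Y).toContract hH' hHF' p) ≤ q ↔
      X.poFst Y p ≤ X.ofContract ((X.contract H hH hHF).poFst Y q) ∧
        X.poSnd Y p ≤ (X.contract H hH hHF).poSnd Y q := by
  rw [← OrderIso.le_symm_apply, toContract_le_iff]
  change p ≤ (X.pushout Y).ofContract ((X.pushout Y).toContract hH' hHF' _) ↔ _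
  rw [ofContract_toContract, sup_eq_right.2, po_le_iff, poFst_mk, poSnd_mk]
  rw [poInl_le_iff]
  exact X.le_ofContract _

theorem poContract_inl (hH' : IsAtom (X.poInl Y H))
    (hHF' : ¬ X.poInl Y H ≤ (X.pushout Y).flat) (x : X.E) :
    poContract Y (hH := hH) (hHF := hHF) hH' hHF'
      ((X.pushout Y).toContract hH' hHF' (X.poInl Y x)) =
      (X.contract H hH hHF).poInl Y (X.toContract hH hHF x) := by
  refine eq_of_forall_ge_iff fun q => ?_
  rw [poContract_toContract_le_iff, poInl_le_iff, toContract_le_iff, poFst_inl, poSnd_inl,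
    and_iff_left_iff_imp, ← le_trace_iff, ← po_trace, trace_contract]
  exact X.trace_mono

theorem poContract_inr (hH' : IsAtom (X.poInl Y H))
    (hHF' : ¬ X.poInl Y H ≤ (X.pushout Y).flat) (y : Y.E) :
    poContract Y (hH := hH) (hHF := hHF) hH' hHF'
      ((X.pushout Y).toContract hH' hHF' (X.poInr Y y)) =
      (X.contract H hH hHF).poInr Y y := by
  refine eq_of_forall_ge_iff fun q => ?_
  rw [poContract_toContract_le_iff, poInr_le_iff, poFst_inr, poSnd_inr,
    and_iff_right_iff_imp, ← le_trace_iff, ← trace_contract, po_trace]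
  exact Y.trace_mono

theorem isFullEmbedding_poContract (hH' : IsAtom (X.poInl Y H))
    (hHF' : ¬ X.poInl Y H ≤ (X.pushout Y).flat) :
    IsFullEmbedding ((X.pushout Y).contract (X.poInl Y H) hH' hHF')
      ((X.contract H hH hHF).pushout Y) (poContract Y hH' hHF') := by
  refine isFullEmbedding_orderIso _ fun l => eq_of_forall_ge_iff fun q => ?_
  refine (poContract_toContract_le_iff Y hH' hHF' ((X.pushout Y).ι l) q).trans ?_
  rw [po_le_iff, poFst_ι, poSnd_ι, poFst_ι, poSnd_ι, ← X.ofContract_le_iff, ofContract_ι,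
    sup_le_iff, and_iff_right (X.le_ofContract _)]

end API

end ModularExtension

variable {L : Type u} [Lattice L] [BoundedOrder L] [IsGeometricLattice L]

/-! ### The product -/

section

theorem neg_one_pow_int_smul {V : Type*} [AddCommGroup V] [Module ℚ V] (n : ℕ) (x : V) :
    (-1 : ℤ) ^ n • x = (-1 : ℚ) ^ n • x := by
  rcases neg_one_pow_eq_or ℤ n with h | h <;> rcases Nat.even_or_odd n with h' | h' <;>
    simp_all [h'.neg_one_pow]

/-- The class of the product of the diagrams with the words `J` and `K`. -/
noncomputable def MD.glueWord (X : ModularExtension L) (J : List X.E) (Y : ModularExtension L)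
    (K : List Y.E) : MD L :=
  MD.word (X.pushout Y) (J.map (X.poInl Y) ++ K.map (X.poInr Y))

theorem MD.glueWord_comm [Nontrivial L] (X : ModularExtension L) (J : List X.E)
    (Y : ModularExtension L) (K : List Y.E) :
    MD.glueWord X J Y K = (-1 : ℤ) ^ (J.length * K.length) • MD.glueWord Y K X J := by
  rw [MD.glueWord, MD.glueWord, (MD.word_antisymm _).append_comm, List.length_map,
    List.length_map, ← MD.word_map (X.isFullEmbedding_poComm Y), List.map_append, List.map_map,
    List.map_map]
  rfl

theorem MD.isInvariant_glueWord [Nontrivial L] (Y : ModularExtension L) (K : List Y.E) :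
    IsInvariant fun (X : ModularExtension L) J => MD.glueWord X J Y K where
  antisymm X := ((MD.word_antisymm (X.pushout Y)).append_right _).map (X.poInl Y)
  map {X X' φ} h J _ := by
    rw [MD.glueWord, MD.glueWord, ← MD.word_map (h.pushout Y), List.map_append, List.map_map,
      List.map_map, List.map_map]
    congr 2
    · exact List.map_congr_left fun x _ => (h.pushout_inl x).symm
    · exact List.map_congr_left fun y _ => (h.pushout_inr y).symm
  span {X J} _ h := by
    refine MD.word_eq_zero_of_span fun h' => h ?_
    rw [po_span] at h'
    exact congrArg (X.poFst Y) h'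
  splits _ h := MD.word_eq_zero_of_splits h.pushout _
  modular {X G A B R} hJ hG hF hA hB hR := by
    by_cases hK : ∀ M ∈ K, IsAtom M
    · refine MD.word_eq_zero_of_isModular (isModular_po (Y := Y) hG hF) ⟨hF, le_top⟩
        (fun h => hA (poInl_le_iff.1 h)) (fun h => hB (poInl_le_iff.1 h)) fun M hM => ?_
      rcases List.mem_append.1 hM with h | h
      · obtain ⟨N, hN, rfl⟩ := List.mem_map.1 h
        exact poInl_le_iff.2 (hR N hN)
      · obtain ⟨N, hN, rfl⟩ := List.mem_map.1 h
        exact poInr_le_iff.2 le_top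
    · push Not at hK
      obtain ⟨M, hM, hM'⟩ := hK
      exact MD.word_of_not_isAtom _ (List.mem_append_right _ (List.mem_map_of_mem hM))
        fun h => hM' (isAtom_poInr_iff.1 h)

/-- Invariance in the second argument follows from invariance in the first one by commutativity. -/
theorem MD.isInvariant_glueWord_right [Nontrivial L] (X : ModularExtension L) (J : List X.E) :
    IsInvariant fun (Y : ModularExtension L) K => MD.glueWord X J Y K where
  antisymm Y := ((MD.word_antisymm (X.pushout Y)).append_left _).map (X.poInr Y)
  map {Y Y' φ} h K hK := by
    rw [MD.glueWord_comm, MD.glueWord_comm X J, (MD.isInvariant_glueWord X J).map h K hK,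
      List.length_map]
  span {Y K} hK h := by
    rw [MD.glueWord_comm, (MD.isInvariant_glueWord X J).span hK h, smul_zero]
  splits {Y K} hK h := by
    rw [MD.glueWord_comm, (MD.isInvariant_glueWord X J).splits hK h, smul_zero]
  modular {Y G A B R} hJ hG hF hA hB hR := by
    rw [MD.glueWord_comm, (MD.isInvariant_glueWord X J).modular hJ hG hF hA hB hR, smul_zero]

theorem MD.glueWord_eq_zero_left (X : ModularExtension L) {J : List X.E}
    (hJ : ¬ ∀ H ∈ J, IsAtom H) (Y : ModularExtension L) (K : List Y.E) :
    MD.glueWord X J Y K = 0 := by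
  push Not at hJ
  obtain ⟨M, hM, hM'⟩ := hJ
  exact MD.word_of_not_isAtom _ (List.mem_append_left _ (List.mem_map_of_mem hM))
    fun h => hM' (isAtom_poInl_iff.1 h)

theorem MD.glueWord_eq_zero_right (X : ModularExtension L) (J : List X.E)
    (Y : ModularExtension L) {K : List Y.E} (hK : ¬ ∀ H ∈ K, IsAtom H) :
    MD.glueWord X J Y K = 0 := by
  push Not at hK
  obtain ⟨M, hM, hM'⟩ := hK
  exact MD.word_of_not_isAtom _ (List.mem_append_right _ (List.mem_map_of_mem hM))
    fun h => hM' (isAtom_poInr_iff.1 h)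

section Mul

variable (L) in
/-- The unit of `MD(L)`. -/
noncomputable def MD.one : MD L := MD.mk (ModularDiagram.empty L)

theorem MD.one_eq : MD.one L = MD.word (ModularExtension.refl L) [] :=
  MD.mk_eq_word (ModularDiagram.empty L)

theorem neg_one_zpow_mul_wordDeg {L : Type u} [Lattice L] [BoundedOrder L]
    (X : ModularExtension L) (J : List X.E) {L' : Type v} [Lattice L'] [BoundedOrder L']
    (Y : ModularExtension L') (K : List Y.E) :
    (-1 : ℚ) ^ (X.wordDeg J * Y.wordDeg K) = (-1 : ℚ) ^ (J.length * K.length) := by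
  rw [zpow_mul, neg_one_zpow_wordDeg, ← zpow_natCast, ← zpow_mul, _root_.mul_comm, zpow_mul,
    neg_one_zpow_wordDeg, ← zpow_natCast, ← zpow_mul, ← zpow_natCast]
  push_cast
  rw [_root_.mul_comm]

theorem MD.dTerm_eq_zero_or (X : ModularExtension L) (H : X.E) (R : List X.E) :
    MD.dTerm X H R = 0 ∨ ∃ (Y : ModularExtension L) (K : List Y.E), K.length = R.length ∧
      MD.dTerm X H R = MD.word Y K := by
  rw [MD.dTerm, MD.contractWord]
  split_ifs with h1 h2
  · exact Or.inr ⟨_, _, List.length_map _, rfl⟩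
  · exact Or.inl rfl
  · exact Or.inl rfl

/-- The letters that may be contracted, in terms of the span of the other letters. -/
theorem ModularDiagram.isContractible_iff {L : Type u} [Lattice L] [BoundedOrder L]
    (Γ : ModularDiagram L) (hJ : Γ.J.Nodup) (i : Fin Γ.J.length) : Γ.IsContractible (Γ.J.get i) ↔
      ¬ Γ.J.get i ≤ Γ.flat ∧ Γ.J.get i ≤ Γ.toModularExtension.span (Γ.J.eraseIdx i) := by
  have hmem : ∀ K, K ∈ Γ.J.eraseIdx i ↔ K ∈ Γ.J ∧ K ≠ Γ.J.get i := by
    intro K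
    rw [List.mem_eraseIdx_iff_getElem]
    constructor
    · rintro ⟨j, hj, hji, rfl⟩
      exact ⟨List.getElem_mem _, fun h => hji ((hJ.getElem_inj_iff).1 h)⟩
    · rintro ⟨hK, hne⟩
      obtain ⟨j, hj, rfl⟩ := List.getElem_of_mem hK
      exact ⟨j, hj, fun h => hne (by subst h; rfl), rfl⟩
  have hb : ¬ Γ.IsBridge (Γ.J.get i) ↔
      Γ.J.get i ≤ Γ.toModularExtension.span (Γ.J.eraseIdx i) := by
    constructor
    · intro h
      by_contra h'
      exact h ⟨List.get_mem _ _, _, Γ.toModularExtension.flat_le_span _, h', fun K hK hne =>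
        Γ.toModularExtension.le_span ((hmem K).2 ⟨hK, hne⟩)⟩
    · rintro h ⟨_, F, hF, hnF, hle⟩
      refine hnF (h.trans (Γ.toModularExtension.span_le_iff.2 ⟨hF, fun K hK => ?_⟩))
      exact hle K ((hmem K).1 hK).1 ((hmem K).1 hK).2
  rw [ModularDiagram.IsContractible, hb, and_iff_right (List.get_mem _ _), and_comm]

variable [Nontrivial L]

/-- Multiplication by the diagram with the word `J` from the left. -/
noncomputable def MD.mulWord (X : ModularExtension L) (J : List X.E) : MD L →ₗ[ℚ] MD L :=
  MD.lift _ (MD.isInvariant_glueWord_right X J)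

theorem MD.mulWord_word (X : ModularExtension L) (J : List X.E) (Y : ModularExtension L)
    (K : List Y.E) : MD.mulWord X J (MD.word Y K) = MD.glueWord X J Y K := by
  by_cases hK : ∀ H ∈ K, IsAtom H
  · exact MD.lift_word _ _ Y hK
  · rw [MD.glueWord_eq_zero_right X J Y hK, MD.word, dif_neg hK, map_zero]

theorem MD.isInvariant_mulWord : IsInvariant (MD.mulWord (L := L)) where
  antisymm X A B H K := MD.hom_ext fun Y M _ => by
    rw [LinearMap.neg_apply, MD.mulWord_word, MD.mulWord_word]
    exact (MD.isInvariant_glueWord Y M).antisymm X A B H K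
  map h J hJ := MD.hom_ext fun Y M _ => by
    rw [MD.mulWord_word, MD.mulWord_word]
    exact (MD.isInvariant_glueWord Y M).map h J hJ
  span hJ h := MD.hom_ext fun Y M _ => by
    rw [MD.mulWord_word]
    exact (MD.isInvariant_glueWord Y M).span hJ h
  splits hJ h := MD.hom_ext fun Y M _ => by
    rw [MD.mulWord_word]
    exact (MD.isInvariant_glueWord Y M).splits hJ h
  modular hJ hG hF hA hB hR := MD.hom_ext fun Y M _ => by
    rw [MD.mulWord_word]
    exact (MD.isInvariant_glueWord Y M).modular hJ hG hF hA hB hR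

/-- The product of `MD(L)`. -/
noncomputable def MD.mul : MD L →ₗ[ℚ] MD L →ₗ[ℚ] MD L := MD.lift _ MD.isInvariant_mulWord

theorem MD.mul_word (X : ModularExtension L) (J : List X.E) (Y : ModularExtension L)
    (K : List Y.E) : MD.mul (MD.word X J) (MD.word Y K) = MD.glueWord X J Y K := by
  by_cases hJ : ∀ H ∈ J, IsAtom H
  · rw [MD.mul, MD.lift_word _ _ X hJ, MD.mulWord_word]
  · rw [MD.glueWord_eq_zero_left X hJ Y K, MD.word, dif_neg hJ, map_zero, LinearMap.zero_apply]

theorem MD.mul_comm_word (X : ModularExtension L) (J : List X.E) (Y : ModularExtension L)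
    (K : List Y.E) : MD.mul (MD.word X J) (MD.word Y K) =
      (-1 : ℤ) ^ (J.length * K.length) • MD.mul (MD.word Y K) (MD.word X J) := by
  rw [MD.mul_word, MD.mul_word, MD.glueWord_comm]

theorem MD.mul_assoc (x y z : MD L) : MD.mul (MD.mul x y) z = MD.mul x (MD.mul y z) := by
  refine MD.induction x (by simp) (fun x x' hx hx' => by
    simp only [map_add, LinearMap.add_apply, hx, hx'])
    (fun c x hx => by simp only [map_smul, LinearMap.smul_apply, hx]) fun X J _ => ?_
  refine MD.induction y (by simp) (fun x x' hx hx' => by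
    simp only [map_add, LinearMap.add_apply, hx, hx'])
    (fun c x hx => by simp only [map_smul, LinearMap.smul_apply, hx]) fun Y K _ => ?_
  refine MD.induction z (by simp) (fun x x' hx hx' => by
    simp only [map_add, hx, hx'])
    (fun c x hx => by simp only [map_smul, hx]) fun Z M _ => ?_
  rw [MD.mul_word, MD.mul_word, MD.glueWord, MD.glueWord, MD.mul_word, MD.mul_word, MD.glueWord,
    MD.glueWord, ← MD.word_map (X.isFullEmbedding_poAssoc Y Z)]
  simp only [List.map_append, List.map_map, List.append_assoc]
  congr 2
  · refine List.map_congr_left fun x _ => po_ext rfl (po_ext rfl ?_)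
    show Z.ι ((X.pushout Y).trace (X.poInl Y x)) = Z.ι (X.trace x)
    rw [trace_po, poFst_inl]
  congr 1
  · refine List.map_congr_left fun y _ => po_ext ?_ (po_ext rfl ?_)
    · show X.ι (Y.trace y) = X.ι ((Y.pushout Z).trace (Y.poInl Z y))
      rw [trace_po, poFst_inl]
    · show Z.ι ((X.pushout Y).trace (X.poInr Y y)) = Z.ι (Y.trace y)
      rw [trace_po, poFst_inr, trace_ι]
  · refine List.map_congr_left fun z _ => po_ext ?_ rfl
    show X.ι (Z.trace z) = X.ι ((Y.pushout Z).trace (Y.poInr Z z))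
    rw [trace_po, poFst_inr, trace_ι]

theorem MD.one_mul (x : MD L) : MD.mul (MD.one L) x = x := by
  refine MD.induction x (by simp) (fun x x' hx hx' => by simp only [map_add, hx, hx'])
    (fun c x hx => by simp only [map_smul, hx]) fun X J _ => ?_
  rw [MD.one_eq, MD.mul_word, MD.glueWord, ← MD.word_map X.isFullEmbedding_poRefl, List.map_nil,
    List.nil_append, List.map_map]
  congr 1
  exact (List.map_congr_left fun x _ => rfl).trans (List.map_id J)

theorem MD.mul_one (x : MD L) : MD.mul x (MD.one L) = x := by
  refine MD.induction x (by simp) (fun x x' hx hx' => by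
    simp only [map_add, LinearMap.add_apply, hx, hx'])
    (fun c x hx => by simp only [map_smul, LinearMap.smul_apply, hx]) fun X J _ => ?_
  rw [MD.one_eq, MD.mul_comm_word, ← MD.one_eq, MD.one_mul]
  simp

theorem MD.mul_mem {i j : ℤ} {x y : MD L} (hx : x ∈ MD.gr L i) (hy : y ∈ MD.gr L j) :
    MD.mul x y ∈ MD.gr L (i + j) := by
  refine MD.gr_induction hx (by simp) (fun x x' hx hx' => by
    rw [map_add]; exact add_mem hx hx')
    (fun c x hx => by rw [map_smul]; exact Submodule.smul_mem _ _ hx) ?_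
  rintro X J _ rfl
  refine MD.gr_induction hy (by simp) (fun x x' hx hx' => by
    rw [map_add]; exact add_mem hx hx')
    (fun c x hx => by rw [map_smul]; exact Submodule.smul_mem _ _ hx) ?_
  rintro Y K _ rfl
  rw [MD.mul_word, MD.glueWord, ← po_wordDeg]
  exact MD.word_mem_gr _ _

theorem MD.mul_comm {i j : ℤ} {x y : MD L} (hx : x ∈ MD.gr L i) (hy : y ∈ MD.gr L j) :
    MD.mul x y = (-1 : ℚ) ^ (i * j) • MD.mul y x := by
  refine MD.gr_induction hx (by simp) (fun x x' hx hx' => by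
    simp only [map_add, LinearMap.add_apply, hx, hx', smul_add])
    (fun c x hx => by simp only [map_smul, LinearMap.smul_apply, hx, smul_comm c]) ?_
  rintro X J _ rfl
  refine MD.gr_induction hy (by simp) (fun x x' hx hx' => by
    simp only [map_add, LinearMap.add_apply, hx, hx', smul_add])
    (fun c x hx => by simp only [map_smul, LinearMap.smul_apply, hx, smul_comm c]) ?_
  rintro Y K _ rfl
  rw [MD.mul_comm_word, neg_one_pow_int_smul, neg_one_zpow_mul_wordDeg]

/-! ### The Leibniz rule -/

theorem MD.dTerm_mul_comm (X : ModularExtension L) (H : X.E) (R : List X.E)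
    (Y : ModularExtension L) (K : List Y.E) : MD.mul (MD.dTerm X H R) (MD.word Y K) =
      (-1 : ℤ) ^ (R.length * K.length) • MD.mul (MD.word Y K) (MD.dTerm X H R) := by
  rcases MD.dTerm_eq_zero_or X H R with h | ⟨Z, M, hM, h⟩
  · simp [h]
  · rw [h, MD.mul_comm_word, hM]

theorem MD.dTerm_inl (X Y : ModularExtension L) (H : X.E) (R : List X.E) (K : List Y.E) :
    MD.dTerm (X.pushout Y) (X.poInl Y H) (R.map (X.poInl Y) ++ K.map (X.poInr Y)) =
      MD.mul (MD.dTerm X H R) (MD.word Y K) := by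
  by_cases hs : H ≤ X.span R
  swap
  · rw [MD.dTerm_of_not_le hs, MD.dTerm_of_not_le, map_zero, LinearMap.zero_apply]
    rwa [po_span, poInl_le_iff, poFst_mk]
  rw [MD.dTerm_of_le hs, MD.dTerm_of_le (by rwa [po_span, poInl_le_iff, poFst_mk])]
  by_cases h : IsAtom H ∧ ¬ H ≤ X.flat
  swap
  · rw [MD.contractWord, MD.contractWord, dif_neg h, map_zero, LinearMap.zero_apply, dif_neg]
    rwa [isAtom_poInl_iff, poInl_le_iff, poFst_flat]
  have h' : IsAtom (X.poInl Y H) ∧ ¬ X.poInl Y H ≤ (X.pushout Y).flat := by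
    rwa [isAtom_poInl_iff, poInl_le_iff, poFst_flat]
  rw [MD.contractWord_eq _ h.1 h.2, MD.contractWord_eq _ h'.1 h'.2, MD.mul_word, MD.glueWord,
    ← MD.word_map (isFullEmbedding_poContract Y (hH := h.1) (hHF := h.2) h'.1 h'.2)]
  simp only [List.map_append, List.map_map]
  congr 2
  · exact List.map_congr_left fun x _ => poContract_inl Y h'.1 h'.2 x
  · exact List.map_congr_left fun y _ => poContract_inr Y h'.1 h'.2 y

theorem MD.dTerm_inr (X Y : ModularExtension L) (J : List X.E) (H : Y.E) (R : List Y.E) :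
    MD.dTerm (X.pushout Y) (X.poInr Y H) (J.map (X.poInl Y) ++ R.map (X.poInr Y)) =
      MD.mul (MD.word X J) (MD.dTerm Y H R) := by
  have h := MD.dTerm_map (Y.isFullEmbedding_poComm X) (Y.poInl X H)
    (R.map (Y.poInl X) ++ J.map (Y.poInr X))
  rw [MD.dTerm_inl, MD.dTerm_mul_comm, List.map_append, List.map_map, List.map_map] at h
  change MD.dTerm (X.pushout Y) (X.poInr Y H) (R.map (X.poInr Y) ++ J.map (X.poInl Y)) = _ at h
  rw [(MD.dTerm_antisymm _ _).append_comm, h, smul_smul, List.length_map, List.length_map,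
    _root_.mul_comm J.length, ← pow_add, (Even.add_self _).neg_one_pow, one_smul]

theorem MD.d_mul_word {X : ModularExtension L} {J : List X.E} (hJ : ∀ H ∈ J, IsAtom H)
    {Y : ModularExtension L} {K : List Y.E} (hK : ∀ H ∈ K, IsAtom H) :
    MD.d (MD.mul (MD.word X J) (MD.word Y K)) = MD.mul (MD.d (MD.word X J)) (MD.word Y K) +
      (-1 : ℤ) ^ J.length • MD.mul (MD.word X J) (MD.d (MD.word Y K)) := by
  have h : ∀ H ∈ J.map (X.poInl Y) ++ K.map (X.poInr Y), IsAtom H := by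
    intro H hH
    rcases List.mem_append.1 hH with h | h
    · obtain ⟨N, hN, rfl⟩ := List.mem_map.1 h
      exact isAtom_poInl_iff.2 (hJ N hN)
    · obtain ⟨N, hN, rfl⟩ := List.mem_map.1 h
      exact isAtom_poInr_iff.2 (hK N hN)
  rw [MD.mul_word, MD.glueWord, MD.d, MD.lift_word _ _ _ h, MD.lift_word _ _ _ hJ,
    MD.lift_word _ _ _ hK, MD.dWord, MD.dWord, MD.dWord, altSum_append, altSum_map, altSum_map,
    List.length_map, show MD.mul (altSum (MD.dTerm X) J) (MD.word Y K) = _ from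
      map_altSum (MD.mul.flip (MD.word Y K)) _ _, map_altSum (MD.mul (MD.word X J))]
  simp only [MD.dTerm_inl, MD.dTerm_inr, LinearMap.flip_apply]

theorem MD.d_mul {i : ℤ} {x : MD L} (y : MD L) (hx : x ∈ MD.gr L i) :
    MD.d (MD.mul x y) = MD.mul (MD.d x) y + (-1 : ℚ) ^ i • MD.mul x (MD.d y) := by
  refine MD.gr_induction hx (by simp) (fun x x' hx hx' => by
    simp only [map_add, LinearMap.add_apply, hx, hx', smul_add]; abel)
    (fun c x hx => by
      simp only [map_smul, LinearMap.smul_apply, hx, smul_comm c, smul_add]) ?_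
  rintro X J hJ rfl
  refine MD.induction y (by simp) (fun x x' hx hx' => by
    simp only [map_add, hx, hx', smul_add]; abel)
    (fun c x hx => by simp only [map_smul, hx, smul_add, smul_comm c]) fun Y K hK => ?_
  rw [MD.d_mul_word hJ hK, neg_one_pow_int_smul, neg_one_zpow_wordDeg]

/-! ### The cdga of modular diagrams -/

variable (L) in
/-- The cdga of modular diagrams of `L`. -/
noncomputable def MD.algebra : MDAlgebra L where
  gr := MD.gr L
  isInternal := MD.gr_isInternal
  one := MD.one L
  mul := MD.mul
  d := MD.d
  one_mem := by
    have h := MD.word_mem_gr (ModularExtension.refl L) []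
    rwa [← MD.one_eq, wordDeg, span_nil, sub_self, List.length_nil, mul_zero, sub_zero,
      Nat.cast_zero] at h
  mul_mem := MD.mul_mem
  one_mul := MD.one_mul
  mul_one := MD.mul_one
  mul_assoc := MD.mul_assoc
  mul_comm := MD.mul_comm
  d_mem := MD.d_mem
  d_d := MD.d_d
  d_mul := MD.d_mul
  gr_eq := rfl
  one_eq := rfl
  mul_mk Γ₁ Γ₂ := by
    rw [MD.mk_eq_word, MD.mk_eq_word, MD.mul_word, MD.mk_eq_word]
    rfl
  d_mk Γ hJ := by
    classical
    rw [MD.mk_eq_word, MD.d, MD.lift_word _ _ _ Γ.isAtom, MD.dWord, altSum_eq_sum]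
    refine Finset.sum_congr rfl fun i _ => ?_
    by_cases h : Γ.IsContractible (Γ.J.get i)
    · rw [dif_pos h, MD.dTerm_of_le ((Γ.isContractible_iff hJ i).1 h).2,
        MD.contractWord_eq _ (Γ.isAtom _ (List.get_mem _ _)) h.2.2, MD.mk_eq_word]
      rfl
    · rw [dif_neg h]
      rw [Γ.isContractible_iff hJ i, and_comm, not_and, not_not] at h
      by_cases hs : Γ.J.get i ≤ Γ.toModularExtension.span (Γ.J.eraseIdx i)
      · rw [MD.dTerm_eq_zero_of_le (h hs), smul_zero]
      · rw [MD.dTerm_of_not_le hs, smul_zero]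

end Mul

end

/-! ### Modular extensions of a product -/

/-- If `a` and `b` are independent over every `s`, then any set `U` of atoms can be distributed
between `a` and `b` such that the two resulting flats are still independent over `s`, the join of
all these elements being kept fixed. The induction over `U` uses the claim for `s` and for `s ∨ e`,
where `e` is the new atom. -/
theorem exists_rk_add_rk_le {E : Type*} [Lattice E] [BoundedOrder E] [hE : IsGeometricLattice E]
    {a b : E} (hab : ∀ s, rk (a ⊔ s) + rk (b ⊔ s) ≤ rk (a ⊔ b ⊔ s) + rk s) (U : Finset E)
    (hU : ∀ e ∈ U, IsAtom e) (s : E) : ∃ a' b' : E, a ≤ a' ∧ b ≤ b' ∧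
      (∀ e ∈ U, e ≤ a' ∨ e ≤ b') ∧
      rk (a' ⊔ s) + rk (b' ⊔ s) ≤ rk (a ⊔ b ⊔ U.sup id ⊔ s) + rk s := by
  classical
  induction U using Finset.induction_on generalizing s with
  | empty => exact ⟨a, b, le_rfl, le_rfl, by simp, by simpa using hab s⟩
  | insert e U _ ih =>
    have hU' : ∀ e ∈ U, IsAtom e := fun x hx => hU x (Finset.mem_insert_of_mem hx)
    have he : IsAtom e := hU e (Finset.mem_insert_self e U)
    obtain ⟨a₁, b₁, ha₁, hb₁, hc₁, hr₁⟩ := ih hU' s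
    obtain ⟨a₂, b₂, ha₂, hb₂, hc₂, hr₂⟩ := ih hU' (s ⊔ e)
    set m := a ⊔ b ⊔ U.sup id
    have hm : a ⊔ b ⊔ (insert e U).sup id ⊔ s = m ⊔ (s ⊔ e) := by
      rw [Finset.sup_insert, id, sup_comm e, ← sup_assoc, sup_assoc, sup_comm e]
    have hs : rk (s ⊔ e) ≤ rk s + 1 := by
      have := hE.semimodular s e
      rw [rk_atom he] at this
      omega
    have hms : rk (m ⊔ s) ≤ rk (m ⊔ (s ⊔ e)) := rk_mono (sup_le_sup_left le_sup_left _)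
    have key : ∀ x y : E, rk (x ⊓ y ⊔ s) + rk (x ⊔ y ⊔ e ⊔ s) ≤
        rk (x ⊔ s) + rk (y ⊔ (s ⊔ e)) := by
      intro x y
      have h1 := hE.semimodular (x ⊔ s) (y ⊔ (s ⊔ e))
      have h2 : rk (x ⊓ y ⊔ s) ≤ rk ((x ⊔ s) ⊓ (y ⊔ (s ⊔ e))) :=
        rk_mono (le_inf (sup_le_sup_right inf_le_left _)
          (sup_le_sup inf_le_right le_sup_left))
      have h3 : x ⊔ y ⊔ e ⊔ s = x ⊔ s ⊔ (y ⊔ (s ⊔ e)) := by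
        refine le_antisymm ?_ ?_ <;> simp [sup_le_iff, le_sup_of_le_left, le_sup_of_le_right]
      rw [h3]
      omega
    -- Two ways to place `e`; by submodularity the ranks of both add up to little enough that
    -- one of them satisfies the bound.
    have h1 := key a₁ a₂
    have h2 := key b₁ b₂
    rw [hm]
    by_cases h : rk (a₁ ⊓ a₂ ⊔ s) + rk (b₁ ⊔ b₂ ⊔ e ⊔ s) ≤ rk (m ⊔ (s ⊔ e)) + rk s
    · refine ⟨a₁ ⊓ a₂, b₁ ⊔ b₂ ⊔ e, le_inf ha₁ ha₂, hb₁.trans (le_sup_left.trans le_sup_left),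
        ?_, h⟩
      intro x hx
      rcases Finset.mem_insert.1 hx with rfl | hx
      · exact Or.inr le_sup_right
      rcases hc₁ x hx with h1 | h1
      · rcases hc₂ x hx with h2 | h2
        · exact Or.inl (le_inf h1 h2)
        · exact Or.inr (h2.trans (le_sup_right.trans le_sup_left))
      · exact Or.inr (h1.trans (le_sup_left.trans le_sup_left))
    · refine ⟨a₁ ⊔ a₂ ⊔ e, b₁ ⊓ b₂, ha₁.trans (le_sup_left.trans le_sup_left), le_inf hb₁ hb₂,
        ?_, by omega⟩
      intro x hx
      rcases Finset.mem_insert.1 hx with rfl | hx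
      · exact Or.inl le_sup_right
      rcases hc₁ x hx with h1 | h1
      · exact Or.inl (h1.trans (le_sup_left.trans le_sup_left))
      · rcases hc₂ x hx with h2 | h2
        · exact Or.inl (h2.trans (le_sup_right.trans le_sup_left))
        · exact Or.inr (le_inf h1 h2)

namespace ModularExtension

section Factors

variable {L₁ L₂ : Type u} [Lattice L₁] [BoundedOrder L₁] [Lattice L₂] [BoundedOrder L₂]

theorem ι_prod (X : ModularExtension (L₁ × L₂)) (l : L₁ × L₂) :
    X.ι l = X.ι (l.1, ⊥) ⊔ X.ι (⊥, l.2) := by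
  rw [← X.isEmbedding.map_sup]
  simp

theorem ι_left_inf (X : ModularExtension (L₁ × L₂)) (x : X.E) :
    X.ι (⊤, ⊥) ⊓ x = X.ι ((X.trace x).1, ⊥) := by
  obtain ⟨l, hl⟩ := X.exists_ι_eq (inf_le_left.trans (X.ι_le_flat _) : X.ι (⊤, ⊥) ⊓ x ≤ X.flat)
  have h1 : l ≤ (⊤, ⊥) := X.ι_le_ι_iff.1 (hl.le.trans inf_le_left)
  have h2 : l ≤ X.trace x := X.le_trace_iff.2 (hl.le.trans inf_le_right)
  refine le_antisymm (hl ▸ X.ι_le_ι_iff.2 ⟨h2.1, h1.2⟩) (le_inf (X.ι_le_ι_iff.2 ⟨le_top, le_rfl⟩)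
    (X.le_trace_iff.1 ⟨le_rfl, bot_le⟩))

theorem ι_right_inf (X : ModularExtension (L₁ × L₂)) (x : X.E) :
    X.ι (⊥, ⊤) ⊓ x = X.ι (⊥, (X.trace x).2) := by
  obtain ⟨l, hl⟩ := X.exists_ι_eq (inf_le_left.trans (X.ι_le_flat _) : X.ι (⊥, ⊤) ⊓ x ≤ X.flat)
  have h1 : l ≤ (⊥, ⊤) := X.ι_le_ι_iff.1 (hl.le.trans inf_le_left)
  have h2 : l ≤ X.trace x := X.le_trace_iff.2 (hl.le.trans inf_le_right)
  refine le_antisymm (hl ▸ X.ι_le_ι_iff.2 ⟨h1.1, h2.2⟩) (le_inf (X.ι_le_ι_iff.2 ⟨le_rfl, le_top⟩)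
    (X.le_trace_iff.1 ⟨bot_le, le_rfl⟩))

variable [IsGeometricLattice L₁] [IsGeometricLattice L₂]

/-- `E` is the product of `[⊥, P]` and `[⊥, Q]`, with `L₁` in the first and `L₂` in the second
factor. -/
structure IsSep (X : ModularExtension (L₁ × L₂)) (P Q : X.E) : Prop extends IsSplit P Q where
  left_le : X.ι (⊤, ⊥) ≤ P
  right_le : X.ι (⊥, ⊤) ≤ Q

theorem rk_sup_left_add (X : ModularExtension (L₁ × L₂)) (x : X.E) :
    rk (X.ι (⊤, ⊥) ⊔ x) + rk (X.trace x).1 = rk x + rk (⊤ : L₁) := by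
  have h1 := X.rk_sup_flat x
  have h2 := X.rk_sup_flat (x ⊔ X.ι (⊤, ⊥))
  rw [sup_assoc, sup_eq_right.2 (X.ι_le_flat _), trace_sup_ι] at h2
  rw [rk_ι, prod_geometric.1] at h1 h2
  simp only [Prod.fst_sup, Prod.snd_sup, sup_top_eq, sup_bot_eq] at h2
  rw [sup_comm]
  omega

theorem rk_sup_right_add (X : ModularExtension (L₁ × L₂)) (x : X.E) :
    rk (X.ι (⊥, ⊤) ⊔ x) + rk (X.trace x).2 = rk x + rk (⊤ : L₂) := by
  have h1 := X.rk_sup_flat x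
  have h2 := X.rk_sup_flat (x ⊔ X.ι (⊥, ⊤))
  rw [sup_assoc, sup_eq_right.2 (X.ι_le_flat _), trace_sup_ι] at h2
  rw [rk_ι, prod_geometric.1] at h1 h2
  simp only [Prod.fst_sup, Prod.snd_sup, sup_top_eq, sup_bot_eq] at h2
  rw [sup_comm]
  omega

theorem isModular_left (X : ModularExtension (L₁ × L₂)) : IsModular (X.ι (⊤, ⊥)) := by
  intro x
  have h1 := X.rk_sup_left_add x
  rw [ι_left_inf, rk_ι, rk_ι, prod_geometric.1, prod_geometric.1]
  simp only [rk_bot]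
  omega

theorem isModular_right (X : ModularExtension (L₁ × L₂)) : IsModular (X.ι (⊥, ⊤)) := by
  intro x
  have h1 := X.rk_sup_right_add x
  rw [ι_right_inf, rk_ι, rk_ι, prod_geometric.1, prod_geometric.1]
  simp only [rk_bot]
  omega

/-- Every modular extension of `L₁ × L₂` is a product of an extension of `L₁` and one of `L₂`. -/
theorem exists_isSep (X : ModularExtension (L₁ × L₂)) : ∃ P Q, X.IsSep P Q := by
  have := X.geometric.finite
  have hab : ∀ s, rk (X.ι (⊤, ⊥) ⊔ s) + rk (X.ι (⊥, ⊤) ⊔ s) ≤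
      rk (X.ι (⊤, ⊥) ⊔ X.ι (⊥, ⊤) ⊔ s) + rk s := by
    intro s
    have h1 := X.rk_sup_left_add s
    have h2 := X.rk_sup_right_add s
    have h3 := X.rk_sup_flat s
    have h4 : X.flat = X.ι (⊤, ⊥) ⊔ X.ι (⊥, ⊤) := X.ι_prod ⊤
    rw [sup_comm s, rk_ι, prod_geometric.1, h4, ← h4] at h3
    have h5 := X.rk_ι ⊤
    rw [prod_geometric.1] at h5
    change rk X.flat = rk (⊤ : L₁) + rk (⊤ : L₂) at h5
    rw [← h4]
    omega
  obtain ⟨P, Q, hP, hQ, hc, hr⟩ := exists_rk_add_rk_le hab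
    (Set.toFinite {a : X.E | IsAtom a}).toFinset (by simp) ⊥
  refine ⟨P, Q, ⟨?_, fun a ha => hc a (by simpa using ha)⟩, hP, hQ⟩
  rw [sup_bot_eq, sup_bot_eq, rk_bot] at hr
  exact hr.trans (rk_mono le_top)

/-- A modular extension of `L₁ × L₂` as an extension of `L₁`. -/
@[reducible] def fstExt (X : ModularExtension (L₁ × L₂)) : ModularExtension L₁ where
  E := X.E
  ι l := X.ι (l, ⊥)
  isEmbedding :=
    { injective := fun _ _ h => congrArg Prod.fst (X.isEmbedding.injective h)
      map_sup := fun _ _ => by rw [← X.isEmbedding.map_sup, Prod.mk_sup_mk, sup_idem]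
      map_atom := fun _ ha => X.isEmbedding.map_atom _ (isAtom_prod_left ha) }
  range_ι := by
    ext x
    constructor
    · rintro ⟨l, rfl⟩
      exact X.ι_le_ι_iff.2 ⟨le_top, le_rfl⟩
    · intro hx
      exact ⟨(X.trace x).1, (X.ι_left_inf x).symm.trans (inf_eq_right.2 hx)⟩
  isModular := X.isModular_left

/-- A modular extension of `L₁ × L₂` as an extension of `L₂`. -/
@[reducible] def sndExt (X : ModularExtension (L₁ × L₂)) : ModularExtension L₂ where
  E := X.E
  ι l := X.ι (⊥, l)
  isEmbedding :=
    { injective := fun _ _ h => congrArg Prod.snd (X.isEmbedding.injective h)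
      map_sup := fun _ _ => by rw [← X.isEmbedding.map_sup, Prod.mk_sup_mk, sup_idem]
      map_atom := fun _ ha => X.isEmbedding.map_atom _ (isAtom_prod_right ha) }
  range_ι := by
    ext x
    constructor
    · rintro ⟨l, rfl⟩
      exact X.ι_le_ι_iff.2 ⟨le_rfl, le_top⟩
    · intro hx
      exact ⟨(X.trace x).2, (X.ι_right_inf x).symm.trans (inf_eq_right.2 hx)⟩
  isModular := X.isModular_right

namespace IsSep

variable {X : ModularExtension (L₁ × L₂)} {P Q : X.E}

/-- The extension `L₁ → [⊥, P]`. -/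
@[reducible] def left (h : X.IsSep P Q) : ModularExtension L₁ := X.fstExt.restrict P h.left_le

/-- The extension `L₂ → [⊥, Q]`. -/
@[reducible] def right (h : X.IsSep P Q) : ModularExtension L₂ := X.sndExt.restrict Q h.right_le

/-- A modular extension of `L₁ × L₂` is the product of the extensions into which it separates. -/
def prodIso (h : X.IsSep P Q) : X.E ≃o (h.left.prod h.right).E := h.orderIso

theorem prodIso_ι (h : X.IsSep P Q) (l : L₁ × L₂) :
    h.prodIso (X.ι l) = (h.left.prod h.right).ι l := by
  have h1 : X.ι (l.1, ⊥) ≤ P := (X.ι_le_ι_iff.2 (Prod.mk_le_mk.2 ⟨le_top, le_rfl⟩)).trans h.left_le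
  have h2 : X.ι (⊥, l.2) ≤ Q := (X.ι_le_ι_iff.2 (Prod.mk_le_mk.2 ⟨le_rfl, le_top⟩)).trans h.right_le
  refine Prod.ext (Subtype.ext ?_) (Subtype.ext ?_)
  · show X.ι l ⊓ P = X.ι (l.1, ⊥)
    rw [ι_prod, h.sup_inf_left h1 h2]
  · show X.ι l ⊓ Q = X.ι (⊥, l.2)
    rw [ι_prod, h.sup_inf_right h1 h2]

end IsSep

end Factors

end ModularExtension

/-! ### Products of modular extensions -/

namespace ModularExtension

variable {L₁ L₂ : Type u} [Lattice L₁] [BoundedOrder L₁] [IsGeometricLattice L₁]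
  [Lattice L₂] [BoundedOrder L₂] [IsGeometricLattice L₂]

/-- The first projection of `E₁ × E₂`. -/
def prFst (X : ModularExtension L₁) (Y : ModularExtension L₂) (p : (X.prod Y).E) : X.E :=
  Prod.fst (α := X.E) (β := Y.E) p

/-- The second projection of `E₁ × E₂`. -/
def prSnd (X : ModularExtension L₁) (Y : ModularExtension L₂) (p : (X.prod Y).E) : Y.E :=
  Prod.snd (α := X.E) (β := Y.E) p

/-- The element `(x, y)` of `E₁ × E₂`. -/
def prMk (X : ModularExtension L₁) (Y : ModularExtension L₂) (x : X.E) (y : Y.E) :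
    (X.prod Y).E :=
  ((x, y) : X.E × Y.E)

/-- The element `(x, ⊥)` of `E₁ × E₂`. -/
def prInl (X : ModularExtension L₁) (Y : ModularExtension L₂) (x : X.E) : (X.prod Y).E :=
  X.prMk Y x ⊥

/-- The element `(⊥, y)` of `E₁ × E₂`. -/
def prInr (X : ModularExtension L₁) (Y : ModularExtension L₂) (y : Y.E) : (X.prod Y).E :=
  X.prMk Y ⊥ y

section API

variable {X X' : ModularExtension L₁} {Y Y' : ModularExtension L₂}

theorem pr_ext {p q : (X.prod Y).E} (h1 : X.prFst Y p = X.prFst Y q)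
    (h2 : X.prSnd Y p = X.prSnd Y q) : p = q :=
  Prod.ext h1 h2

theorem pr_le_iff {p q : (X.prod Y).E} :
    p ≤ q ↔ X.prFst Y p ≤ X.prFst Y q ∧ X.prSnd Y p ≤ X.prSnd Y q := Iff.rfl

theorem prFst_mk (x : X.E) (y : Y.E) : X.prFst Y (X.prMk Y x y) = x := rfl

theorem prSnd_mk (x : X.E) (y : Y.E) : X.prSnd Y (X.prMk Y x y) = y := rfl

theorem prFst_ι (l : L₁ × L₂) : X.prFst Y ((X.prod Y).ι l) = X.ι l.1 := rfl

theorem prSnd_ι (l : L₁ × L₂) : X.prSnd Y ((X.prod Y).ι l) = Y.ι l.2 := rfl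

theorem prFst_flat : X.prFst Y (X.prod Y).flat = X.flat := rfl

theorem prSnd_flat : X.prSnd Y (X.prod Y).flat = Y.flat := rfl

theorem prInl_le_iff {x : X.E} {p : (X.prod Y).E} : X.prInl Y x ≤ p ↔ x ≤ X.prFst Y p :=
  pr_le_iff.trans (and_iff_left bot_le)

theorem prInr_le_iff {y : Y.E} {p : (X.prod Y).E} : X.prInr Y y ≤ p ↔ y ≤ X.prSnd Y p :=
  pr_le_iff.trans (and_iff_right bot_le)

theorem rk_pr (p : (X.prod Y).E) : rk p = rk (X.prFst Y p) + rk (X.prSnd Y p) :=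
  (prod_geometric (E := X.E) (E' := Y.E)).1 p

theorem isAtom_prInl_iff {x : X.E} : IsAtom (X.prInl Y x) ↔ IsAtom x := by
  rw [isAtom_iff_rk, isAtom_iff_rk, rk_pr, prInl, prFst_mk, prSnd_mk, rk_bot, add_zero]

theorem isAtom_prInr_iff {y : Y.E} : IsAtom (X.prInr Y y) ↔ IsAtom y := by
  rw [isAtom_iff_rk, isAtom_iff_rk, rk_pr, prInr, prFst_mk, prSnd_mk, rk_bot, zero_add]

theorem trace_pr (p : (X.prod Y).E) :
    (X.prod Y).trace p = (X.trace (X.prFst Y p), Y.trace (X.prSnd Y p)) := by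
  refine eq_of_forall_le_iff fun a => ?_
  rw [le_trace_iff, pr_le_iff, prFst_ι, prSnd_ι, Prod.le_def, le_trace_iff, le_trace_iff]

theorem pr_span (J : List X.E) (K : List Y.E) :
    (X.prod Y).span (J.map (X.prInl Y) ++ K.map (X.prInr Y)) =
      X.prMk Y (X.span J) (Y.span K) := by
  refine eq_of_forall_ge_iff fun p => ?_
  rw [span_le_iff, pr_le_iff, pr_le_iff, prFst_flat, prSnd_flat, prFst_mk, prSnd_mk,
    span_le_iff, span_le_iff]
  simp only [List.mem_append, or_imp, forall_and, List.forall_mem_map, prInl_le_iff,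
    prInr_le_iff]
  tauto

theorem pr_wordDeg (J : List X.E) (K : List Y.E) :
    (X.prod Y).wordDeg (J.map (X.prInl Y) ++ K.map (X.prInr Y)) =
      X.wordDeg J + Y.wordDeg K := by
  have h1 := rk_pr (X.prod Y).flat
  rw [prFst_flat, prSnd_flat] at h1
  rw [wordDeg, wordDeg, wordDeg, pr_span, rk_pr, prFst_mk, prSnd_mk, List.length_append,
    List.length_map, List.length_map, h1]
  push_cast
  ring

theorem isModular_prMk {G : X.E} {G' : Y.E} (hG : IsModular G) (hG' : IsModular G') :
    IsModular (X.prMk Y G G') := isModular_prod hG hG'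

theorem Splits.prod_left (h : X.Splits) (Y : ModularExtension L₂) : (X.prod Y).Splits := by
  obtain ⟨P, Q, hPQ, hF, hQ⟩ := h
  refine ⟨X.prMk Y P ⊤, X.prInl Y Q, ⟨?_, fun a ha => ?_⟩, ⟨hF, le_top⟩,
    fun h => hQ (congrArg (X.prFst Y) h)⟩
  · have h1 := hPQ.rk_le
    rw [rk_pr, rk_pr, rk_pr, prInl, prFst_mk, prFst_mk, prSnd_mk, prSnd_mk, rk_bot]
    change rk P + rk (⊤ : Y.E) + (rk Q + 0) ≤ rk (⊤ : X.E) + rk (⊤ : Y.E)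
    omega
  · by_cases h0 : X.prFst Y a ≤ P
    · exact Or.inl ⟨h0, le_top⟩
    · have hatom := X.geometric.atomistic
      obtain ⟨b, hb, hba, hbP⟩ := exists_atom_le_not_le h0
      have h1 : X.prInl Y b = a :=
        (ha.le_iff_eq (isAtom_prInl_iff.2 hb).1).1 (prInl_le_iff.2 hba)
      rw [← h1]
      exact Or.inr (prInl_le_iff.2 ((hPQ.not_le_iff hb).1 hbP))

theorem Splits.prod_right (h : Y.Splits) (X : ModularExtension L₁) : (X.prod Y).Splits := by
  obtain ⟨P, Q, hPQ, hF, hQ⟩ := h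
  refine ⟨X.prMk Y ⊤ P, X.prInr Y Q, ⟨?_, fun a ha => ?_⟩, ⟨le_top, hF⟩,
    fun h => hQ (congrArg (X.prSnd Y) h)⟩
  · have h1 := hPQ.rk_le
    rw [rk_pr, rk_pr, rk_pr, prInr, prFst_mk, prFst_mk, prSnd_mk, prSnd_mk, rk_bot]
    change rk (⊤ : X.E) + rk P + (0 + rk Q) ≤ rk (⊤ : X.E) + rk (⊤ : Y.E)
    omega
  · by_cases h0 : X.prSnd Y a ≤ P
    · exact Or.inl ⟨le_top, h0⟩
    · have hatom := Y.geometric.atomistic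
      obtain ⟨b, hb, hba, hbP⟩ := exists_atom_le_not_le h0
      have h1 : X.prInr Y b = a :=
        (ha.le_iff_eq (isAtom_prInr_iff.2 hb).1).1 (prInr_le_iff.2 hba)
      rw [← h1]
      exact Or.inr (prInr_le_iff.2 ((hPQ.not_le_iff hb).1 hbP))

theorem isFullEmbedding_id {L : Type u} [Lattice L] [BoundedOrder L] (X : ModularExtension L) :
    IsFullEmbedding X X fun x => x :=
  isFullEmbedding_orderIso (OrderIso.refl X.E) fun _ => rfl

/-- `(E₁ ∪ E₁') × (E₂ ∪ E₂') ≃ (E₁ × E₂) ∪ (E₁' × E₂')`. -/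
noncomputable def prPushout (X X' : ModularExtension L₁) (Y Y' : ModularExtension L₂) :
    ((X.pushout X').prod (Y.pushout Y')).E ≃o ((X.prod Y).pushout (X'.prod Y')).E where
  toFun p := (X.prod Y).poMk (X'.prod Y')
    (X.prMk Y (X.poFst X' ((X.pushout X').prFst (Y.pushout Y') p))
      (Y.poFst Y' ((X.pushout X').prSnd (Y.pushout Y') p)))
    (X'.prMk Y' (X.poSnd X' ((X.pushout X').prFst (Y.pushout Y') p))
      (Y.poSnd Y' ((X.pushout X').prSnd (Y.pushout Y') p)))
    (by simp only [trace_pr, prFst_mk, prSnd_mk, po_trace])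
  invFun p := (X.pushout X').prMk (Y.pushout Y')
    (X.poMk X' (X.prFst Y ((X.prod Y).poFst (X'.prod Y') p))
      (X'.prFst Y' ((X.prod Y).poSnd (X'.prod Y') p))
      (by have h := (X.prod Y).po_trace (X'.prod Y') p
          rw [trace_pr, trace_pr] at h
          exact congrArg Prod.fst h))
    (Y.poMk Y' (X.prSnd Y ((X.prod Y).poFst (X'.prod Y') p))
      (X'.prSnd Y' ((X.prod Y).poSnd (X'.prod Y') p))
      (by have h := (X.prod Y).po_trace (X'.prod Y') p
          rw [trace_pr, trace_pr] at h
          exact congrArg Prod.snd h))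
  left_inv _ := rfl
  right_inv _ := rfl
  map_rel_iff' := and_and_and_comm

theorem isFullEmbedding_prPushout (X X' : ModularExtension L₁) (Y Y' : ModularExtension L₂) :
    IsFullEmbedding ((X.pushout X').prod (Y.pushout Y')) ((X.prod Y).pushout (X'.prod Y'))
      (prPushout X X' Y Y') :=
  isFullEmbedding_orderIso _ fun _ => rfl

theorem prPushout_inl_inl (x : X.E) : prPushout X X' Y Y'
    ((X.pushout X').prInl (Y.pushout Y') (X.poInl X' x)) =
      (X.prod Y).poInl (X'.prod Y') (X.prInl Y x) := by
  refine po_ext rfl ?_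
  rw [poSnd_inl, trace_pr]
  refine pr_ext rfl ?_
  show ⊥ = Y'.ι (Y.trace ⊥)
  rw [trace_bot, ι_bot]

theorem prPushout_inl_inr (x : X'.E) : prPushout X X' Y Y'
    ((X.pushout X').prInl (Y.pushout Y') (X.poInr X' x)) =
      (X.prod Y).poInr (X'.prod Y') (X'.prInl Y' x) := by
  refine po_ext ?_ rfl
  rw [poFst_inr, trace_pr]
  refine pr_ext rfl ?_
  show ⊥ = Y.ι (Y'.trace ⊥)
  rw [trace_bot, ι_bot]

theorem prPushout_inr_inl (y : Y.E) : prPushout X X' Y Y'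
    ((X.pushout X').prInr (Y.pushout Y') (Y.poInl Y' y)) =
      (X.prod Y).poInl (X'.prod Y') (X.prInr Y y) := by
  refine po_ext rfl ?_
  rw [poSnd_inl, trace_pr]
  refine pr_ext ?_ rfl
  show ⊥ = X'.ι (X.trace ⊥)
  rw [trace_bot, ι_bot]

theorem prPushout_inr_inr (y : Y'.E) : prPushout X X' Y Y'
    ((X.pushout X').prInr (Y.pushout Y') (Y.poInr Y' y)) =
      (X.prod Y).poInr (X'.prod Y') (X'.prInr Y' y) := by
  refine po_ext ?_ rfl
  rw [poFst_inr, trace_pr]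
  refine pr_ext ?_ rfl
  show ⊥ = X.ι (X'.trace ⊥)
  rw [trace_bot, ι_bot]

/-- Contracting an atom of the first factor of a product. -/
theorem isFullEmbedding_contract_prInl {H : X.E} {hH : IsAtom H} {hHF : ¬ H ≤ X.flat}
    (Y : ModularExtension L₂) (hH' : IsAtom (X.prInl Y H))
    (hHF' : ¬ X.prInl Y H ≤ (X.prod Y).flat) :
    IsFullEmbedding ((X.contract H hH hHF).prod Y) ((X.prod Y).contract (X.prInl Y H) hH' hHF')
      (fun p => (X.prod Y).toContract hH' hHF' (X.prMk Y
        (X.ofContract ((X.contract H hH hHF).prFst Y p)) ((X.contract H hH hHF).prSnd Y p))) := by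
  have key : ∀ p : ((X.contract H hH hHF).prod Y).E,
      (X.prod Y).ofContract ((X.prod Y).toContract hH' hHF' (X.prMk Y
        (X.ofContract ((X.contract H hH hHF).prFst Y p)) ((X.contract H hH hHF).prSnd Y p))) =
      X.prMk Y (X.ofContract ((X.contract H hH hHF).prFst Y p))
        ((X.contract H hH hHF).prSnd Y p) := fun p => by
    rw [ofContract_toContract, sup_eq_right, prInl_le_iff]
    exact X.le_ofContract _
  have hrk : ∀ p : ((X.contract H hH hHF).prod Y).E,
      rk ((X.prod Y).toContract hH' hHF' (X.prMk Y
        (X.ofContract ((X.contract H hH hHF).prFst Y p)) ((X.contract H hH hHF).prSnd Y p))) =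
      rk p := fun p => by
    have h1 := (X.prod Y).rk_contract ((X.prod Y).toContract hH' hHF' (X.prMk Y
        (X.ofContract ((X.contract H hH hHF).prFst Y p)) ((X.contract H hH hHF).prSnd Y p)))
    have h2 := X.rk_contract ((X.contract H hH hHF).prFst Y p)
    rw [key, rk_pr, prFst_mk, prSnd_mk] at h1
    have h3 := rk_pr p
    omega
  exact
  { injective := fun p q hpq => by
      have h := congrArg (X.prod Y).ofContract hpq
      simp only [key] at h
      exact pr_ext (X.ofContract_injective (congrArg (X.prFst Y) h)) (congrArg (X.prSnd Y) h)
    map_sup := fun p q => ofContract_injective _ (by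
      rw [key, ofContract_sup, key, key]
      rfl)
    map_atom := fun p hp => isAtom_of_rk (by rw [hrk, rk_atom hp])
    rk_top := by
      rw [← hrk]
      refine congrArg rk (ofContract_injective _ ?_)
      rw [key, ofContract_top]
      rfl
    map_ι := fun l => ofContract_injective _ (by
      rw [key, ofContract_ι]
      refine pr_ext rfl ?_
      exact bot_sup_eq (Y.ι l.2)) }

/-- Contracting an atom of the second factor of a product. -/
theorem isFullEmbedding_contract_prInr {H : Y.E} {hH : IsAtom H} {hHF : ¬ H ≤ Y.flat}
    (X : ModularExtension L₁) (hH' : IsAtom (X.prInr Y H))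
    (hHF' : ¬ X.prInr Y H ≤ (X.prod Y).flat) :
    IsFullEmbedding (X.prod (Y.contract H hH hHF)) ((X.prod Y).contract (X.prInr Y H) hH' hHF')
      (fun p => (X.prod Y).toContract hH' hHF' (X.prMk Y
        (X.prFst (Y.contract H hH hHF) p) (Y.ofContract (X.prSnd (Y.contract H hH hHF) p)))) := by
  have key : ∀ p : (X.prod (Y.contract H hH hHF)).E,
      (X.prod Y).ofContract ((X.prod Y).toContract hH' hHF' (X.prMk Y
        (X.prFst (Y.contract H hH hHF) p) (Y.ofContract (X.prSnd (Y.contract H hH hHF) p)))) =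
      X.prMk Y (X.prFst (Y.contract H hH hHF) p)
        (Y.ofContract (X.prSnd (Y.contract H hH hHF) p)) := fun p => by
    rw [ofContract_toContract, sup_eq_right, prInr_le_iff]
    exact Y.le_ofContract _
  have hrk : ∀ p : (X.prod (Y.contract H hH hHF)).E,
      rk ((X.prod Y).toContract hH' hHF' (X.prMk Y
        (X.prFst (Y.contract H hH hHF) p) (Y.ofContract (X.prSnd (Y.contract H hH hHF) p)))) =
      rk p := fun p => by
    have h1 := (X.prod Y).rk_contract ((X.prod Y).toContract hH' hHF' (X.prMk Y
        (X.prFst (Y.contract H hH hHF) p) (Y.ofContract (X.prSnd (Y.contract H hH hHF) p))))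
    have h2 := Y.rk_contract (X.prSnd (Y.contract H hH hHF) p)
    rw [key, rk_pr, prFst_mk, prSnd_mk] at h1
    have h3 := rk_pr p
    omega
  exact
  { injective := fun p q hpq => by
      have h := congrArg (X.prod Y).ofContract hpq
      simp only [key] at h
      exact pr_ext (congrArg (X.prFst Y) h) (Y.ofContract_injective (congrArg (X.prSnd Y) h))
    map_sup := fun p q => ofContract_injective _ (by
      rw [key, ofContract_sup, key, key]
      rfl)
    map_atom := fun p hp => isAtom_of_rk (by rw [hrk, rk_atom hp])
    rk_top := by
      rw [← hrk]
      refine congrArg rk (ofContract_injective _ ?_)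
      rw [key, ofContract_top]
      rfl
    map_ι := fun l => ofContract_injective _ (by
      rw [key, ofContract_ι]
      refine pr_ext ?_ rfl
      exact bot_sup_eq (X.ι l.1)) }

theorem IsFullEmbedding.prod [Nontrivial L₁] [Nontrivial L₂] {φ : X.E → X'.E}
    {ψ : Y.E → Y'.E} (h : IsFullEmbedding X X' φ) (h' : IsFullEmbedding Y Y' ψ) :
    IsFullEmbedding (X.prod Y) (X'.prod Y')
      (fun p => X'.prMk Y' (φ (X.prFst Y p)) (ψ (X.prSnd Y p))) where
  injective p q hpq := pr_ext (h.injective (congrArg (X'.prFst Y') hpq))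
    (h'.injective (congrArg (X'.prSnd Y') hpq))
  map_sup p q := pr_ext (h.map_sup _ _) (h'.map_sup _ _)
  map_atom p hp := isAtom_of_rk (by
    rw [rk_pr, prFst_mk, prSnd_mk, h.rk_map, h'.rk_map, ← rk_pr, rk_atom hp])
  rk_top := by
    rw [rk_pr, rk_pr]
    exact congrArg₂ (· + ·) h.rk_top h'.rk_top
  map_ι l := pr_ext (h.map_ι l.1) (h'.map_ι l.2)

theorem IsFullEmbedding.prod_inl [Nontrivial L₂] {φ : X.E → X'.E} {ψ : Y.E → Y'.E}
    (h' : IsFullEmbedding Y Y' ψ) (x : X.E) :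
    X'.prMk Y' (φ (X.prFst Y (X.prInl Y x))) (ψ (X.prSnd Y (X.prInl Y x))) =
      X'.prInl Y' (φ x) :=
  pr_ext rfl h'.map_bot

theorem IsFullEmbedding.prod_inr [Nontrivial L₁] {φ : X.E → X'.E} {ψ : Y.E → Y'.E}
    (h : IsFullEmbedding X X' φ) (y : Y.E) :
    X'.prMk Y' (φ (X.prFst Y (X.prInr Y y))) (ψ (X.prSnd Y (X.prInr Y y))) =
      X'.prInr Y' (ψ y) :=
  pr_ext h.map_bot rfl

end API

end ModularExtension

/-! ### The comparison map -/

section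

variable {L₁ L₂ : Type u} [Lattice L₁] [BoundedOrder L₁] [IsGeometricLattice L₁]
  [Lattice L₂] [BoundedOrder L₂] [IsGeometricLattice L₂]

/-- The class of the diagram `(E₁ × E₂, ι₁ × ι₂, J ⊔ K)`. -/
noncomputable def MD.prodWord (X : ModularExtension L₁) (J : List X.E) (Y : ModularExtension L₂)
    (K : List Y.E) : MD (L₁ × L₂) :=
  MD.word (X.prod Y) (J.map (X.prInl Y) ++ K.map (X.prInr Y))

theorem MD.prodWord_eq_zero_left (X : ModularExtension L₁) {J : List X.E}
    (hJ : ¬ ∀ H ∈ J, IsAtom H) (Y : ModularExtension L₂) (K : List Y.E) :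
    MD.prodWord X J Y K = 0 := by
  push Not at hJ
  obtain ⟨M, hM, hM'⟩ := hJ
  exact MD.word_of_not_isAtom _ (List.mem_append_left _ (List.mem_map_of_mem hM))
    fun h => hM' (isAtom_prInl_iff.1 h)

theorem MD.prodWord_eq_zero_right (X : ModularExtension L₁) (J : List X.E)
    (Y : ModularExtension L₂) {K : List Y.E} (hK : ¬ ∀ H ∈ K, IsAtom H) :
    MD.prodWord X J Y K = 0 := by
  push Not at hK
  obtain ⟨M, hM, hM'⟩ := hK
  exact MD.word_of_not_isAtom _ (List.mem_append_right _ (List.mem_map_of_mem hM))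
    fun h => hM' (isAtom_prInr_iff.1 h)

variable [Nontrivial L₁] [Nontrivial L₂]

theorem MD.isInvariant_prodWord_left (Y : ModularExtension L₂) (K : List Y.E) :
    IsInvariant fun (X : ModularExtension L₁) J => MD.prodWord X J Y K where
  antisymm X := ((MD.word_antisymm (X.prod Y)).append_right _).map (X.prInl Y)
  map {X X' φ} h J _ := by
    rw [MD.prodWord, MD.prodWord, ← MD.word_map (h.prod Y.isFullEmbedding_id), List.map_append,
      List.map_map, List.map_map, List.map_map]
    congr 2
    exact List.map_congr_left fun y _ => (h.prod_inr (Y' := Y) (ψ := fun y => y) y).symm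
  span {X J} _ h := by
    refine MD.word_eq_zero_of_span fun h' => h ?_
    rw [pr_span] at h'
    exact congrArg (X.prFst Y) h'
  splits _ h := MD.word_eq_zero_of_splits (h.prod_left Y) _
  modular {X G A B R} _ hG hF hA hB hR := by
    refine MD.word_eq_zero_of_isModular (isModular_prMk (Y := Y) hG isModular_top) ⟨hF, le_top⟩
      (fun h => hA (prInl_le_iff.1 h)) (fun h => hB (prInl_le_iff.1 h)) fun M hM => ?_
    rcases List.mem_append.1 hM with h | h
    · obtain ⟨N, hN, rfl⟩ := List.mem_map.1 h
      exact prInl_le_iff.2 (hR N hN)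
    · obtain ⟨N, hN, rfl⟩ := List.mem_map.1 h
      exact prInr_le_iff.2 le_top

theorem MD.isInvariant_prodWord_right (X : ModularExtension L₁) (J : List X.E) :
    IsInvariant fun (Y : ModularExtension L₂) K => MD.prodWord X J Y K where
  antisymm Y := ((MD.word_antisymm (X.prod Y)).append_left _).map (X.prInr Y)
  map {Y Y' φ} h K _ := by
    rw [MD.prodWord, MD.prodWord, ← MD.word_map (X.isFullEmbedding_id.prod h), List.map_append,
      List.map_map, List.map_map, List.map_map]
    congr 2
    exact List.map_congr_left fun x _ => (h.prod_inl (X' := X) (φ := fun x => x) x).symm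
  span {Y K} _ h := by
    refine MD.word_eq_zero_of_span fun h' => h ?_
    rw [pr_span] at h'
    exact congrArg (X.prSnd Y) h'
  splits _ h := MD.word_eq_zero_of_splits (h.prod_right X) _
  modular {Y G A B R} _ hG hF hA hB hR := by
    refine (MD.word_antisymm _).eq_zero_of_perm List.perm_append_comm ?_
    refine MD.word_eq_zero_of_isModular (isModular_prMk (X := X) isModular_top hG) ⟨le_top, hF⟩
      (fun h => hA (prInr_le_iff.1 h)) (fun h => hB (prInr_le_iff.1 h)) fun M hM => ?_
    rcases List.mem_append.1 hM with h | h
    · obtain ⟨N, hN, rfl⟩ := List.mem_map.1 h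
      exact prInr_le_iff.2 (hR N hN)
    · obtain ⟨N, hN, rfl⟩ := List.mem_map.1 h
      exact prInl_le_iff.2 le_top

/-- The product of diagrams of `L₂` with the diagram of `L₁` with the word `J`. -/
noncomputable def MD.prodHomWord (X : ModularExtension L₁) (J : List X.E) :
    MD L₂ →ₗ[ℚ] MD (L₁ × L₂) :=
  MD.lift _ (MD.isInvariant_prodWord_right X J)

theorem MD.prodHomWord_word (X : ModularExtension L₁) (J : List X.E) (Y : ModularExtension L₂)
    (K : List Y.E) : MD.prodHomWord X J (MD.word Y K) = MD.prodWord X J Y K := by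
  by_cases hK : ∀ H ∈ K, IsAtom H
  · exact MD.lift_word _ _ Y hK
  · rw [MD.prodWord_eq_zero_right X J Y hK, MD.word, dif_neg hK, map_zero]

theorem MD.isInvariant_prodHomWord :
    IsInvariant (MD.prodHomWord (L₁ := L₁) (L₂ := L₂)) where
  antisymm X A B H K := MD.hom_ext fun Y M _ => by
    rw [LinearMap.neg_apply, MD.prodHomWord_word, MD.prodHomWord_word]
    exact (MD.isInvariant_prodWord_left Y M).antisymm X A B H K
  map h J hJ := MD.hom_ext fun Y M _ => by
    rw [MD.prodHomWord_word, MD.prodHomWord_word]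
    exact (MD.isInvariant_prodWord_left Y M).map h J hJ
  span hJ h := MD.hom_ext fun Y M _ => by
    rw [MD.prodHomWord_word]
    exact (MD.isInvariant_prodWord_left Y M).span hJ h
  splits hJ h := MD.hom_ext fun Y M _ => by
    rw [MD.prodHomWord_word]
    exact (MD.isInvariant_prodWord_left Y M).splits hJ h
  modular hJ hG hF hA hB hR := MD.hom_ext fun Y M _ => by
    rw [MD.prodHomWord_word]
    exact (MD.isInvariant_prodWord_left Y M).modular hJ hG hF hA hB hR

/-- The bilinear map that takes the product of a diagram of `L₁` and a diagram of `L₂`. -/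
noncomputable def MD.prodHom : MD L₁ →ₗ[ℚ] MD L₂ →ₗ[ℚ] MD (L₁ × L₂) :=
  MD.lift _ MD.isInvariant_prodHomWord

theorem MD.prodHom_word (X : ModularExtension L₁) (J : List X.E) (Y : ModularExtension L₂)
    (K : List Y.E) : MD.prodHom (MD.word X J) (MD.word Y K) = MD.prodWord X J Y K := by
  by_cases hJ : ∀ H ∈ J, IsAtom H
  · rw [MD.prodHom, MD.lift_word _ _ X hJ, MD.prodHomWord_word]
  · rw [MD.prodWord_eq_zero_left X hJ Y K, MD.word, dif_neg hJ, map_zero, LinearMap.zero_apply]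

theorem MD.prodHom_mk (Γ₁ : ModularDiagram L₁) (Γ₂ : ModularDiagram L₂) :
    MD.prodHom (MD.mk Γ₁) (MD.mk Γ₂) = MD.mk (Γ₁.prod Γ₂) := by
  rw [MD.mk_eq_word, MD.mk_eq_word, MD.mk_eq_word, MD.prodHom_word]
  rfl

theorem MD.prodHom_one : MD.prodHom (MD.one L₁) (MD.one L₂) = MD.one (L₁ × L₂) := by
  rw [MD.one_eq, MD.one_eq, MD.one_eq, MD.prodHom_word]
  exact MD.word_map (X := (ModularExtension.refl L₁).prod (ModularExtension.refl L₂))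
    (Y := ModularExtension.refl (L₁ × L₂)) (isFullEmbedding_orderIso
      (OrderIso.refl (L₁ × L₂)) fun _ => rfl) []

/-- Products of diagrams multiply factor by factor; the sign comes from moving `J'` past `K`. -/
theorem MD.prodWord_mul (X : ModularExtension L₁) (J : List X.E) (Y : ModularExtension L₂)
    (K : List Y.E) (X' : ModularExtension L₁) (J' : List X'.E) (Y' : ModularExtension L₂)
    (K' : List Y'.E) : MD.mul (MD.prodWord X J Y K) (MD.prodWord X' J' Y' K') =
      (-1 : ℤ) ^ (J'.length * K.length) • MD.prodHom (MD.mul (MD.word X J) (MD.word X' J'))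
        (MD.mul (MD.word Y K) (MD.word Y' K')) := by
  rw [MD.mul_word, MD.mul_word, MD.glueWord, MD.glueWord, MD.prodHom_word, MD.prodWord,
    MD.prodWord, MD.prodWord, MD.mul_word, MD.glueWord,
    ← MD.word_map (isFullEmbedding_prPushout X X' Y Y')]
  simp only [List.map_append, List.map_map, List.append_assoc]
  have h := (((MD.word_antisymm ((X.prod Y).pushout (X'.prod Y'))).append_left
    (J.map (prPushout X X' Y Y' ∘ (X.pushout X').prInl (Y.pushout Y') ∘ X.poInl X'))).append_right
    (K'.map (prPushout X X' Y Y' ∘ (X.pushout X').prInr (Y.pushout Y') ∘ Y.poInr Y'))).append_comm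
    (J'.map (prPushout X X' Y Y' ∘ (X.pushout X').prInl (Y.pushout Y') ∘ X.poInr X'))
    (K.map (prPushout X X' Y Y' ∘ (X.pushout X').prInr (Y.pushout Y') ∘ Y.poInl Y'))
  simp only [List.append_assoc, List.length_map] at h
  rw [h, smul_smul, ← pow_add, (Even.add_self _).neg_one_pow, one_smul]
  congr 2
  · exact List.map_congr_left fun x _ => (prPushout_inl_inl x).symm
  congr 1
  · exact List.map_congr_left fun x _ => (prPushout_inr_inl x).symm
  congr 1
  · exact List.map_congr_left fun x _ => (prPushout_inl_inr x).symm
  · exact List.map_congr_left fun x _ => (prPushout_inr_inr x).symm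

theorem MD.dTerm_prInl (X : ModularExtension L₁) (Y : ModularExtension L₂) (H : X.E)
    (R : List X.E) (K : List Y.E) :
    MD.dTerm (X.prod Y) (X.prInl Y H) (R.map (X.prInl Y) ++ K.map (X.prInr Y)) =
      MD.prodHom (MD.dTerm X H R) (MD.word Y K) := by
  by_cases hs : H ≤ X.span R
  swap
  · rw [MD.dTerm_of_not_le hs, MD.dTerm_of_not_le, map_zero, LinearMap.zero_apply]
    rwa [pr_span, prInl_le_iff, prFst_mk]
  rw [MD.dTerm_of_le hs, MD.dTerm_of_le (by rwa [pr_span, prInl_le_iff, prFst_mk])]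
  by_cases h : IsAtom H ∧ ¬ H ≤ X.flat
  swap
  · rw [MD.contractWord, MD.contractWord, dif_neg h, map_zero, LinearMap.zero_apply, dif_neg]
    rwa [isAtom_prInl_iff, prInl_le_iff, prFst_flat]
  have h' : IsAtom (X.prInl Y H) ∧ ¬ X.prInl Y H ≤ (X.prod Y).flat := by
    rwa [isAtom_prInl_iff, prInl_le_iff, prFst_flat]
  rw [MD.contractWord_eq _ h.1 h.2, MD.contractWord_eq _ h'.1 h'.2, MD.prodHom_word, MD.prodWord,
    ← MD.word_map (isFullEmbedding_contract_prInl Y (hH := h.1) (hHF := h.2) h'.1 h'.2)]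
  simp only [List.map_append, List.map_map]
  congr 2
  · refine List.map_congr_left fun x _ => ofContract_injective _ (pr_ext ?_ rfl)
    exact (sup_left_idem H x).symm
  · refine List.map_congr_left fun x _ => ofContract_injective _ (pr_ext ?_ rfl)
    show H ⊔ ⊥ = H ⊔ H
    rw [sup_bot_eq, sup_idem]

theorem MD.dTerm_prInr (X : ModularExtension L₁) (Y : ModularExtension L₂) (J : List X.E)
    (H : Y.E) (R : List Y.E) :
    MD.dTerm (X.prod Y) (X.prInr Y H) (J.map (X.prInl Y) ++ R.map (X.prInr Y)) =
      MD.prodHom (MD.word X J) (MD.dTerm Y H R) := by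
  by_cases hs : H ≤ Y.span R
  swap
  · rw [MD.dTerm_of_not_le hs, MD.dTerm_of_not_le, map_zero]
    rwa [pr_span, prInr_le_iff, prSnd_mk]
  rw [MD.dTerm_of_le hs, MD.dTerm_of_le (by rwa [pr_span, prInr_le_iff, prSnd_mk])]
  by_cases h : IsAtom H ∧ ¬ H ≤ Y.flat
  swap
  · rw [MD.contractWord, MD.contractWord, dif_neg h, map_zero, dif_neg]
    rwa [isAtom_prInr_iff, prInr_le_iff, prSnd_flat]
  have h' : IsAtom (X.prInr Y H) ∧ ¬ X.prInr Y H ≤ (X.prod Y).flat := by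
    rwa [isAtom_prInr_iff, prInr_le_iff, prSnd_flat]
  rw [MD.contractWord_eq _ h.1 h.2, MD.contractWord_eq _ h'.1 h'.2, MD.prodHom_word, MD.prodWord,
    ← MD.word_map (isFullEmbedding_contract_prInr X (hH := h.1) (hHF := h.2) h'.1 h'.2)]
  simp only [List.map_append, List.map_map]
  congr 2
  · refine List.map_congr_left fun x _ => ofContract_injective _ (pr_ext rfl ?_)
    show H ⊔ ⊥ = H ⊔ H
    rw [sup_bot_eq, sup_idem]
  · refine List.map_congr_left fun x _ => ofContract_injective _ (pr_ext rfl ?_)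
    exact (sup_left_idem H x).symm

theorem MD.d_prodWord {X : ModularExtension L₁} {J : List X.E} (hJ : ∀ H ∈ J, IsAtom H)
    {Y : ModularExtension L₂} {K : List Y.E} (hK : ∀ H ∈ K, IsAtom H) :
    MD.d (MD.prodWord X J Y K) = MD.prodHom (MD.d (MD.word X J)) (MD.word Y K) +
      (-1 : ℤ) ^ J.length • MD.prodHom (MD.word X J) (MD.d (MD.word Y K)) := by
  have h : ∀ H ∈ J.map (X.prInl Y) ++ K.map (X.prInr Y), IsAtom H := by
    intro H hH
    rcases List.mem_append.1 hH with h | h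
    · obtain ⟨N, hN, rfl⟩ := List.mem_map.1 h
      exact isAtom_prInl_iff.2 (hJ N hN)
    · obtain ⟨N, hN, rfl⟩ := List.mem_map.1 h
      exact isAtom_prInr_iff.2 (hK N hN)
  rw [MD.prodWord, MD.d, MD.d, MD.d, MD.lift_word _ _ _ h, MD.lift_word _ _ _ hJ,
    MD.lift_word _ _ _ hK, MD.dWord, MD.dWord, MD.dWord, altSum_append, altSum_map, altSum_map,
    List.length_map, show MD.prodHom (altSum (MD.dTerm X) J) (MD.word Y K) = _ from
      map_altSum (MD.prodHom.flip (MD.word Y K)) _ _, map_altSum (MD.prodHom (MD.word X J))]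
  simp only [MD.dTerm_prInl, MD.dTerm_prInr, LinearMap.flip_apply]

end

/-! ### Sorting the letters of a word -/

section Shuffle

variable {α : Type*} {β : Type*} {V : Type*} [AddCommGroup V]

open Classical in
/-- The sign of the permutation that moves the letters of `J` with the property `p` to the front,
keeping the order within the two groups of letters. -/
noncomputable def shuffleSign (p : α → Prop) : List α → ℤ
  | [] => 1
  | H :: B => if p H then shuffleSign p B else (-1) ^ (B.filter p).length * shuffleSign p B

theorem shuffleSign_map (p : β → Prop) (φ : α → β) (J : List α) :
    shuffleSign p (J.map φ) = shuffleSign (fun x => p (φ x)) J := by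
  induction J with
  | nil => rw [List.map_nil, shuffleSign, shuffleSign]
  | cons H B ih =>
    rw [List.map_cons, shuffleSign, shuffleSign, ih, List.filter_map, List.length_map]
    rfl

open Classical in
theorem shuffleSign_append_eq_one {p : α → Prop} {A B : List α} (hA : ∀ x ∈ A, p x)
    (hB : ∀ x ∈ B, ¬ p x) : shuffleSign p (A ++ B) = 1 := by
  induction A with
  | nil =>
    rw [List.nil_append]
    induction B with
    | nil => rw [shuffleSign]
    | cons K B ih =>
      have h : B.filter p = [] := by
        rw [List.filter_eq_nil_iff]
        intro x hx
        simpa using hB x (List.mem_cons_of_mem K hx)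
      rw [shuffleSign, if_neg (hB K List.mem_cons_self), h,
        ih fun x hx => hB x (List.mem_cons_of_mem K hx), List.length_nil, pow_zero, mul_one]
  | cons H A ih =>
    rw [List.cons_append, shuffleSign, if_pos (hA H List.mem_cons_self),
      ih fun x hx => hA x (List.mem_cons_of_mem H hx)]

open Classical in
/-- Sorting the letters of a word multiplies an antisymmetric function by the sign. -/
theorem Antisymm.eq_shuffleSign_smul {f : List α → V} (hf : Antisymm f) (p : α → Prop)
    (J : List α) : f J = shuffleSign p J • f (J.filter p ++ J.filter fun x => ¬ p x) := by
  induction J generalizing f with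
  | nil => simp [shuffleSign]
  | cons H B ih =>
    rw [shuffleSign]
    have h := ih (hf.cons H)
    by_cases hp : p H
    · simpa [hp] using h
    · rw [h, hf.neg_smul_cons, if_neg hp, smul_smul, mul_comm]
      simp [hp]

open Classical in
/-- An antisymmetric function of two words yields an antisymmetric function of one word: the letters
are sorted into the two words, and the sign of the sorting permutation is included. -/
theorem antisymm_shuffle {f : List α → List α → V} (h1 : ∀ B, Antisymm fun A => f A B)
    (h2 : ∀ A, Antisymm fun B => f A B) (p : α → Prop) :
    Antisymm fun J => shuffleSign p J • f (J.filter p) (J.filter fun x => ¬ p x) := by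
  intro A B H K
  induction A generalizing f with
  | nil =>
    by_cases hH : p H <;> by_cases hK : p K
    · simpa [shuffleSign, hH, hK] using congrArg (shuffleSign p B • ·)
        (h1 (B.filter fun x => ¬ p x) [] (B.filter p) H K)
    · simp [shuffleSign, hH, hK, pow_succ]
    · simp [shuffleSign, hH, hK, pow_succ]
    · simpa [shuffleSign, hH, hK] using congrArg
        (((-1) ^ (B.filter p).length * ((-1) ^ (B.filter p).length * shuffleSign p B)) • ·)
        (h2 (B.filter p) [] (B.filter fun x => ¬ p x) H K)
  | cons M A ih =>
    have hlen : ((A ++ H :: K :: B).filter p).length = ((A ++ K :: H :: B).filter p).length :=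
      ((List.Perm.append_left A (List.Perm.swap K H B)).filter _).length_eq
    simp only [List.cons_append, shuffleSign]
    by_cases hM : p M
    · simpa [hM] using ih (f := fun A B => f (M :: A) B) (fun B => (h1 B).cons M)
        (fun A => h2 (M :: A))
    · have h := ih (f := fun A B => f A (M :: B)) (fun B => h1 (M :: B)) (fun A => (h2 A).cons M)
      simp only [hM, if_false, not_false_eq_true, decide_true, List.filter_cons_of_pos,
        decide_false, List.filter_cons_of_neg, Bool.false_eq_true, mul_smul, hlen]
      rw [← smul_neg]
      exact congrArg _ h

end Shuffle

open scoped TensorProduct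

/-! ### The inverse of the comparison map -/

section

namespace ModularExtension

/-- Separations may be pulled back along full embeddings. -/
theorem IsFullEmbedding.exists_isSep {L₁ L₂ : Type u} [Lattice L₁]
    [BoundedOrder L₁] [Lattice L₂] [BoundedOrder L₂] {X Y : ModularExtension (L₁ × L₂)}
    [Nontrivial L₁] [Nontrivial L₂]
    {φ : X.E → Y.E} (hφ : IsFullEmbedding X Y φ) {P' Q' : Y.E} (h : Y.IsSep P' Q') :
    ∃ P Q, X.IsSep P Q ∧ rk P = rk P' ∧ rk Q = rk Q' ∧ (∀ x, x ≤ P ↔ φ x ≤ P') ∧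
      ∀ x, x ≤ Q ↔ φ x ≤ Q' := by
  have := X.geometric.finite
  have key : ∀ z : Y.E, ∃ w : X.E, ∀ x, x ≤ w ↔ φ x ≤ z := by
    intro z
    set S := (Set.toFinite {x : X.E | φ x ≤ z}).toFinset with hS
    have hsup : φ (S.sup id) ≤ z := by
      refine Finset.sup_induction (p := fun x => φ x ≤ z) ?_ ?_ ?_
      · rw [hφ.map_bot]
        exact bot_le
      · intro x hx y hy
        rw [hφ.map_sup]
        exact sup_le hx hy
      · intro x hx
        simpa [hS] using hx
    refine ⟨S.sup id, fun x => ⟨fun hx => (hφ.le_iff_le.2 hx).trans hsup, fun hx => ?_⟩⟩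
    exact Finset.le_sup (f := id) (by simpa [hS] using hx)
  obtain ⟨P, hP⟩ := key P'
  obtain ⟨Q, hQ⟩ := key Q'
  have h1 : rk P ≤ rk P' := by
    rw [← hφ.rk_map]
    exact rk_mono ((hP P).1 le_rfl)
  have h2 : rk Q ≤ rk Q' := by
    rw [← hφ.rk_map]
    exact rk_mono ((hQ Q).1 le_rfl)
  have h3 := h.rk_add
  have h4 := hφ.rk_top
  have hs : X.IsSep P Q :=
    { rk_le := by omega
      atom_le := fun a ha => by
        rw [hP, hQ]
        exact h.atom_le _ (hφ.map_atom a ha)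
      left_le := by
        rw [hP, ← hφ.map_ι]
        exact h.left_le
      right_le := by
        rw [hQ, ← hφ.map_ι]
        exact h.right_le }
  have h5 := hs.rk_add
  exact ⟨P, Q, hs, by omega, by omega, hP, hQ⟩

variable {L₁ L₂ : Type u} [Lattice L₁] [BoundedOrder L₁] [IsGeometricLattice L₁]
  [Lattice L₂] [BoundedOrder L₂] [IsGeometricLattice L₂]

theorem fstExt_flat_le (X : ModularExtension (L₁ × L₂)) : X.fstExt.flat ≤ X.flat := X.ι_le_flat _

theorem sndExt_flat_le (X : ModularExtension (L₁ × L₂)) : X.sndExt.flat ≤ X.flat := X.ι_le_flat _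

namespace IsSep

variable {X Y : ModularExtension (L₁ × L₂)} {P Q P' Q' : X.E}

/-- The projection `E → [⊥, P]`. -/
def toLeft (h : X.IsSep P Q) (x : X.E) : h.left.E := ⟨x ⊓ P, inf_le_right⟩

/-- The projection `E → [⊥, Q]`. -/
def toRight (h : X.IsSep P Q) (x : X.E) : h.right.E := ⟨x ⊓ Q, inf_le_right⟩

theorem toLeft_of_le (h : X.IsSep P Q) {x : X.E} (hx : x ≤ P) : h.toLeft x = ⟨x, hx⟩ :=
  Subtype.ext (inf_eq_left.2 hx)

theorem toRight_of_le (h : X.IsSep P Q) {x : X.E} (hx : x ≤ Q) : h.toRight x = ⟨x, hx⟩ :=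
  Subtype.ext (inf_eq_left.2 hx)

open Classical in
/-- The subword of the letters below `P`, as a word in `[⊥, P]`. -/
noncomputable def leftWord (h : X.IsSep P Q) (J : List X.E) : List h.left.E :=
  (J.filter fun H => H ≤ P).map h.toLeft

open Classical in
/-- The subword of the letters that are not below `P`, as a word in `[⊥, Q]`. -/
noncomputable def rightWord (h : X.IsSep P Q) (J : List X.E) : List h.right.E :=
  (J.filter fun H => ¬ H ≤ P).map h.toRight

open Classical in
theorem mem_leftWord (h : X.IsSep P Q) {J : List X.E} {x : h.left.E} :
    x ∈ h.leftWord J ↔ x.1 ∈ J := by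
  rw [leftWord, List.mem_map]
  constructor
  · rintro ⟨H, hH, rfl⟩
    obtain ⟨h1, h2⟩ := List.mem_filter.1 hH
    rwa [h.toLeft_of_le (of_decide_eq_true h2)]
  · intro hx
    exact ⟨x.1, List.mem_filter.2 ⟨hx, decide_eq_true x.2⟩, h.toLeft_of_le x.2⟩

open Classical in
theorem mem_rightWord (h : X.IsSep P Q) {J : List X.E} (hJ : ∀ H ∈ J, IsAtom H) {x : h.right.E} :
    x ∈ h.rightWord J ↔ x.1 ∈ J := by
  rw [rightWord, List.mem_map]
  constructor
  · rintro ⟨H, hH, rfl⟩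
    obtain ⟨h1, h2⟩ := List.mem_filter.1 hH
    rwa [h.toRight_of_le ((h.not_le_iff (hJ H h1)).1 (of_decide_eq_true h2))]
  · intro hx
    exact ⟨x.1, List.mem_filter.2 ⟨hx, decide_eq_true ((h.not_le_iff (hJ _ hx)).2 x.2)⟩,
      h.toRight_of_le x.2⟩

theorem leftWord_cons_of_le (h : X.IsSep P Q) {H : X.E} (hH : H ≤ P) (J : List X.E) :
    h.leftWord (H :: J) = ⟨H, hH⟩ :: h.leftWord J := by
  simp [leftWord, hH, toLeft_of_le]

theorem leftWord_cons_of_not_le (h : X.IsSep P Q) {H : X.E} (hH : ¬ H ≤ P) (J : List X.E) :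
    h.leftWord (H :: J) = h.leftWord J := by
  simp [leftWord, hH]

theorem rightWord_cons_of_not_le (h : X.IsSep P Q) {H : X.E} (hHP : ¬ H ≤ P) (hH : H ≤ Q)
    (J : List X.E) : h.rightWord (H :: J) = ⟨H, hH⟩ :: h.rightWord J := by
  simp [rightWord, hHP, h.toRight_of_le hH]

theorem le_span_of_left (h : X.IsSep P Q) {J : List X.E}
    (hs : h.left.span (h.leftWord J) = ⊤) : P ≤ X.span J := by
  have h1 : h.left.span (h.leftWord J) ≤ ⟨X.span J ⊓ P, inf_le_right⟩ := by
    rw [span_le_iff]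
    refine ⟨le_inf (X.fstExt_flat_le.trans (X.flat_le_span J)) h.left_le, fun x hx => ?_⟩
    exact le_inf (X.le_span (h.mem_leftWord.1 hx)) x.2
  rw [hs] at h1
  exact le_trans (show P ≤ X.span J ⊓ P from h1) inf_le_left

theorem le_span_of_right (h : X.IsSep P Q) {J : List X.E} (hJ : ∀ H ∈ J, IsAtom H)
    (hs : h.right.span (h.rightWord J) = ⊤) : Q ≤ X.span J := by
  have h1 : h.right.span (h.rightWord J) ≤ ⟨X.span J ⊓ Q, inf_le_right⟩ := by
    rw [span_le_iff]
    refine ⟨le_inf (X.sndExt_flat_le.trans (X.flat_le_span J)) h.right_le, fun x hx => ?_⟩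
    exact le_inf (X.le_span ((h.mem_rightWord hJ).1 hx)) x.2
  rw [hs] at h1
  exact le_trans (show Q ≤ X.span J ⊓ Q from h1) inf_le_left

end IsSep

end ModularExtension

variable {L₁ L₂ : Type u} [Lattice L₁] [BoundedOrder L₁] [IsGeometricLattice L₁]
  [Lattice L₂] [BoundedOrder L₂] [IsGeometricLattice L₂]

variable {X Y : ModularExtension (L₁ × L₂)} {P Q P' Q' : X.E}

/-- The element of `MD(L₁) ⊗ MD(L₂)` into which a diagram of `L₁ × L₂` separates, with the sign of
sorting its letters into the two factors. -/
noncomputable def MD.sepWord (h : X.IsSep P Q) (J : List X.E) : MD L₁ ⊗[ℚ] MD L₂ :=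
  shuffleSign (· ≤ P) J • (MD.word h.left (h.leftWord J) ⊗ₜ[ℚ] MD.word h.right (h.rightWord J))

theorem MD.sepWord_antisymm (h : X.IsSep P Q) : Antisymm (MD.sepWord h) := by
  classical
  refine antisymm_shuffle (f := fun A B => MD.word h.left (A.map h.toLeft)
    ⊗ₜ[ℚ] MD.word h.right (B.map h.toRight)) (fun B A C H K => ?_)
    (fun B A C H K => ?_) (· ≤ P)
  · have e : MD.word h.left ((A ++ H :: K :: C).map h.toLeft) =
        - MD.word h.left ((A ++ K :: H :: C).map h.toLeft) :=
      (MD.word_antisymm h.left).map h.toLeft A C H K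
    simp only [e, TensorProduct.neg_tmul]
  · have e : MD.word h.right ((A ++ H :: K :: C).map h.toRight) =
        - MD.word h.right ((A ++ K :: H :: C).map h.toRight) :=
      (MD.word_antisymm h.right).map h.toRight A C H K
    simp only [e, TensorProduct.tmul_neg]

theorem MD.sepWord_eq_zero_left (h : X.IsSep P Q) {J : List X.E}
    (h0 : MD.word h.left (h.leftWord J) = 0) : MD.sepWord h J = 0 := by
  rw [MD.sepWord, h0, TensorProduct.zero_tmul, smul_zero]

theorem MD.sepWord_eq_zero_right (h : X.IsSep P Q) {J : List X.E}
    (h0 : MD.word h.right (h.rightWord J) = 0) : MD.sepWord h J = 0 := by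
  rw [MD.sepWord, h0, TensorProduct.tmul_zero, smul_zero]

theorem MD.sepWord_eq_zero_of_span (h : X.IsSep P Q) {J : List X.E} (hJ : ∀ H ∈ J, IsAtom H)
    (hs : X.span J ≠ ⊤) : MD.sepWord h J = 0 := by
  by_cases h1 : h.left.span (h.leftWord J) = ⊤
  · by_cases h2 : h.right.span (h.rightWord J) = ⊤
    · refine absurd (top_le_iff.1 ?_) hs
      rw [← h.sup_eq]
      exact sup_le (h.le_span_of_left h1) (h.le_span_of_right hJ h2)
    · exact MD.sepWord_eq_zero_right h (MD.word_eq_zero_of_span h2)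
  · exact MD.sepWord_eq_zero_left h (MD.word_eq_zero_of_span h1)

/-- If the two letters outside of the modular flat `G` lie in the same factor, then they are the
only ones outside of the modular flat in which `G` meets this factor. Otherwise each of them is a
bridge in its factor. -/
theorem MD.sepWord_eq_zero_of_isModular [Nontrivial L₁] (h : X.IsSep P Q) {G A B : X.E}
    {R : List X.E} (hJ : ∀ H ∈ A :: B :: R, IsAtom H) (hG : IsModular G) (hF : X.flat ≤ G)
    (hA : ¬ A ≤ G) (hB : ¬ B ≤ G) (hR : ∀ K ∈ R, K ≤ G) : MD.sepWord h (A :: B :: R) = 0 := by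
  have hlF : h.left.flat ≤ ⟨G ⊓ P, inf_le_right⟩ := le_inf (X.fstExt_flat_le.trans hF) h.left_le
  have hrF : h.right.flat ≤ ⟨G ⊓ Q, inf_le_right⟩ :=
    le_inf (X.sndExt_flat_le.trans hF) h.right_le
  have hatom : ∀ K ∈ R, IsAtom K := fun K hK =>
    hJ K (List.mem_cons_of_mem _ (List.mem_cons_of_mem _ hK))
  have hl : ∀ x ∈ h.leftWord R, x ≤ ⟨G ⊓ P, inf_le_right⟩ := fun x hx =>
    le_inf (hR _ (h.mem_leftWord.1 hx)) x.2
  have hr : ∀ x ∈ h.rightWord R, x ≤ ⟨G ⊓ Q, inf_le_right⟩ := fun x hx =>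
    le_inf (hR _ ((h.mem_rightWord hatom).1 hx)) x.2
  have hA' := hJ A List.mem_cons_self
  have hB' := hJ B (List.mem_cons_of_mem _ List.mem_cons_self)
  by_cases hAP : A ≤ P
  · refine MD.sepWord_eq_zero_left h ?_
    rw [h.leftWord_cons_of_le hAP]
    by_cases hBP : B ≤ P
    · rw [h.leftWord_cons_of_le hBP]
      exact MD.word_eq_zero_of_isModular (hG.inf_split h.toIsSplit) hlF
        (fun h => hA (le_trans (show A ≤ G ⊓ P from h) inf_le_left))
        (fun h => hB (le_trans (show B ≤ G ⊓ P from h) inf_le_left)) hl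
    · rw [h.leftWord_cons_of_not_le hBP]
      refine MD.word_eq_zero_of_bridge (X := h.left) (H := (⟨A, hAP⟩ : Set.Iic P)) hlF
        (isAtom_Iic_iff.2 hA')
        (fun h => hA (le_trans (show A ≤ G ⊓ P from h) inf_le_left)) fun K hK => ?_
      rcases List.mem_cons.1 hK with rfl | hK
      · exact Or.inr rfl
      · exact Or.inl (hl K hK)
  · have hAQ := (h.not_le_iff hA').1 hAP
    by_cases hBP : B ≤ P
    · refine MD.sepWord_eq_zero_left h ?_
      rw [h.leftWord_cons_of_not_le hAP, h.leftWord_cons_of_le hBP]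
      refine MD.word_eq_zero_of_bridge (X := h.left) (H := (⟨B, hBP⟩ : Set.Iic P)) hlF
        (isAtom_Iic_iff.2 hB')
        (fun h => hB (le_trans (show B ≤ G ⊓ P from h) inf_le_left)) fun K hK => ?_
      rcases List.mem_cons.1 hK with rfl | hK
      · exact Or.inr rfl
      · exact Or.inl (hl K hK)
    · have hBQ := (h.not_le_iff hB').1 hBP
      refine MD.sepWord_eq_zero_right h ?_
      rw [h.rightWord_cons_of_not_le hAP hAQ, h.rightWord_cons_of_not_le hBP hBQ]
      exact MD.word_eq_zero_of_isModular (hG.inf_split h.toIsSplit.symm) hrF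
        (fun h => hA (le_trans (show A ≤ G ⊓ Q from h) inf_le_left))
        (fun h => hB (le_trans (show B ≤ G ⊓ Q from h) inf_le_left)) hr

variable [Nontrivial L₁] [Nontrivial L₂]

theorem MD.sepWord_eq_zero_of_splits (h : X.IsSep P Q) {R S : X.E} (hRS : IsSplit R S)
    (hR : X.flat ≤ R) (hPQ : ¬ P ≤ R ∨ ¬ Q ≤ R) (J : List X.E) : MD.sepWord h J = 0 := by
  rcases hPQ with h1 | h1
  · exact MD.sepWord_eq_zero_left h (MD.word_eq_zero_of_splits
      (X.fstExt.splits_restrict h.left_le hRS (X.fstExt_flat_le.trans hR) h1) _)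
  · exact MD.sepWord_eq_zero_right h (MD.word_eq_zero_of_splits
      (X.sndExt.splits_restrict h.right_le hRS (X.sndExt_flat_le.trans hR) h1) _)

/-- If there are two different separations, then some factor of each of them splits. -/
theorem MD.sepWord_eq_zero_of_ne (h : X.IsSep P Q) (h' : X.IsSep P' Q') (hne : P ≠ P')
    (J : List X.E) : MD.sepWord h J = 0 := by
  by_cases h1 : P ≤ P'
  · have h2 : ¬ Q ≤ Q' := fun h2 => by
      have h3 := rk_strictMono (lt_of_le_of_ne h1 hne)
      have h4 := rk_mono h2
      have h5 := h.rk_add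
      have h6 := h'.rk_add
      omega
    exact MD.sepWord_eq_zero_right h (MD.word_eq_zero_of_splits
      (X.sndExt.splits_restrict h.right_le h'.toIsSplit.symm h'.right_le h2) _)
  · exact MD.sepWord_eq_zero_left h (MD.word_eq_zero_of_splits
      (X.fstExt.splits_restrict h.left_le h'.toIsSplit h'.left_le h1) _)

/-- The element into which a diagram separates does not depend on the choice of the separation. -/
theorem MD.sepWord_eq (h : X.IsSep P Q) (h' : X.IsSep P' Q') (J : List X.E) :
    MD.sepWord h J = MD.sepWord h' J := by
  by_cases hne : P = P'
  · subst hne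
    obtain rfl := h.right_unique h'.toIsSplit
    rfl
  · rw [MD.sepWord_eq_zero_of_ne h h' hne, MD.sepWord_eq_zero_of_ne h' h (Ne.symm hne)]

theorem MD.sepWord_map {φ : X.E → Y.E} (hφ : IsFullEmbedding X Y φ) {J : List X.E}
    (hJ : ∀ H ∈ J, IsAtom H) (h : X.IsSep P Q) {P' Q' : Y.E} (h' : Y.IsSep P' Q') :
    MD.sepWord h' (J.map φ) = MD.sepWord h J := by
  classical
  obtain ⟨P₀, Q₀, h₀, hrP, hrQ, hP, hQ⟩ := hφ.exists_isSep h'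
  rw [MD.sepWord_eq h h₀]
  have hl : IsFullEmbedding h₀.left h'.left (fun x => ⟨φ x.1, (hP x.1).1 x.2⟩) :=
    { injective := fun x y hxy => Subtype.ext (hφ.injective (congrArg Subtype.val hxy))
      map_sup := fun x y => Subtype.ext (hφ.map_sup x.1 y.1)
      map_atom := fun x hx => isAtom_Iic_iff.2 (hφ.map_atom _ (isAtom_Iic_iff.1 hx))
      rk_top := by
        rw [(Iic_geometric P₀).1, (Iic_geometric P').1]
        exact hrP
      map_ι := fun l => Subtype.ext (hφ.map_ι (l, ⊥)) }
  have hr : IsFullEmbedding h₀.right h'.right (fun x => ⟨φ x.1, (hQ x.1).1 x.2⟩) :=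
    { injective := fun x y hxy => Subtype.ext (hφ.injective (congrArg Subtype.val hxy))
      map_sup := fun x y => Subtype.ext (hφ.map_sup x.1 y.1)
      map_atom := fun x hx => isAtom_Iic_iff.2 (hφ.map_atom _ (isAtom_Iic_iff.1 hx))
      rk_top := by
        rw [(Iic_geometric Q₀).1, (Iic_geometric Q').1]
        exact hrQ
      map_ι := fun l => Subtype.ext (hφ.map_ι (⊥, l)) }
  have e1 : h'.leftWord (J.map φ) =
      (h₀.leftWord J).map (fun x => ⟨φ x.1, (hP x.1).1 x.2⟩) := by
    rw [IsSep.leftWord, IsSep.leftWord, List.filter_map, List.map_map, List.map_map]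
    have : (J.filter ((fun H => decide (H ≤ P')) ∘ φ)) = J.filter fun H => H ≤ P₀ :=
      List.filter_congr fun x _ => by simp [hP]
    rw [this]
    refine List.map_congr_left fun x hx => Subtype.ext ?_
    have hx' : x ≤ P₀ := of_decide_eq_true (List.mem_filter.1 hx).2
    show φ x ⊓ P' = φ (x ⊓ P₀)
    rw [inf_eq_left.2 hx', inf_eq_left.2 ((hP x).1 hx')]
  have e2 : h'.rightWord (J.map φ) =
      (h₀.rightWord J).map (fun x => ⟨φ x.1, (hQ x.1).1 x.2⟩) := by
    rw [IsSep.rightWord, IsSep.rightWord, List.filter_map, List.map_map, List.map_map]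
    have : (J.filter ((fun H => decide ¬ H ≤ P') ∘ φ)) = J.filter fun H => ¬ H ≤ P₀ :=
      List.filter_congr fun x _ => by simp [hP]
    rw [this]
    refine List.map_congr_left fun x hx => Subtype.ext ?_
    have hx' : x ≤ Q₀ := (h₀.not_le_iff (hJ x (List.mem_filter.1 hx).1)).1
      (of_decide_eq_true (List.mem_filter.1 hx).2)
    show φ x ⊓ Q' = φ (x ⊓ Q₀)
    rw [inf_eq_left.2 hx', inf_eq_left.2 ((hQ x).1 hx')]
  rw [MD.sepWord, MD.sepWord, e1, e2, MD.word_map hl, MD.word_map hr, shuffleSign_map]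
  simp only [hP]

/-- The value of the inverse of the comparison map on the diagram with the word `J`. -/
noncomputable def MD.unprodWord (X : ModularExtension (L₁ × L₂)) (J : List X.E) :
    MD L₁ ⊗[ℚ] MD L₂ :=
  MD.sepWord X.exists_isSep.choose_spec.choose_spec J

theorem MD.unprodWord_eq (h : X.IsSep P Q) (J : List X.E) :
    MD.unprodWord X J = MD.sepWord h J :=
  MD.sepWord_eq _ h J

theorem MD.isInvariant_unprodWord : IsInvariant (MD.unprodWord (L₁ := L₁) (L₂ := L₂)) where
  antisymm X := MD.sepWord_antisymm _
  map hφ J hJ := MD.sepWord_map hφ hJ _ _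
  span hJ hs := MD.sepWord_eq_zero_of_span _ hJ hs
  splits {X J} _ h := by
    obtain ⟨R, S, hRS, hR, hS⟩ := h
    obtain ⟨P, Q, h⟩ := X.exists_isSep
    rw [MD.unprodWord_eq h]
    refine MD.sepWord_eq_zero_of_splits h hRS hR ?_ J
    by_contra! hc
    refine hS ?_
    have h1 : R = ⊤ := top_le_iff.1 (h.sup_eq ▸ sup_le hc.1 hc.2)
    rw [← hRS.inf_eq, h1, top_inf_eq]
  modular hJ hG hF hA hB hR := MD.sepWord_eq_zero_of_isModular _ hJ hG hF hA hB hR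

end

/-! ### The isomorphism of cdgas -/

section Iso

variable {L₁ L₂ : Type u} [Lattice L₁] [BoundedOrder L₁] [IsGeometricLattice L₁]
  [Lattice L₂] [BoundedOrder L₂] [IsGeometricLattice L₂]

namespace ModularExtension

/-- The obvious separation of a product. -/
theorem isSep_prod (X : ModularExtension L₁) (Y : ModularExtension L₂) :
    (X.prod Y).IsSep (X.prMk Y ⊤ ⊥) (X.prMk Y ⊥ ⊤) where
  toIsSplit := isSplit_prod (E₁ := X.E) (E₂ := Y.E)
  left_le := ⟨le_top, Y.ι_bot.le⟩
  right_le := ⟨X.ι_bot.le, le_top⟩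

theorem isFullEmbedding_prod_left (X : ModularExtension L₁) (Y : ModularExtension L₂) :
    IsFullEmbedding X (X.isSep_prod Y).left (fun x => ⟨X.prInl Y x, le_top, le_rfl⟩) where
  injective x y h := congrArg (X.prFst Y) (congrArg Subtype.val h)
  map_sup x y := Subtype.ext (pr_ext rfl (sup_idem ⊥).symm)
  map_atom x hx := isAtom_Iic_iff.2 (isAtom_prInl_iff.2 hx)
  rk_top := by
    rw [(Iic_geometric (X.prMk Y ⊤ ⊥)).1]
    show _ = rk (X.prMk Y ⊤ ⊥)
    rw [rk_pr, prFst_mk, prSnd_mk, rk_bot, add_zero]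
  map_ι l := Subtype.ext (pr_ext rfl Y.ι_bot)

theorem isFullEmbedding_prod_right (X : ModularExtension L₁) (Y : ModularExtension L₂) :
    IsFullEmbedding Y (X.isSep_prod Y).right (fun y => ⟨X.prInr Y y, le_rfl, le_top⟩) where
  injective x y h := congrArg (X.prSnd Y) (congrArg Subtype.val h)
  map_sup x y := Subtype.ext (pr_ext (sup_idem ⊥).symm rfl)
  map_atom x hx := isAtom_Iic_iff.2 (isAtom_prInr_iff.2 hx)
  rk_top := by
    rw [(Iic_geometric (X.prMk Y ⊥ ⊤)).1]
    show _ = rk (X.prMk Y ⊥ ⊤)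
    rw [rk_pr, prFst_mk, prSnd_mk, rk_bot, zero_add]
  map_ι l := Subtype.ext (pr_ext X.ι_bot rfl)

theorem not_prInr_le {X : ModularExtension L₁} {Y : ModularExtension L₂} {y : Y.E}
    (hy : IsAtom y) : ¬ X.prInr Y y ≤ X.prMk Y ⊤ ⊥ := fun h =>
  hy.1 (le_bot_iff.1 (prInr_le_iff.1 h))

theorem leftWord_prod (X : ModularExtension L₁) (J : List X.E) (Y : ModularExtension L₂)
    {K : List Y.E} (hK : ∀ H ∈ K, IsAtom H) :
    (X.isSep_prod Y).leftWord (J.map (X.prInl Y) ++ K.map (X.prInr Y)) =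
      J.map fun x => ⟨X.prInl Y x, le_top, le_rfl⟩ := by
  classical
  rw [IsSep.leftWord, List.filter_append, List.filter_eq_self.2, List.filter_eq_nil_iff.2,
    List.append_nil, List.map_map]
  · exact List.map_congr_left fun x _ => (X.isSep_prod Y).toLeft_of_le
      (x := X.prInl Y x) ⟨le_top, le_rfl⟩
  · intro z hz
    obtain ⟨y, hy, rfl⟩ := List.mem_map.1 hz
    simpa using not_prInr_le (hK y hy)
  · intro z hz
    obtain ⟨x, _, rfl⟩ := List.mem_map.1 hz
    exact decide_eq_true ⟨le_top, le_rfl⟩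

theorem rightWord_prod (X : ModularExtension L₁) (J : List X.E) (Y : ModularExtension L₂)
    {K : List Y.E} (hK : ∀ H ∈ K, IsAtom H) :
    (X.isSep_prod Y).rightWord (J.map (X.prInl Y) ++ K.map (X.prInr Y)) =
      K.map fun y => ⟨X.prInr Y y, le_rfl, le_top⟩ := by
  classical
  rw [IsSep.rightWord, List.filter_append, List.filter_eq_nil_iff.2, List.filter_eq_self.2,
    List.nil_append, List.map_map]
  · exact List.map_congr_left fun x _ => (X.isSep_prod Y).toRight_of_le
      (x := X.prInr Y x) ⟨le_rfl, le_top⟩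
  · intro z hz
    obtain ⟨y, hy, rfl⟩ := List.mem_map.1 hz
    exact decide_eq_true (not_prInr_le (hK y hy))
  · intro z hz
    obtain ⟨x, _, rfl⟩ := List.mem_map.1 hz
    have h : X.prInl Y x ≤ X.prMk Y ⊤ ⊥ := ⟨le_top, le_rfl⟩
    simpa using h

namespace IsSep

variable {X : ModularExtension (L₁ × L₂)} {P Q : X.E}

theorem isFullEmbedding (h : X.IsSep P Q) :
    IsFullEmbedding X (h.left.prod h.right) h.prodIso :=
  isFullEmbedding_orderIso h.prodIso h.prodIso_ι

open Classical in
theorem map_filter_append_filter (h : X.IsSep P Q) {J : List X.E} (hJ : ∀ H ∈ J, IsAtom H) :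
    ((J.filter fun H => H ≤ P) ++ J.filter fun H => ¬ H ≤ P).map h.prodIso =
      (h.leftWord J).map (h.left.prInl h.right) ++
        (h.rightWord J).map (h.left.prInr h.right) := by
  have hbot : P ⊓ Q = ⊥ := h.inf_eq
  rw [List.map_append, leftWord, rightWord, List.map_map, List.map_map]
  congr 1
  · refine List.map_congr_left fun x hx => pr_ext (X := h.left) (Y := h.right) rfl
      (Subtype.ext ?_)
    have hx' : x ≤ P := of_decide_eq_true (List.mem_filter.1 hx).2
    exact le_bot_iff.1 (hbot ▸ inf_le_inf_right Q hx')
  · refine List.map_congr_left fun x hx => pr_ext (X := h.left) (Y := h.right) (Subtype.ext ?_)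
      rfl
    have hx' : x ≤ Q := (h.not_le_iff (hJ x (List.mem_filter.1 hx).1)).1
      (of_decide_eq_true (List.mem_filter.1 hx).2)
    rw [inf_comm] at hbot
    exact le_bot_iff.1 (hbot ▸ inf_le_inf_right P hx')

/-- The degrees of the two words into which a word separates add up to its degree. -/
theorem wordDeg_add (h : X.IsSep P Q) [Nontrivial L₁] [Nontrivial L₂] {J : List X.E}
    (hJ : ∀ H ∈ J, IsAtom H) :
    h.left.wordDeg (h.leftWord J) + h.right.wordDeg (h.rightWord J) = X.wordDeg J := by
  classical
  rw [← pr_wordDeg, ← h.map_filter_append_filter hJ, h.isFullEmbedding.wordDeg]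
  refine X.wordDeg_perm ?_
  simpa using List.filter_append_perm (fun H => decide (H ≤ P)) J

end IsSep

end ModularExtension

variable [Nontrivial L₁] [Nontrivial L₂]

/-- Up to sign, every diagram of `L₁ × L₂` is a product of diagrams. -/
theorem MD.word_eq_prodWord {X : ModularExtension (L₁ × L₂)} {P Q : X.E} (h : X.IsSep P Q)
    {J : List X.E} (hJ : ∀ H ∈ J, IsAtom H) : MD.word X J = shuffleSign (· ≤ P) J •
      MD.prodWord h.left (h.leftWord J) h.right (h.rightWord J) := by
  classical
  rw [MD.prodWord, ← h.map_filter_append_filter hJ, MD.word_map h.isFullEmbedding]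
  exact (MD.word_antisymm X).eq_shuffleSign_smul (· ≤ P) J

/-- The comparison map `MD(L₁) ⊗ MD(L₂) → MD(L₁ × L₂)`. -/
noncomputable def MD.tensorHom : MD L₁ ⊗[ℚ] MD L₂ →ₗ[ℚ] MD (L₁ × L₂) :=
  TensorProduct.lift MD.prodHom

theorem MD.tensorHom_tmul (x : MD L₁) (y : MD L₂) :
    MD.tensorHom (x ⊗ₜ[ℚ] y) = MD.prodHom x y := TensorProduct.lift.tmul x y

/-- The inverse `MD(L₁ × L₂) → MD(L₁) ⊗ MD(L₂)` of the comparison map. -/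
noncomputable def MD.unprodHom : MD (L₁ × L₂) →ₗ[ℚ] MD L₁ ⊗[ℚ] MD L₂ :=
  MD.lift MD.unprodWord MD.isInvariant_unprodWord

theorem MD.unprodHom_word {X : ModularExtension (L₁ × L₂)} {P Q : X.E} (h : X.IsSep P Q)
    {J : List X.E} (hJ : ∀ H ∈ J, IsAtom H) : MD.unprodHom (MD.word X J) = MD.sepWord h J := by
  rw [MD.unprodHom, MD.lift_word _ _ X hJ, MD.unprodWord_eq h]

theorem MD.tensorHom_unprodHom (x : MD (L₁ × L₂)) : MD.tensorHom (MD.unprodHom x) = x := by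
  refine MD.induction x (by simp) (fun x y hx hy => by rw [map_add, map_add, hx, hy])
    (fun c x hx => by rw [map_smul, map_smul, hx]) fun X J hJ => ?_
  obtain ⟨P, Q, h⟩ := X.exists_isSep
  rw [MD.unprodHom_word h hJ, MD.sepWord, map_zsmul, MD.tensorHom_tmul, MD.prodHom_word,
    ← MD.word_eq_prodWord h hJ]

theorem MD.unprodHom_prodHom (x : MD L₁) (y : MD L₂) :
    MD.unprodHom (MD.prodHom x y) = x ⊗ₜ[ℚ] y := by
  refine MD.induction x (by simp) (fun x x' hx hx' => by
    rw [map_add, LinearMap.add_apply, map_add, hx, hx', TensorProduct.add_tmul])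
    (fun c x hx => by
      rw [map_smul, LinearMap.smul_apply, map_smul, hx, TensorProduct.smul_tmul'])
    fun X J hJ => ?_
  refine MD.induction y (by simp) (fun y y' hy hy' => by
    rw [map_add, map_add, hy, hy', TensorProduct.tmul_add])
    (fun c y hy => by rw [map_smul, map_smul, hy, TensorProduct.tmul_smul]) fun Y K hK => ?_
  have h : ∀ H ∈ J.map (X.prInl Y) ++ K.map (X.prInr Y), IsAtom H := by
    intro H hH
    rcases List.mem_append.1 hH with h | h
    · obtain ⟨N, hN, rfl⟩ := List.mem_map.1 h
      exact isAtom_prInl_iff.2 (hJ N hN)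
    · obtain ⟨N, hN, rfl⟩ := List.mem_map.1 h
      exact isAtom_prInr_iff.2 (hK N hN)
  rw [MD.prodHom_word, MD.prodWord, MD.unprodHom_word (X.isSep_prod Y) h, MD.sepWord,
    leftWord_prod X J Y hK, rightWord_prod X J Y hK, MD.word_map (X.isFullEmbedding_prod_left Y),
    MD.word_map (X.isFullEmbedding_prod_right Y), shuffleSign_append_eq_one, one_smul]
  · intro z hz
    obtain ⟨x, _, rfl⟩ := List.mem_map.1 hz
    exact ⟨le_top, le_rfl⟩
  · intro z hz
    obtain ⟨y, hy, rfl⟩ := List.mem_map.1 hz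
    exact not_prInr_le (hK y hy)

/-- The linear isomorphism `MD(L₁) ⊗ MD(L₂) ≃ MD(L₁ × L₂)`. -/
noncomputable def MD.tensorEquiv : MD L₁ ⊗[ℚ] MD L₂ ≃ₗ[ℚ] MD (L₁ × L₂) :=
  LinearEquiv.ofLinearMap MD.tensorHom MD.unprodHom (LinearMap.ext MD.tensorHom_unprodHom)
    (TensorProduct.ext' fun x y => by
      rw [LinearMap.comp_apply, MD.tensorHom_tmul, MD.unprodHom_prodHom, LinearMap.id_apply])

theorem MD.prodHom_mem {i j : ℤ} {x : MD L₁} {y : MD L₂} (hx : x ∈ MD.gr L₁ i)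
    (hy : y ∈ MD.gr L₂ j) : MD.prodHom x y ∈ MD.gr (L₁ × L₂) (i + j) := by
  refine MD.gr_induction hx (by simp) (fun x x' hx hx' => by
    rw [map_add]; exact add_mem hx hx')
    (fun c x hx => by rw [map_smul]; exact Submodule.smul_mem _ _ hx) ?_
  rintro X J _ rfl
  refine MD.gr_induction hy (by simp) (fun x x' hx hx' => by
    rw [map_add]; exact add_mem hx hx')
    (fun c x hx => by rw [map_smul]; exact Submodule.smul_mem _ _ hx) ?_
  rintro Y K _ rfl
  rw [MD.prodHom_word, MD.prodWord, ← pr_wordDeg]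
  exact MD.word_mem_gr _ _

theorem MD.tensorHom_mem {n : ℤ} {x : MD L₁ ⊗[ℚ] MD L₂}
    (hx : x ∈ CDGA.tensorGr (MD.algebra L₁).toCDGA (MD.algebra L₂).toCDGA n) :
    MD.tensorHom x ∈ MD.gr (L₁ × L₂) n := by
  induction hx using Submodule.span_induction with
  | zero => rw [map_zero]; exact Submodule.zero_mem _
  | add x y _ _ hx hy => rw [map_add]; exact add_mem hx hy
  | smul c x _ hx => rw [map_smul]; exact Submodule.smul_mem _ c hx
  | mem x hx =>
    obtain ⟨i, j, a, b, rfl, ha, hb, rfl⟩ := hx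
    rw [MD.tensorHom_tmul]
    exact MD.prodHom_mem ha hb

theorem MD.unprodHom_mem {n : ℤ} {x : MD (L₁ × L₂)} (hx : x ∈ MD.gr (L₁ × L₂) n) :
    MD.unprodHom x ∈ CDGA.tensorGr (MD.algebra L₁).toCDGA (MD.algebra L₂).toCDGA n := by
  refine MD.gr_induction hx (by simp) (fun x x' hx hx' => by
    rw [map_add]; exact add_mem hx hx')
    (fun c x hx => by rw [map_smul]; exact Submodule.smul_mem _ _ hx) ?_
  rintro X J hJ rfl
  obtain ⟨P, Q, h⟩ := X.exists_isSep
  rw [MD.unprodHom_word h hJ, MD.sepWord, ← h.wordDeg_add hJ]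
  exact zsmul_mem (CDGA.tmul_mem_tensorGr _ _ (MD.word_mem_gr _ _) (MD.word_mem_gr _ _)) _

theorem MD.tensorHom_mul (x y : MD L₁ ⊗[ℚ] MD L₂) :
    MD.tensorHom (CDGA.tensorMul (MD.algebra L₁).toCDGA (MD.algebra L₂).toCDGA x y) =
      MD.mul (MD.tensorHom x) (MD.tensorHom y) := by
  induction x using TensorProduct.induction_on with
  | zero => simp
  | add x x' hx hx' => simp only [map_add, LinearMap.add_apply, hx, hx']
  | tmul a b =>
  induction y using TensorProduct.induction_on with
  | zero => simp
  | add y y' hy hy' => simp only [map_add, hy, hy']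
  | tmul a' b' =>
  refine MD.induction a (by simp) (fun x x' hx hx' => by
    simp only [TensorProduct.add_tmul, map_add, LinearMap.add_apply, hx, hx'])
    (fun c x hx => by
      rw [← TensorProduct.smul_tmul', map_smul, map_smul, LinearMap.smul_apply, map_smul, hx,
        map_smul, LinearMap.smul_apply]) fun X J _ => ?_
  refine MD.induction b (by simp) (fun x x' hx hx' => by
    simp only [TensorProduct.tmul_add, map_add, LinearMap.add_apply, hx, hx'])
    (fun c x hx => by
      rw [TensorProduct.tmul_smul, map_smul, map_smul, LinearMap.smul_apply, map_smul, hx,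
        map_smul, LinearMap.smul_apply]) fun Y K _ => ?_
  refine MD.induction a' (by simp) (fun x x' hx hx' => by
    simp only [TensorProduct.add_tmul, map_add, hx, hx'])
    (fun c x hx => by
      rw [← TensorProduct.smul_tmul', map_smul, map_smul, hx, map_smul, map_smul])
    fun X' J' _ => ?_
  refine MD.induction b' (by simp) (fun x x' hx hx' => by
    simp only [TensorProduct.tmul_add, map_add, hx, hx'])
    (fun c x hx => by
      rw [TensorProduct.tmul_smul, map_smul, map_smul, hx, map_smul, map_smul])
    fun Y' K' _ => ?_
  have h := CDGA.tensorMul_tmul (MD.algebra L₁).toCDGA (MD.algebra L₂).toCDGA (MD.word X J)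
    (MD.word Y' K') (MD.word_mem_gr Y K) (MD.word_mem_gr X' J')
  rw [h, map_smul, MD.tensorHom_tmul, MD.tensorHom_tmul, MD.tensorHom_tmul, MD.prodHom_word,
    MD.prodHom_word, MD.prodWord_mul, neg_one_pow_int_smul, neg_one_zpow_mul_wordDeg]
  rfl

theorem MD.tensorHom_d (x : MD L₁ ⊗[ℚ] MD L₂) :
    MD.tensorHom (CDGA.tensorD (MD.algebra L₁).toCDGA (MD.algebra L₂).toCDGA x) =
      MD.d (MD.tensorHom x) := by
  induction x using TensorProduct.induction_on with
  | zero => simp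
  | add x x' hx hx' => simp only [map_add, hx, hx']
  | tmul a b =>
  refine MD.induction a (by simp) (fun x x' hx hx' => by
    simp only [TensorProduct.add_tmul, map_add, hx, hx'])
    (fun c x hx => by
      rw [← TensorProduct.smul_tmul', map_smul, map_smul, hx, map_smul, map_smul])
    fun X J hJ => ?_
  refine MD.induction b (by simp) (fun x x' hx hx' => by
    simp only [TensorProduct.tmul_add, map_add, hx, hx'])
    (fun c x hx => by
      rw [TensorProduct.tmul_smul, map_smul, map_smul, hx, map_smul, map_smul])
    fun Y K hK => ?_
  have h := CDGA.tensorD_tmul (MD.algebra L₁).toCDGA (MD.algebra L₂).toCDGA (MD.word Y K)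
    (MD.word_mem_gr X J)
  rw [h, map_add, map_smul, MD.tensorHom_tmul, MD.tensorHom_tmul, MD.tensorHom_tmul,
    MD.prodHom_word, MD.d_prodWord hJ hK, neg_one_pow_int_smul, neg_one_zpow_wordDeg]
  rfl

/-- The isomorphism of cdgas `MD(L₁) ⊗ MD(L₂) ≃ MD(L₁ × L₂)`. -/
noncomputable def MD.tensorIso : CDGA.Iso
    ((MD.algebra L₁).toCDGA.tensor (MD.algebra L₂).toCDGA) (MD.algebra (L₁ × L₂)).toCDGA where
  toLinearEquiv := MD.tensorEquiv
  map_gr n x := by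
    refine ⟨fun h => ?_, MD.tensorHom_mem⟩
    have h1 : MD.unprodHom (MD.tensorEquiv x) ∈ _ := MD.unprodHom_mem h
    rwa [show MD.unprodHom (MD.tensorEquiv x) = x from MD.tensorEquiv.symm_apply_apply x] at h1
  map_one := (MD.tensorHom_tmul _ _).trans MD.prodHom_one
  map_mul := MD.tensorHom_mul
  map_d := MD.tensorHom_d

end Iso

end ModularDiagrams

theorem mainTheorem6 {L₁ L₂ : Type u}
    [Lattice L₁] [BoundedOrder L₁] [IsGeometricLattice L₁] [Nontrivial L₁]
    [Lattice L₂] [BoundedOrder L₂] [IsGeometricLattice L₂] [Nontrivial L₂] :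
    (∃ (A₁ : MDAlgebra L₁) (A₂ : MDAlgebra L₂) (A : MDAlgebra (L₁ × L₂))
        (Φ : CDGA.Iso (A₁.toCDGA.tensor A₂.toCDGA) A.toCDGA),
        ∀ (Γ₁ : ModularDiagram L₁) (Γ₂ : ModularDiagram L₂),
          Φ.toLinearEquiv (MD.mk Γ₁ ⊗ₜ[ℚ] MD.mk Γ₂) = MD.mk (Γ₁.prod Γ₂)) ∧
      ∀ X : ModularExtension (L₁ × L₂),
        ∃ (X₁ : ModularExtension L₁) (X₂ : ModularExtension L₂) (e : X.E ≃o (X₁.prod X₂).E),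
          ∀ l : L₁ × L₂, e (X.ι l) = (X₁.prod X₂).ι l := by
  refine ⟨⟨MD.algebra L₁, MD.algebra L₂, MD.algebra (L₁ × L₂), MD.tensorIso, fun Γ₁ Γ₂ =>
    (MD.tensorHom_tmul _ _).trans (MD.prodHom_mk Γ₁ Γ₂)⟩, fun X => ?_⟩
  obtain ⟨P, Q, h⟩ := X.exists_isSep
  exact ⟨h.left, h.right, h.prodIso, h.prodIso_ι⟩
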